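/- Let $U$ be a connected Riemann surface, $x$ a non-constant meromorphic function on $U$, and let $K$ be a functional differential field on $(U,x)$, i.e. a subfield of the field of meromorphic functions on $U$ that contains all complex constants and is closed under the derivation $f\mapsto f'=df/dx$. Multivalued functions on $U$ are understood through their analytic germs, up to analytic continuation. The \emph{basic elementary functions} are the complex constants, the independent variable $z$, $\exp$, $\ln$, $z^\alpha$ ($\alpha\in\mathbb C$), $\sin,\cos,\tan,\cot$, and the inverse trigonometric functions $\arcsin,\arccos,\arctan,\operatorname{arccot}$. The \emph{generalized elementary functions of one variable} are the (multivalued) functions on $\mathbb C$ obtained from the basic elementary functions by repeated application of composition, arithmetic operations, differentiation, solving algebraic equations $y^n+f_1y^{n-1}+\dots+f_n=0$, and analytic continuation. The \emph{generalized elementary functions over $K$} are the (multivalued) functions on $U$ obtained from the functions in $K$ by repeated application of composition $f\mapsto\varphi\circ f$ with generalized elementary functions $\varphi$ of one variable, arithmetic operations, the derivation $d/dx$, solving algebraic equations, and analytic continuation. \textbf{Liouville's First Theorem.} Let $f\in K$ and let $y$ be an integral of $f$, i.e. an analytic germ at a point $p\in U$ with $dy/dx=f$ near $p$. Then $y$ is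 a germ of a generalized elementary function over $K$ if and only if there are $m\ge 0$, functions $r_0,r_1,\dots,r_m\in K$ and complex constants $\lambda_1,\dots,\lambda_m$ such that $$y=r_0+\sum_{i=1}^m\lambda_i\ln r_i$$ near $p$, in the sense that in a neighbourhood of every point $q\neq p$ sufficiently close to $p$ this identity holds for suitable branches of the logarithms $\ln r_i$. -/

import Mathlib

open Filter Topology
open scoped Manifold ContDiff

noncomputable section

namespace Liouville

/-! ### Functions on a Riemann surface -/

section Surface

variable {U : Type*} [TopologicalSpace U] [ChartedSpace ℂ U]

/-- `f`, read in the preferred chart at `p`. -/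
def inChart (f : U → ℂ) (p : U) : ℂ → ℂ := f ∘ (chartAt ℂ p).symm

/-- `f` is holomorphic in a neighbourhood of `p`, i.e. it defines an analytic germ at `p`. -/
def HolAt (f : U → ℂ) (p : U) : Prop := AnalyticAt ℂ (inChart f p) (chartAt ℂ p p)

/-- `f` is meromorphic on `U`.  As for Mathlib's `MeromorphicAt`, the values of `f` on a closed
discrete set do not matter: two such functions are the same meromorphic function if and only if
they agree off a closed discrete set, i.e. `f =ᶠ[codiscrete U] g`. -/
def IsMeromorphic (f : U → ℂ) : Prop :=
  ∀ p, MeromorphicAt (inChart f p) (chartAt ℂ p p)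

/-- `x` is not a constant meromorphic function. -/
def IsNonconstant (x : U → ℂ) : Prop := ¬ ∃ c : ℂ, x =ᶠ[codiscrete U] fun _ => c

/-- The coordinate derivative of `f` at `p`, in the preferred chart at `p`. -/
def chartDeriv (f : U → ℂ) (p : U) : ℂ := deriv (inChart f p) (chartAt ℂ p p)

/-- The derivative `df / dx` with respect to the function `x`.  The ratio does not depend on the
chart wherever `f` and `x` are holomorphic and `dx ≠ 0`. -/
def derivWrt (x f : U → ℂ) : U → ℂ := fun p => chartDeriv f p / chartDeriv x p

/-- A functional differential field: a differential subfield, containing the complex constants, of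
the field of meromorphic functions on `U` with the derivation `f ↦ df / dx`.  It is given as the
set of all functions `U → ℂ` that represent one of its elements (hence `saturated`); the inverse
of a nonzero element is represented by the pointwise inverse. -/
structure IsFunctionalDifferentialField (x : U → ℂ) (K : Subalgebra ℂ (U → ℂ)) : Prop where
  meromorphic : ∀ f ∈ K, IsMeromorphic f
  saturated : ∀ f ∈ K, ∀ g : U → ℂ, f =ᶠ[codiscrete U] g → g ∈ K
  inv_mem : ∀ f ∈ K, f⁻¹ ∈ K
  deriv_mem : ∀ f ∈ K, derivWrt x f ∈ K

/-- The germ of `g` at `q` is obtained from the germ of `f` at `p` by analytic continuation inside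
one connected open set.  Repeating this gives all analytic continuations along paths. -/
def IsDirectContinuation (f : U → ℂ) (p : U) (g : U → ℂ) (q : U) : Prop :=
  ∃ W : Set U, IsOpen W ∧ IsPreconnected W ∧ p ∈ W ∧ q ∈ W ∧
    ∃ h : U → ℂ, (∀ w ∈ W, HolAt h w) ∧ h =ᶠ[𝓝 p] f ∧ h =ᶠ[𝓝 q] g

end Surface

/-! ### Generalized elementary functions of one complex variable

A multivalued function is represented by its analytic germs; `P f p` means that the germ of `f` at
`p` is a germ of a function of the class `P`. -/

/-- The germs of the basic elementary functions.  The multivalued ones are given by all their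
branches. -/
inductive IsBasicElementary : (ℂ → ℂ) → ℂ → Prop
  | const (c b : ℂ) : IsBasicElementary (fun _ => c) b
  | var (b : ℂ) : IsBasicElementary (fun z => z) b
  | exp (b : ℂ) : IsBasicElementary Complex.exp b
  | log (b : ℂ) (g : ℂ → ℂ) (hg : AnalyticAt ℂ g b) (h : ∀ᶠ z in 𝓝 b, Complex.exp (g z) = z) :
      IsBasicElementary g b
  | pow (α b : ℂ) (g : ℂ → ℂ) (hg : AnalyticAt ℂ g b)
      (h : ∀ᶠ z in 𝓝 b, Complex.exp (g z) = z) :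
      IsBasicElementary (fun z => Complex.exp (α * g z)) b
  | sin (b : ℂ) : IsBasicElementary Complex.sin b
  | cos (b : ℂ) : IsBasicElementary Complex.cos b
  | tan (b : ℂ) (hb : Complex.cos b ≠ 0) : IsBasicElementary Complex.tan b
  | cot (b : ℂ) (hb : Complex.sin b ≠ 0) : IsBasicElementary Complex.cot b
  | arcsin (b : ℂ) (g : ℂ → ℂ) (hg : AnalyticAt ℂ g b)
      (h : ∀ᶠ z in 𝓝 b, Complex.sin (g z) = z) : IsBasicElementary g b
  | arccos (b : ℂ) (g : ℂ → ℂ) (hg : AnalyticAt ℂ g b)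
      (h : ∀ᶠ z in 𝓝 b, Complex.cos (g z) = z) : IsBasicElementary g b
  | arctan (b : ℂ) (g : ℂ → ℂ) (hg : AnalyticAt ℂ g b)
      (h : ∀ᶠ z in 𝓝 b, Complex.sin (g z) = z * Complex.cos (g z)) : IsBasicElementary g b
  | arccot (b : ℂ) (g : ℂ → ℂ) (hg : AnalyticAt ℂ g b)
      (h : ∀ᶠ z in 𝓝 b, Complex.cos (g z) = z * Complex.sin (g z)) : IsBasicElementary g b

/-- Generalized elementary functions of one variable: generated by the basic elementary functions
under composition, arithmetic operations, differentiation, solving algebraic equations, and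
analytic continuation. -/
inductive IsGenElementary : (ℂ → ℂ) → ℂ → Prop
  | basic {f : ℂ → ℂ} {b : ℂ} (hf : IsBasicElementary f b) : IsGenElementary f b
  | continuation {f g : ℂ → ℂ} {b c : ℂ} (hf : IsGenElementary f b)
      (h : IsDirectContinuation f b g c) : IsGenElementary g c
  | comp {f g : ℂ → ℂ} {b : ℂ} (hf : IsGenElementary f (g b)) (hg : IsGenElementary g b) :
      IsGenElementary (fun z => f (g z)) b
  | add {f g : ℂ → ℂ} {b : ℂ} (hf : IsGenElementary f b) (hg : IsGenElementary g b) :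
      IsGenElementary (fun z => f z + g z) b
  | sub {f g : ℂ → ℂ} {b : ℂ} (hf : IsGenElementary f b) (hg : IsGenElementary g b) :
      IsGenElementary (fun z => f z - g z) b
  | mul {f g : ℂ → ℂ} {b : ℂ} (hf : IsGenElementary f b) (hg : IsGenElementary g b) :
      IsGenElementary (fun z => f z * g z) b
  | div {f g : ℂ → ℂ} {b : ℂ} (hf : IsGenElementary f b) (hg : IsGenElementary g b)
      (h : g b ≠ 0) : IsGenElementary (fun z => f z / g z) b
  | deriv {f : ℂ → ℂ} {b : ℂ} (hf : IsGenElementary f b) : IsGenElementary (deriv f) b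
  | solve {n : ℕ} {c : Fin n → ℂ → ℂ} {y : ℂ → ℂ} {b : ℂ} (hc : ∀ i, IsGenElementary (c i) b)
      (hy : AnalyticAt ℂ y b)
      (h : ∀ᶠ z in 𝓝 b, y z ^ n + ∑ i, c i z * y z ^ (i : ℕ) = 0) : IsGenElementary y b

section Over

variable {U : Type*} [TopologicalSpace U] [ChartedSpace ℂ U]

/-- Generalized elementary functions over `K`: generated by the functions of `K` under
composition `f ↦ φ ∘ f` with generalized elementary functions `φ` of one variable, arithmetic
operations, differentiation, solving algebraic equations, and analytic continuation. -/
inductive IsGenElementaryOver (x : U → ℂ) (K : Subalgebra ℂ (U → ℂ)) : (U → ℂ) → U → Prop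
  | basic {f : U → ℂ} {p : U} (hf : f ∈ K) (hp : HolAt f p) : IsGenElementaryOver x K f p
  | continuation {f g : U → ℂ} {p q : U} (hf : IsGenElementaryOver x K f p)
      (h : IsDirectContinuation f p g q) : IsGenElementaryOver x K g q
  | comp {φ : ℂ → ℂ} {f : U → ℂ} {p : U} (hφ : IsGenElementary φ (f p))
      (hf : IsGenElementaryOver x K f p) : IsGenElementaryOver x K (fun u => φ (f u)) p
  | add {f g : U → ℂ} {p : U} (hf : IsGenElementaryOver x K f p)
      (hg : IsGenElementaryOver x K g p) : IsGenElementaryOver x K (fun u => f u + g u) p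
  | sub {f g : U → ℂ} {p : U} (hf : IsGenElementaryOver x K f p)
      (hg : IsGenElementaryOver x K g p) : IsGenElementaryOver x K (fun u => f u - g u) p
  | mul {f g : U → ℂ} {p : U} (hf : IsGenElementaryOver x K f p)
      (hg : IsGenElementaryOver x K g p) : IsGenElementaryOver x K (fun u => f u * g u) p
  | div {f g : U → ℂ} {p : U} (hf : IsGenElementaryOver x K f p)
      (hg : IsGenElementaryOver x K g p) (h : g p ≠ 0) :
      IsGenElementaryOver x K (fun u => f u / g u) p
  | deriv {f : U → ℂ} {p : U} (hf : IsGenElementaryOver x K f p) (hx : HolAt x p)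
      (h : chartDeriv x p ≠ 0) : IsGenElementaryOver x K (derivWrt x f) p
  | solve {n : ℕ} {c : Fin n → U → ℂ} {y : U → ℂ} {p : U}
      (hc : ∀ i, IsGenElementaryOver x K (c i) p) (hy : HolAt y p)
      (h : ∀ᶠ u in 𝓝 p, y u ^ n + ∑ i, c i u * y u ^ (i : ℕ) = 0) :
      IsGenElementaryOver x K y p

/-- The germ of `y` at `p` is a germ of an integral of `f`, i.e. `dy / dx = f`. -/
def IsIntegralOf (x f y : U → ℂ) (p : U) : Prop :=
  HolAt y p ∧ derivWrt x y =ᶠ[𝓝[≠] p] f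

/-- `L` is a branch of `ln r` at `q`. -/
def IsLogBranch (r L : U → ℂ) (q : U) : Prop :=
  HolAt L q ∧ ∀ᶠ u in 𝓝 q, Complex.exp (L u) = r u

/-- `y = r₀ + ∑ λᵢ ln rᵢ` near `p`, with `r₀, …, r_m ∈ K` and complex constants `λᵢ`.  The points
near `p` other than `p` itself are used, since some `rᵢ` may have a zero or a pole at `p`. -/
def IsLogSum (K : Subalgebra ℂ (U → ℂ)) (y : U → ℂ) (p : U) : Prop :=
  ∃ (m : ℕ) (r₀ : U → ℂ) (r : Fin m → U → ℂ) (c : Fin m → ℂ), r₀ ∈ K ∧ (∀ i, r i ∈ K) ∧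
    ∀ᶠ q in 𝓝[≠] p, ∃ L : Fin m → U → ℂ, (∀ i, IsLogBranch (r i) (L i) q) ∧
      ∀ᶠ u in 𝓝 q, y u = r₀ u + ∑ i, c i * L i u

end Over

end Liouville

end

/-! If `y` is a sum of logarithms, it is visibly elementary near some `q ≠ p`, and its germ at `p`
is a continuation of that one. The other direction is Liouville's argument, which is algebraic once
the analysis has been encoded.

Algebraic core. Let `f = y'` lie in a differential field `k`, with `y` in a field reached from `k`
by adjoining algebraic elements, logarithms and exponentials, without new constants. At the top of
the tower `f` is trivially of the form `∑ cᵢ uᵢ'/uᵢ + v'`: take `v = y` and no logarithms. This form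
descends one step at a time (`IsElemStep.stable_and_hasLogForm`). For an algebraic step this is
`isLiouville_of_finiteDimensional`. For a transcendental `t` one expands in Laurent series, in
powers of `t` for an exponential and of `1/t` for a logarithm, and compares coefficients. In degrees
`≤ 0` a logarithmic derivative of a series contributes only in degree `0`, and only through the
leading coefficient and the order.

Why abstract rings. The functions used to build `y` need not all have germs at `p`: continuation may
lose the intermediate ones, and `φ` in `φ ∘ f` lives at another point. So "elementary" is taken to
mean elementary in some nontrivial differential ring containing the meromorphic germs at `p`
(`IsElemOver`). Two such rings over a common field are amalgamated by a tensor product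
(`exists_amalgam`). This makes the class stable under continuation (`ElemGerm.continuation`) and
composition (`ElemGerm.comp`).

No new constants. Such a ring may have zero divisors and new constants. Only countably many of its
elements matter, so it may be taken of countable dimension over `k`; modulo a maximal differential
ideal it becomes a domain. A transcendental constant `s` of the fraction field would lie in that
domain together with the uncountably many independent elements `1/(s - z)`, `z ∈ ℂ`, which is
impossible (`mem_range_of_isDiffSimple`). Hence `hasLogForm_of_isElem`.

Finally the logarithmic form is integrated on a punctured disc (`exists_log_sum`). Going round `p`
only changes the branches of the logarithms, so one constant of integration serves all points and is
absorbed into `r₀`. -/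

noncomputable section

namespace Liouville

/-! ### Elementary elements of a differential ring -/

/-- Derivations of a ring into itself. -/
abbrev SelfDeriv (R : Type*) [CommRing R] : Type _ := Derivation ℤ R R

/-- The derivation `D + u E`. -/
def SelfDeriv.addMul {R : Type*} [CommRing R] (D : SelfDeriv R) (u : R) (E : SelfDeriv R) :
    SelfDeriv R := D + u • E

theorem SelfDeriv.addMul_apply {R : Type*} [CommRing R] (D : SelfDeriv R) (u : R)
    (E : SelfDeriv R) (a : R) : D.addMul u E a = D a + u * E a := rfl

theorem SelfDeriv.map_mul {R : Type*} [CommRing R] (D : SelfDeriv R) (a b : R) :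
    D (a * b) = a * D b + b * D a := D.leibniz a b

theorem SelfDeriv.map_inv₀ {R : Type*} [Field R] (D : SelfDeriv R) (a : R) :
    D a⁻¹ = -a⁻¹ ^ 2 * D a := D.leibniz_inv a

/-- The elements of a differential ring that are elementary over the set `S`.  All the closure
conditions are equations, so that they are preserved by homomorphisms of differential rings. -/
inductive IsElem {R : Type*} [CommRing R] (D : SelfDeriv R) (S : Set R) : R → Prop
  | base {a : R} (h : a ∈ S) : IsElem D S a
  | one : IsElem D S 1
  | add {a b : R} (ha : IsElem D S a) (hb : IsElem D S b) : IsElem D S (a + b)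
  | sub {a b : R} (ha : IsElem D S a) (hb : IsElem D S b) : IsElem D S (a - b)
  | mul {a b : R} (ha : IsElem D S a) (hb : IsElem D S b) : IsElem D S (a * b)
  | inv {a b : R} (ha : IsElem D S a) (h : a * b = 1) : IsElem D S b
  | deriv {a : R} (ha : IsElem D S a) : IsElem D S (D a)
  | alg {n : ℕ} {c : Fin n → R} {b : R} (hc : ∀ i, IsElem D S (c i))
      (h : b ^ n + ∑ i, c i * b ^ (i : ℕ) = 0) : IsElem D S b
  | exp {a b e : R} (ha : IsElem D S a) (hb : b * e = 1) (h : D b = b * D a) : IsElem D S b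
  | log {a b e : R} (ha : IsElem D S a) (he : a * e = 1) (h : D b * a = D a) : IsElem D S b

section IsElem

variable {R R' : Type*} [CommRing R] [CommRing R'] {D : SelfDeriv R}
  {D' : SelfDeriv R'} {S' : Set R'} {S : Set R}

/-- Elementary elements are preserved by ring homomorphisms that respect the derivations up to an
elementary unit `u`. -/
theorem IsElem.map_of_unit (k : R →+* R') {u v : R'} (huv : u * v = 1) (hu : IsElem D' S' u)
    (hk : ∀ a, D' (k a) = u * k (D a)) (hS : ∀ a ∈ S, IsElem D' S' (k a)) {a : R}
    (ha : IsElem D S a) : IsElem D' S' (k a) := by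
  induction ha with
  | base h => exact hS _ h
  | one => rw [map_one]; exact IsElem.one
  | add _ _ iha ihb => rw [map_add]; exact iha.add ihb
  | sub _ _ iha ihb => rw [map_sub]; exact iha.sub ihb
  | mul _ _ iha ihb => rw [map_mul]; exact iha.mul ihb
  | inv _ h ih => exact ih.inv (by rw [← map_mul, h, map_one])
  | @deriv a _ ih =>
    -- The inverse `v` of `u` is elementary too, by `IsElem.inv`, so `k (D a)` can be recovered from
    -- the derivative of `k a`.
    have h1 : k (D a) = v * D' (k a) := by
      rw [hk]; linear_combination (-k (D a)) * huv
    rw [h1]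
    exact (hu.inv huv).mul ih.deriv
  | @alg n c b _ h ih =>
    refine IsElem.alg (c := fun i => k (c i)) ih ?_
    rw [← map_zero k, ← h]
    simp
  | exp _ hb h ih =>
    refine ih.exp (e := k _) (by rw [← map_mul, hb, map_one]) ?_
    rw [hk, hk, h, map_mul]; ring
  | log _ he h ih =>
    refine ih.log (e := k _) (by rw [← map_mul, he, map_one]) ?_
    rw [hk, hk, ← h, map_mul]; ring

/-- Elementary elements are preserved by homomorphisms of differential rings. -/
theorem IsElem.map (k : R →+* R') (hk : ∀ a, D' (k a) = k (D a))
    (hS : ∀ a ∈ S, IsElem D' S' (k a)) {a : R} (ha : IsElem D S a) : IsElem D' S' (k a) :=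
  IsElem.map_of_unit k (one_mul 1) IsElem.one (by simpa using hk) hS ha

end IsElem

/-! ### Amalgamation of differential rings -/

section Amalgam

open TensorProduct

/-- An additive endomorphism that satisfies the Leibniz rule, as a derivation. -/
def derivationOfLeibniz {R : Type*} [CommRing R] (d : R →+ R)
    (h : ∀ a b, d (a * b) = a * d b + b * d a) : SelfDeriv R :=
  Derivation.mk' d.toIntLinearMap h

/-- The derivation of a tensor product of two differential algebras, as an additive map. -/
def tensorDerivAux {F A B : Type*} [CommRing F] [CommRing A] [CommRing B] [Algebra F A]
    [Algebra F B] (D₁ : SelfDeriv A) (D₂ : SelfDeriv B)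
    (h : ∀ r : F, ∃ r' : F, D₁ (algebraMap F A r) = algebraMap F A r' ∧
      D₂ (algebraMap F B r) = algebraMap F B r') : A ⊗[F] B →+ A ⊗[F] B :=
  TensorProduct.liftAddHom
    { toFun := fun a =>
        { toFun := fun b => D₁ a ⊗ₜ b + a ⊗ₜ D₂ b
          map_zero' := by simp
          map_add' := fun b b' => by
            simp only [TensorProduct.tmul_add, map_add]; abel }
      map_zero' := by ext; simp
      map_add' := fun a a' => by
        ext b
        simp only [map_add, TensorProduct.add_tmul, AddMonoidHom.coe_mk, ZeroHom.coe_mk,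
          AddMonoidHom.add_apply]
        abel }
    -- Balancedness over `F`: moving `r` across creates the extra terms `(r' • a) ⊗ b` and `a ⊗ (r'
    -- • b)`, which agree because both derivations use the same `r'`.
    (fun r a b => by
      obtain ⟨r', h₁, h₂⟩ := h r
      have e₁ : D₁ (r • a) = r • D₁ a + r' • a := by
        rw [Algebra.smul_def, Derivation.leibniz, h₁, smul_eq_mul, smul_eq_mul,
          Algebra.smul_def, Algebra.smul_def, mul_comm a]
      have e₂ : D₂ (r • b) = r • D₂ b + r' • b := by
        rw [Algebra.smul_def, Derivation.leibniz, h₂, smul_eq_mul, smul_eq_mul,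
          Algebra.smul_def, Algebra.smul_def, mul_comm b]
      simp only [AddMonoidHom.coe_mk, ZeroHom.coe_mk, e₁, e₂, TensorProduct.add_tmul,
        TensorProduct.tmul_add, TensorProduct.smul_tmul]
      abel)

theorem tensorDerivAux_tmul {F A B : Type*} [CommRing F] [CommRing A] [CommRing B] [Algebra F A]
    [Algebra F B] (D₁ : SelfDeriv A) (D₂ : SelfDeriv B)
    (h : ∀ r : F, ∃ r' : F, D₁ (algebraMap F A r) = algebraMap F A r' ∧
      D₂ (algebraMap F B r) = algebraMap F B r') (a : A) (b : B) :
    tensorDerivAux D₁ D₂ h (a ⊗ₜ b) = D₁ a ⊗ₜ b + a ⊗ₜ D₂ b := rfl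

theorem tensorDerivAux_mul {F A B : Type*} [CommRing F] [CommRing A] [CommRing B] [Algebra F A]
    [Algebra F B] (D₁ : SelfDeriv A) (D₂ : SelfDeriv B)
    (h : ∀ r : F, ∃ r' : F, D₁ (algebraMap F A r) = algebraMap F A r' ∧
      D₂ (algebraMap F B r) = algebraMap F B r') (s t : A ⊗[F] B) :
    tensorDerivAux D₁ D₂ h (s * t) =
      s * tensorDerivAux D₁ D₂ h t + t * tensorDerivAux D₁ D₂ h s := by
  induction s using TensorProduct.induction_on with
  | zero => simp
  | add s s' hs hs' =>
    simp only [add_mul, map_add, hs, hs', mul_add]; abel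
  | tmul a b =>
    induction t using TensorProduct.induction_on with
    | zero => simp
    | add t t' ht ht' =>
      simp only [add_mul, map_add, ht, ht', mul_add]; abel
    | tmul a' b' =>
      simp only [Algebra.TensorProduct.tmul_mul_tmul, tensorDerivAux_tmul, Derivation.leibniz,
        smul_eq_mul, TensorProduct.add_tmul, TensorProduct.tmul_add, mul_add]
      simp only [mul_comm b' b, mul_comm a' a, mul_comm b' (D₂ b), mul_comm a' (D₁ a)]
      abel

/-- Two nontrivial differential rings over a common field embed into a third one. -/
theorem exists_amalgam {F : Type*} {A B : Type} [Field F] [CommRing A] [CommRing B] [Nontrivial A]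
    [Nontrivial B] (i : F →+* A) (j : F →+* B) (D₁ : SelfDeriv A) (D₂ : SelfDeriv B)
    (h : ∀ r : F, ∃ r' : F, D₁ (i r) = i r' ∧ D₂ (j r) = j r') :
    ∃ (T : Type) (_ : CommRing T) (_ : Nontrivial T) (D : SelfDeriv T) (i' : A →+* T)
      (j' : B →+* T), (∀ a, D (i' a) = i' (D₁ a)) ∧ (∀ b, D (j' b) = j' (D₂ b)) ∧
      ∀ r, i' (i r) = j' (j r) := by
  let := i.toAlgebra
  let := j.toAlgebra
  -- The tensor product is nontrivial because `F` is a field; it may well have zero divisors and new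
  -- constants.
  refine ⟨A ⊗[F] B, inferInstance, inferInstance,
    derivationOfLeibniz (tensorDerivAux D₁ D₂ h) (tensorDerivAux_mul D₁ D₂ h),
    Algebra.TensorProduct.includeLeftRingHom,
    (Algebra.TensorProduct.includeRight : B →ₐ[F] A ⊗[F] B).toRingHom, ?_, ?_, ?_⟩
  · intro a
    exact (tensorDerivAux_tmul D₁ D₂ h a 1).trans (by simp)
  · intro b
    exact (tensorDerivAux_tmul D₁ D₂ h 1 b).trans (by simp)
  · intro r
    have h1 : i r = r • (1 : A) := (Algebra.algebraMap_eq_smul_one r)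
    have h2 : j r = r • (1 : B) := (Algebra.algebraMap_eq_smul_one r)
    simp [h1, h2, TensorProduct.smul_tmul]

end Amalgam

/-! ### Derivations of fraction fields, quotients and subrings -/

section Fractions

variable {S : Type*} [CommRing S] (Q : Type*) [Field Q] [Algebra S Q] [IsFractionRing S Q]

/-- The homomorphism `a ↦ a + D a ε` into the dual numbers of the fraction field, extended to the
fraction field. -/
def fractionDual (D : SelfDeriv S) : Q →+* TrivSqZeroExt Q Q :=
  IsLocalization.lift (M := nonZeroDivisors S) (S := Q)
    (g := { toFun := fun a => (TrivSqZeroExt.inl (algebraMap S Q a) +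
              TrivSqZeroExt.inr (algebraMap S Q (D a)) : TrivSqZeroExt Q Q)
            map_one' := by ext <;> simp
            map_zero' := by ext <;> simp
            map_mul' := fun a b => by
              ext
              · simp
              · simp only [Derivation.leibniz, smul_eq_mul, map_mul, map_add,
                  TrivSqZeroExt.snd_add, TrivSqZeroExt.snd_mul, TrivSqZeroExt.snd_inl,
                  TrivSqZeroExt.snd_inr, TrivSqZeroExt.fst_add, TrivSqZeroExt.fst_inl,
                  TrivSqZeroExt.fst_inr, MulOpposite.smul_eq_mul_unop, MulOpposite.unop_op]
                ring
            map_add' := fun a b => by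
              ext
              · simp
              · simp only [map_add, TrivSqZeroExt.snd_add, TrivSqZeroExt.snd_inl,
                  TrivSqZeroExt.snd_inr]
                ring })
    (fun a => by
      rw [TrivSqZeroExt.isUnit_iff_isUnit_fst]
      simpa using IsLocalization.map_units Q a)

theorem fractionDual_algebraMap (D : SelfDeriv S) (a : S) :
    fractionDual Q D (algebraMap S Q a) =
      TrivSqZeroExt.inl (algebraMap S Q a) + TrivSqZeroExt.inr (algebraMap S Q (D a)) := by
  simp [fractionDual]

theorem fst_fractionDual (D : SelfDeriv S) (a : Q) : (fractionDual Q D a).fst = a := by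
  have : (TrivSqZeroExt.fstHom Q Q Q).toRingHom.comp (fractionDual Q D) = RingHom.id _ := by
    refine IsLocalization.ringHom_ext (nonZeroDivisors S) ?_
    ext a
    simp [fractionDual_algebraMap]
  exact congrArg (fun g => g a) this

/-- The extension of a derivation of a domain to its fraction field. -/
def fractionDeriv (D : SelfDeriv S) : SelfDeriv Q :=
  derivationOfLeibniz
    { toFun := fun a => (fractionDual Q D a).snd
      map_zero' := by simp
      map_add' := by simp }
    (fun a b => by simp [fst_fractionDual, mul_comm])

theorem fractionDeriv_algebraMap (D : SelfDeriv S) (a : S) :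
    fractionDeriv Q D (algebraMap S Q a) = algebraMap S Q (D a) := by
  change (fractionDual Q D (algebraMap S Q a)).snd = _
  rw [fractionDual_algebraMap, TrivSqZeroExt.snd_add, TrivSqZeroExt.snd_inl,
    TrivSqZeroExt.snd_inr, zero_add]

end Fractions

/-! ### Differential ideals and differentially simple rings -/

section Quotient

variable {R : Type*} [CommRing R]

/-- The derivation of the quotient by a differential ideal. -/
def quotientDeriv (D : SelfDeriv R) (I : Ideal R) (hI : ∀ a ∈ I, D a ∈ I) :
    SelfDeriv (R ⧸ I) :=
  derivationOfLeibniz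
    (QuotientAddGroup.map I.toAddSubgroup I.toAddSubgroup (D : R →+ R) hI)
    (fun a b => by
      obtain ⟨a, rfl⟩ := Ideal.Quotient.mk_surjective a
      obtain ⟨b, rfl⟩ := Ideal.Quotient.mk_surjective b
      exact congrArg (Ideal.Quotient.mk I) (D.leibniz a b))

theorem quotientDeriv_mk (D : SelfDeriv R) (I : Ideal R) (hI : ∀ a ∈ I, D a ∈ I) (a : R) :
    quotientDeriv D I hI (Ideal.Quotient.mk I a) = Ideal.Quotient.mk I (D a) := rfl

/-- The restriction of a derivation to a differential subring. -/
def restrictDeriv (D : SelfDeriv R) (A : Subring R) (hA : ∀ a ∈ A, D a ∈ A) :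
    SelfDeriv A :=
  derivationOfLeibniz
    { toFun := fun a => ⟨D a, hA a a.2⟩
      map_zero' := by ext; simp
      map_add' := fun a b => by ext; simp }
    (fun a b => by ext; simp)

/-- A differential ring without proper nonzero differential ideals. -/
def IsDiffSimple (D : SelfDeriv R) : Prop :=
  ∀ I : Ideal R, (∀ a ∈ I, D a ∈ I) → I = ⊥ ∨ I = ⊤

/-- Zorn's lemma applies because a union of a chain of proper differential ideals is again one.
Differential ideals of the quotient pull back to differential ideals containing `I`, so maximality
of `I` is simplicity of the quotient. -/
theorem exists_maximal_diffIdeal [Nontrivial R] (D : SelfDeriv R) :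
    ∃ (I : Ideal R) (hI : ∀ a ∈ I, D a ∈ I), I ≠ ⊤ ∧ IsDiffSimple (quotientDeriv D I hI) := by
  obtain ⟨I, hI⟩ := zorn_le₀ {I : Ideal R | (∀ a ∈ I, D a ∈ I) ∧ I ≠ ⊤} (by
    intro c hc hchain
    rcases c.eq_empty_or_nonempty with rfl | hne
    · exact ⟨⊥, ⟨by simp, bot_ne_top⟩, by simp⟩
    · refine ⟨sSup c, ⟨?_, ?_⟩, fun J hJ => le_sSup hJ⟩
      · intro a ha
        rw [Submodule.mem_sSup_of_directed hne hchain.directedOn] at ha ⊢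
        obtain ⟨J, hJ, haJ⟩ := ha
        exact ⟨J, hJ, (hc hJ).1 a haJ⟩
      · rw [Ne, Ideal.eq_top_iff_one, Submodule.mem_sSup_of_directed hne hchain.directedOn]
        rintro ⟨J, hJ, h1⟩
        exact (hc hJ).2 ((Ideal.eq_top_iff_one J).2 h1))
  refine ⟨I, hI.prop.1, hI.prop.2, fun J hJ => ?_⟩
  by_cases hT : J = ⊤
  · exact Or.inr hT
  left
  have h1 : J.comap (Ideal.Quotient.mk I) ≤ I := by
    refine hI.le_of_ge ⟨?_, ?_⟩ ?_
    · intro a ha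
      rw [Ideal.mem_comap] at ha ⊢
      exact hJ _ ha
    · rwa [Ne, Ideal.comap_eq_top_iff]
    · intro a ha
      rw [Ideal.mem_comap, Ideal.Quotient.eq_zero_iff_mem.2 ha]
      exact J.zero_mem
  rw [eq_bot_iff]
  intro b hb
  obtain ⟨a, rfl⟩ := Ideal.Quotient.mk_surjective b
  exact Ideal.Quotient.eq_zero_iff_mem.2 (h1 hb)

/-- For `a` not nilpotent, the elements killed by some power of `a` form a proper differential
ideal, hence vanish: `a` is not a zero divisor. The nilradical is differential: from `a ^ (n + 1) =
0` one gets `(n + 1) a ^ n D a = 0`, and if `D a` were not nilpotent this would give `a ^ n = 0`,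
and so on down to `1 = 0`. Being proper, the nilradical is zero. Dividing by `n + 1` is the use of
`ℚ`. -/
theorem IsDiffSimple.isDomain [Nontrivial R] [Algebra ℚ R] {D : SelfDeriv R}
    (hD : IsDiffSimple D) : IsDomain R := by
  have key : ∀ a : R, ¬ IsNilpotent a → ∀ b, a * b = 0 → b = 0 := by
    intro a ha b hab
    let I : Ideal R :=
      { carrier := {b | ∃ n : ℕ, a ^ n * b = 0}
        zero_mem' := ⟨0, by simp⟩
        add_mem' := by
          rintro x y ⟨n, hn⟩ ⟨m, hm⟩
          refine ⟨n + m, ?_⟩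
          rw [pow_add]
          linear_combination a ^ m * hn + a ^ n * hm
        smul_mem' := by
          rintro c x ⟨n, hn⟩
          exact ⟨n, by rw [smul_eq_mul]; linear_combination c * hn⟩ }
    have hI : ∀ x ∈ I, D x ∈ I := by
      rintro x ⟨n, hn⟩
      refine ⟨n + 1, ?_⟩
      have h1 : D (a ^ (n + 1) * x) = 0 := by
        rw [pow_succ', mul_assoc, hn, mul_zero, map_zero]
      rw [Derivation.leibniz, Derivation.leibniz_pow] at h1
      simp only [smul_eq_mul, Nat.add_sub_cancel, nsmul_eq_mul] at h1
      linear_combination h1 - ((n + 1 : ℕ) : R) * D a * hn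
    rcases hD I hI with h | h
    · have : b ∈ I := ⟨1, by simpa using hab⟩
      rwa [h] at this
    · obtain ⟨n, hn⟩ := (Ideal.eq_top_iff_one I).1 h
      exact absurd ⟨n, by simpa using hn⟩ ha
  have hred : ∀ a ∈ nilradical R, D a ∈ nilradical R := by
    intro a ha
    rw [mem_nilradical] at ha ⊢
    by_contra hDa
    obtain ⟨n, hn⟩ := ha
    induction n with
    | zero => simp at hn
    | succ n ih =>
      apply ih
      have h1 : D (a ^ (n + 1)) = 0 := by rw [hn, map_zero]
      rw [Derivation.leibniz_pow] at h1
      simp only [smul_eq_mul, Nat.add_sub_cancel, nsmul_eq_mul] at h1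
      have h2 : D a * (((n + 1 : ℕ) : R) * a ^ n) = 0 := by linear_combination h1
      have h3 := key _ hDa _ h2
      have h4 : IsUnit ((n + 1 : ℕ) : R) := by
        have := (IsUnit.mk0 ((n + 1 : ℕ) : ℚ) (by positivity)).map (algebraMap ℚ R)
        simpa using this
      exact (h4.mul_right_eq_zero).1 h3
  have hnil : nilradical R = ⊥ := by
    rcases hD _ hred with h | h
    · exact h
    · have := (Ideal.eq_top_iff_one _).1 h
      rw [mem_nilradical] at this
      obtain ⟨n, hn⟩ := this
      simp at hn
  have : NoZeroDivisors R := ⟨fun {a b} hab => by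
    by_cases ha : IsNilpotent a
    · left
      rw [← mem_nilradical, hnil] at ha
      exact ha
    · exact Or.inr (key a ha b hab)⟩
  exact NoZeroDivisors.to_isDomain R

end Quotient

/-! ### Logarithmic forms and Laurent series -/

/-- `a = ∑ cᵢ uᵢ' / uᵢ + v'` in the differential field `F`, with constants `cᵢ`. -/
def HasLogForm {F : Type*} [Field F] (d : SelfDeriv F) (a : F) : Prop :=
  ∃ (ι : Type) (_ : Fintype ι) (c u : ι → F) (v : F),
    (∀ i, d (c i) = 0) ∧ a = ∑ i, c i * (d (u i) / u i) + d v

section Laurent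

open LaurentSeries HahnSeries

variable {F : Type*} [Field F]

/-- The coefficientwise map `∑ aₙ Xⁿ ↦ ∑ δₙ(aₙ) Xⁿ` of Laurent series. -/
def coeffMap (δ : ℤ → F →+ F) : F⸨X⸩ →+ F⸨X⸩ where
  toFun x := (⟨fun n => δ n (x.coeff n),
    x.isPWO_support.mono fun n hn h => hn (by simp only [h, map_zero])⟩ : HahnSeries ℤ F)
  map_zero' := HahnSeries.ext (funext fun n => by simp)
  map_add' x y := HahnSeries.ext (funext fun n => by simp)

theorem coeff_coeffMap (δ : ℤ → F →+ F) (x : F⸨X⸩) (n : ℤ) :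
    (coeffMap δ x).coeff n = δ n (x.coeff n) := rfl

theorem support_coeffMap_subset (δ : ℤ → F →+ F) (x : F⸨X⸩) :
    (coeffMap δ x).support ⊆ x.support := fun n hn h =>
  hn (by rw [coeff_coeffMap, h, map_zero])

/-- The coefficientwise derivation `∑ aₙ Xⁿ ↦ ∑ δₙ(aₙ) Xⁿ` of Laurent series. -/
def coeffDeriv (δ : ℤ → F →+ F) (hδ : ∀ i j a b, δ (i + j) (a * b) = a * δ j b + b * δ i a) :
    SelfDeriv (F⸨X⸩) :=
  derivationOfLeibniz (coeffMap δ) (fun x y => HahnSeries.ext (funext fun n => by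
    rw [HahnSeries.coeff_add, mul_comm y,
      HahnSeries.coeff_mul_right' y.isPWO_support (support_coeffMap_subset δ y),
      HahnSeries.coeff_mul_left' x.isPWO_support (support_coeffMap_subset δ x),
      ← Finset.sum_add_distrib]
    simp only [coeff_coeffMap, HahnSeries.coeff_mul, map_sum]
    refine Finset.sum_congr rfl fun ij hij => ?_
    rw [Finset.mem_antidiagonal] at hij
    rw [← hij.2.2, hδ]
    ring))

/-- The derivation of `F⸨X⸩` with `X' = θ X`. -/
def expExtDeriv (d : SelfDeriv F) (θ : F) : SelfDeriv (F⸨X⸩) :=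
  coeffDeriv (fun n => (d : F →+ F) + AddMonoidHom.mulLeft (n * θ)) (fun i j a b => by
    simp
    ring)

theorem coeff_expExtDeriv (d : SelfDeriv F) (θ : F) (x : F⸨X⸩) (n : ℤ) :
    (expExtDeriv d θ x).coeff n = d (x.coeff n) + n * θ * x.coeff n := rfl

/-- The derivation of `F⸨X⸩` with `(1 / X)' = η`. -/
def logExtDeriv (d : SelfDeriv F) (η : F) : SelfDeriv (F⸨X⸩) :=
  -- The second summand is `-ηX` times the Euler derivation `X d/dX`, so that `X' = -ηX²`.
  SelfDeriv.addMul (coeffDeriv (fun _ => (d : F →+ F)) (fun i j a b => by simp))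
    (single 1 (-η)) (coeffDeriv (fun n => AddMonoidHom.mulLeft (n : F)) (fun i j a b => by
      simp
      ring))

theorem coeff_logExtDeriv (d : SelfDeriv F) (η : F) (x : F⸨X⸩) (n : ℤ) :
    (logExtDeriv d η x).coeff n = d (x.coeff n) - (n - 1) * η * x.coeff (n - 1) := by
  change (coeffMap (fun _ => (d : F →+ F)) x + (single 1 (-η) : F⸨X⸩) *
    coeffMap (fun n => AddMonoidHom.mulLeft (n : F)) x).coeff n = _
  rw [HahnSeries.coeff_add, HahnSeries.coeff_single_mul, coeff_coeffMap, coeff_coeffMap]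
  simp
  ring

/-- The constant coefficient of a quotient of two Laurent series. -/
theorem coeff_zero_of_mul_eq {w u v : F⸨X⸩} (hu : u ≠ 0) (h : w * u = v)
    (hv : ∀ n < u.order, v.coeff n = 0) :
    (∀ n < 0, w.coeff n = 0) ∧ w.coeff 0 * u.leadingCoeff = v.coeff u.order := by
  rcases eq_or_ne w 0 with rfl | hw
  · simp [← h]
  have h1 := HahnSeries.coeff_mul_order_add_order w u
  rw [h] at h1
  have h2 : 0 ≤ w.order := by
    by_contra hlt
    rw [hv _ (by omega)] at h1
    exact mul_ne_zero (HahnSeries.leadingCoeff_ne_zero.2 hw)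
      (HahnSeries.leadingCoeff_ne_zero.2 hu) h1.symm
  refine ⟨fun n hn => HahnSeries.coeff_eq_zero_of_lt_order (by omega), ?_⟩
  rcases h2.eq_or_lt with h3 | h3
  · rw [← h3, zero_add] at h1
    rw [h1, HahnSeries.leadingCoeff_eq (x := w), ← h3]
  · rw [HahnSeries.coeff_eq_zero_of_lt_order h3, zero_mul, ← h,
      HahnSeries.coeff_eq_zero_of_lt_order]
    rw [HahnSeries.order_mul hw hu]
    omega

theorem coeff_C_mul (c : F) (x : F⸨X⸩) (n : ℤ) : (C c * x).coeff n = c * x.coeff n := by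
  rw [HahnSeries.C_apply]; simp

/-- If an element of `F` has a logarithmic form in an exponential extension of `F`, then it has one
in `F`. -/
theorem hasLogForm_of_expExtDeriv (d : SelfDeriv F) (a₀ a : F) {ι : Type} [Fintype ι]
    (c : ι → F) (hc : ∀ i, d (c i) = 0) (u : ι → F⸨X⸩) (v : F⸨X⸩)
    (h : C a = ∑ i, C (c i) * (expExtDeriv d (d a₀) (u i) / u i) + expExtDeriv d (d a₀) v) :
    HasLogForm d a := by
  -- The derivation does not lower the order, and on the leading term it acts as `d + N θ`, where
  -- `N` is the order and `θ = d a₀`.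
  have key : ∀ x : F⸨X⸩, (expExtDeriv d (d a₀) x / x).coeff 0 =
      d x.leadingCoeff / x.leadingCoeff + x.order * d a₀ := by
    intro x
    rcases eq_or_ne x 0 with rfl | hx
    · simp
    have h1 := (coeff_zero_of_mul_eq hx (div_mul_cancel₀ (expExtDeriv d (d a₀) x) hx)
      (fun n hn => by simp [coeff_expExtDeriv, HahnSeries.coeff_eq_zero_of_lt_order hn])).2
    have h2 := HahnSeries.leadingCoeff_ne_zero.2 hx
    rw [coeff_expExtDeriv, ← HahnSeries.leadingCoeff_eq] at h1
    field_simp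
    rw [h1]
    ring
  -- The orders contribute `∑ cᵢ Nᵢ d a₀`, which is the derivative of a constant times `a₀` and
  -- joins `v`.
  refine ⟨ι, inferInstance, c, fun i => (u i).leadingCoeff,
    (∑ i, c i * (u i).order) * a₀ + v.coeff 0, hc, ?_⟩
  have h0 := congrArg (fun x : F⸨X⸩ => x.coeff 0) h
  simp only [HahnSeries.coeff_add, HahnSeries.coeff_sum, coeff_C_mul, key, coeff_expExtDeriv] at h0
  rw [HahnSeries.C_apply, HahnSeries.coeff_single_same] at h0
  have hd : d (∑ i, c i * ((u i).order : F)) = 0 := by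
    simp [hc]
  rw [h0, map_add, Derivation.leibniz, hd]
  simp only [mul_add, Finset.sum_add_distrib, smul_eq_mul, mul_zero, add_zero, Finset.sum_mul,
    Int.cast_zero, zero_mul]
  simp only [mul_assoc, add_assoc]

/-- If an element of `F` has a logarithmic form in a logarithmic extension of `F`, then it has one
in `F`. -/
theorem hasLogForm_of_logExtDeriv [CharZero F] (d : SelfDeriv F) (a₀ a : F)
    (ha₀ : ∀ e, d e ≠ d a₀ / a₀) {ι : Type} [Fintype ι]
    (c : ι → F) (hc : ∀ i, d (c i) = 0) (u : ι → F⸨X⸩) (v : F⸨X⸩)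
    (h : C a = ∑ i, C (c i) * (logExtDeriv d (d a₀ / a₀) (u i) / u i) + logExtDeriv d (d a₀ / a₀) v) :
    HasLogForm d a := by
  set η := d a₀ / a₀ with hη
  -- The summand `-ηX² d/dX` raises degrees, so the order does not enter the constant coefficient
  -- here.
  have key : ∀ x : F⸨X⸩, (∀ n < 0, (logExtDeriv d η x / x).coeff n = 0) ∧
      (logExtDeriv d η x / x).coeff 0 = d x.leadingCoeff / x.leadingCoeff := by
    intro x
    rcases eq_or_ne x 0 with rfl | hx
    · simp
    have h1 := (coeff_zero_of_mul_eq hx (div_mul_cancel₀ (logExtDeriv d η x) hx)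
      (fun n hn => by
        rw [coeff_logExtDeriv, HahnSeries.coeff_eq_zero_of_lt_order hn,
          HahnSeries.coeff_eq_zero_of_lt_order (show n - 1 < x.order by omega)]
        simp))
    have h2 := HahnSeries.leadingCoeff_ne_zero.2 hx
    refine ⟨h1.1, ?_⟩
    have h3 := h1.2
    rw [coeff_logExtDeriv, ← HahnSeries.leadingCoeff_eq,
      HahnSeries.coeff_eq_zero_of_lt_order (show x.order - 1 < x.order by omega)] at h3
    field_simp
    rw [h3]
    ring
  have hcoeff : ∀ n, (C a : F⸨X⸩).coeff n = ∑ i, c i * (logExtDeriv d η (u i) / u i).coeff n +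
      (d (v.coeff n) - (n - 1) * η * v.coeff (n - 1)) := by
    intro n
    have h0 := congrArg (fun x : F⸨X⸩ => x.coeff n) h
    simpa only [HahnSeries.coeff_add, HahnSeries.coeff_sum, coeff_C_mul, coeff_logExtDeriv] using h0
  -- In negative degrees neither `a` nor the logarithmic derivatives contribute, so the coefficients
  -- of `v'` vanish there.
  have hneg : ∀ n < 0, d (v.coeff n) = (n - 1) * η * v.coeff (n - 1) := by
    intro n hn
    have h0 := hcoeff n
    rw [Finset.sum_eq_zero (fun i _ => by rw [(key (u i)).1 n hn, mul_zero]), HahnSeries.C_apply,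
      HahnSeries.coeff_single_of_ne hn.ne] at h0
    linear_combination -h0
  have hlow : ∀ n < -1, v.coeff n = 0 := by
    by_contra! hcon
    obtain ⟨n, hn, hvn⟩ := hcon
    have hv : v ≠ 0 := by rintro rfl; simp at hvn
    have hord : v.order < -1 := lt_of_le_of_lt (HahnSeries.order_le_of_coeff_ne_zero hvn) hn
    have h1 := hneg v.order (by omega)
    rw [HahnSeries.coeff_eq_zero_of_lt_order (show v.order - 1 < v.order by omega), mul_zero] at h1
    have h2 := hneg (v.order + 1) (by omega)
    rw [add_sub_cancel_right] at h2
    have h3 : v.coeff v.order ≠ 0 := by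
      rw [← HahnSeries.leadingCoeff_eq]; exact HahnSeries.leadingCoeff_ne_zero.2 hv
    have h4 : (v.order : F) ≠ 0 := by
      exact_mod_cast (show v.order ≠ 0 by omega)
    -- With `N = v.order < -1`, degree `N` says that `v_N` is constant and degree `N + 1 < 0` says
    -- `v_{N+1}' = N η v_N`. So `η` would have a primitive in `F`.
    apply ha₀ (v.coeff (v.order + 1) / (v.order * v.coeff v.order))
    rw [Derivation.leibniz_div_const _ _ _ (by simp [h1]), h2, smul_eq_mul]
    push_cast
    field_simp
    ring
  have hconst : d (v.coeff (-1)) = 0 := by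
    rw [hneg (-1) (by omega), hlow _ (by omega), mul_zero]
  -- In degree `0` the constant `v₋₁` contributes `v₋₁ η = v₋₁ a₀'/a₀`: this is the one additional
  -- logarithm.
  refine ⟨Option ι, inferInstance, fun o => o.elim (v.coeff (-1)) c,
    fun o => o.elim a₀ fun i => (u i).leadingCoeff, v.coeff 0, ?_, ?_⟩
  · rintro (_ | i)
    · exact hconst
    · exact hc i
  · have h0 := hcoeff 0
    rw [HahnSeries.C_apply, HahnSeries.coeff_single_same] at h0
    rw [h0, Fintype.sum_option]
    simp only [(key _).2, Option.elim]
    rw [← hη]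
    push_cast
    simp only [zero_sub]
    ring

end Laurent

/-! ### Liouville's theorem for towers of elementary extensions -/

section Step

open LaurentSeries HahnSeries IntermediateField Polynomial

variable {F L : Type*} [Field F] [Field L] [Algebra F L]

/-- A transcendental simple extension embeds into the Laurent series as a differential field. -/
theorem exists_laurent_embedding (D : SelfDeriv L) (d : SelfDeriv F)
    (hd : ∀ a, D (algebraMap F L a) = algebraMap F L (d a)) (t : L) (ht : Transcendental F t)
    (Δ : SelfDeriv (F⸨X⸩)) (hΔ : ∀ a, Δ (HahnSeries.C a) = HahnSeries.C (d a)) (θ : F) (n : ℕ)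
    (hDt : D t = algebraMap F L θ * t ^ n)
    (hX : Δ (single 1 1) = HahnSeries.C θ * (single 1 1 : F⸨X⸩) ^ n) :
    ∃ σ : F⟮t⟯ →+* F⸨X⸩, (∀ a, σ (algebraMap F F⟮t⟯ a) = HahnSeries.C a) ∧
      ∀ u : F⟮t⟯, ∃ h : D u ∈ F⟮t⟯, σ ⟨D u, h⟩ = Δ (σ u) := by
  let e := RatFunc.algEquivOfTranscendental t ht
  let g : F[X] →+* F⸨X⸩ := (HahnSeries.ofPowerSeries ℤ F).comp Polynomial.coeToPowerSeries.ringHom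
  have hg : Function.Injective g :=
    HahnSeries.ofPowerSeries_injective.comp (Polynomial.coe_injective F)
  let σ : F⟮t⟯ →+* F⸨X⸩ :=
    (IsFractionRing.lift (K := RatFunc F) hg).comp e.symm.toRingEquiv.toRingHom
  have hσ : ∀ u, σ u = IsFractionRing.lift (K := RatFunc F) hg (e.symm u) := fun _ => rfl
  have hC : ∀ a, σ (algebraMap F F⟮t⟯ a) = HahnSeries.C a := by
    intro a
    rw [hσ, AlgEquiv.commutes, IsScalarTower.algebraMap_apply F F[X] (RatFunc F),
      IsFractionRing.lift_algebraMap]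
    simp [g]
  have hT : σ (AdjoinSimple.gen F t) = single 1 1 := by
    have h1 : e.symm (AdjoinSimple.gen F t) = algebraMap F[X] (RatFunc F) Polynomial.X := by
      rw [AlgEquiv.symm_apply_eq]
      refine Subtype.ext ?_
      simp [e]
    rw [hσ, h1, IsFractionRing.lift_algebraMap]
    simp [g]
  refine ⟨σ, hC, ?_⟩
  -- Stability under `D` and compatibility with `Δ` are proved together, since the second cannot be
  -- stated without the first. On the generator both reduce to `t' = θ tⁿ` and `X' = θ Xⁿ`.
  have key : ∀ u (hu : u ∈ F⟮t⟯), ∃ h : D u ∈ F⟮t⟯, σ ⟨D u, h⟩ = Δ (σ ⟨u, hu⟩) := by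
    intro u hu
    induction hu using IntermediateField.adjoin_induction with
    | mem x hx =>
      obtain rfl : x = t := hx
      have h1 : D x = ((algebraMap F F⟮x⟯ θ * AdjoinSimple.gen F x ^ n : F⟮x⟯) : L) := by
        rw [hDt]; simp
      refine ⟨h1 ▸ Subtype.property _, ?_⟩
      have h2 : (⟨D x, h1 ▸ Subtype.property _⟩ : F⟮x⟯) =
        algebraMap F F⟮x⟯ θ * AdjoinSimple.gen F x ^ n := Subtype.ext h1
      rw [h2, map_mul, map_pow, hT, hC]
      exact hX.symm.trans (congrArg Δ hT.symm)
    | algebraMap a =>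
      refine ⟨hd a ▸ (F⟮t⟯).algebraMap_mem _, ?_⟩
      have h2 : (⟨D (algebraMap F L a), hd a ▸ (F⟮t⟯).algebraMap_mem _⟩ : F⟮t⟯) =
        algebraMap F F⟮t⟯ (d a) := Subtype.ext (hd a)
      rw [h2, hC, ← hΔ, ← hC]
      rfl
    | add x y hx hy ihx ihy =>
      obtain ⟨h1, e1⟩ := ihx
      obtain ⟨h2, e2⟩ := ihy
      refine ⟨by rw [map_add]; exact add_mem h1 h2, ?_⟩
      have e3 : (⟨x + y, add_mem hx hy⟩ : F⟮t⟯) = ⟨x, hx⟩ + ⟨y, hy⟩ := rfl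
      rw [e3, map_add σ, map_add Δ, ← e1, ← e2, ← map_add σ]
      congr 1
      exact Subtype.ext (map_add D x y)
    | inv x hx ihx =>
      obtain ⟨h1, e1⟩ := ihx
      have e0 : D x⁻¹ = -(x⁻¹ ^ 2) * D x := by
        rw [Derivation.leibniz_inv, smul_eq_mul]
      refine ⟨by rw [e0]; exact mul_mem (neg_mem (pow_mem (inv_mem hx) 2)) h1, ?_⟩
      have e3 : (⟨x⁻¹, inv_mem hx⟩ : F⟮t⟯) = ⟨x, hx⟩⁻¹ := rfl
      rw [e3, map_inv₀ σ, SelfDeriv.map_inv₀ Δ, ← e1, ← map_inv₀ σ, ← map_pow,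
        ← map_neg, ← map_mul]
      congr 1
      exact Subtype.ext e0
    | mul x y hx hy ihx ihy =>
      obtain ⟨h1, e1⟩ := ihx
      obtain ⟨h2, e2⟩ := ihy
      have e0 : D (x * y) = x * D y + y * D x := by rw [Derivation.leibniz]; rfl
      refine ⟨by rw [e0]; exact add_mem (mul_mem hx h2) (mul_mem hy h1), ?_⟩
      have e3 : (⟨x * y, mul_mem hx hy⟩ : F⟮t⟯) = ⟨x, hx⟩ * ⟨y, hy⟩ := rfl
      rw [e3, map_mul σ, SelfDeriv.map_mul Δ, ← e1, ← e2, ← map_mul σ,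
        ← map_mul σ, ← map_add σ]
      congr 1
      exact Subtype.ext e0
  exact fun u => key u u.2

/-- `t` is elementary of one of the three basic kinds over the differential field `F`. -/
def IsElemStep (D : SelfDeriv L) (d : SelfDeriv F) (t : L) : Prop :=
  IsAlgebraic F t ∨ (∃ a, D t = algebraMap F L (d a / a)) ∨ ∃ a, D t = t * algebraMap F L (d a)

/-- `a = ∑ cᵢ uᵢ' / uᵢ + v'` with constants `cᵢ` and `uᵢ, v ∈ E`. -/
def HasLogFormIn (D : SelfDeriv L) (E : Set L) (a : L) : Prop :=
  ∃ (ι : Type) (_ : Fintype ι) (c u : ι → L) (v : L), (∀ i, D (c i) = 0) ∧ (∀ i, u i ∈ E) ∧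
    v ∈ E ∧ a = ∑ i, c i * (D (u i) / u i) + D v

variable {D : SelfDeriv L} {d : SelfDeriv F}

theorem HasLogForm.hasLogFormIn
    (hd : ∀ a, D (algebraMap F L a) = algebraMap F L (d a))
    {a : F} (h : HasLogForm d a) :
    HasLogFormIn D (Set.range (algebraMap F L)) (algebraMap F L a) := by
  obtain ⟨ι, _, c, u, v, hc, h⟩ := h
  refine ⟨ι, inferInstance, fun i => algebraMap F L (c i), fun i => algebraMap F L (u i),
    algebraMap F L v, fun i => by rw [hd, hc, map_zero], fun i => ⟨_, rfl⟩, ⟨_, rfl⟩, ?_⟩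
  rw [h]
  simp [hd]

/-- Since all constants of `L` lie in `F`, the `cᵢ` become constant series under `σ`; the `uᵢ` and
`v` become arbitrary series. -/
theorem hasLogForm_of_laurent
    (hd : ∀ a, D (algebraMap F L a) = algebraMap F L (d a))
    (hconst : ∀ c, D c = 0 → c ∈ (algebraMap F L).range)
    {t : L} (Δ : SelfDeriv (F⸨X⸩)) (σ : F⟮t⟯ →+* F⸨X⸩)
    (hC : ∀ a, σ (algebraMap F F⟮t⟯ a) = HahnSeries.C a)
    (hσ : ∀ u : F⟮t⟯, ∃ h : D u ∈ F⟮t⟯, σ ⟨D u, h⟩ = Δ (σ u)) {a : F}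
    (h : HasLogFormIn D (F⟮t⟯ : Set L) (algebraMap F L a)) :
    ∃ (ι : Type) (_ : Fintype ι) (c : ι → F) (u : ι → F⸨X⸩) (v : F⸨X⸩),
      (∀ i, d (c i) = 0) ∧ HahnSeries.C a = ∑ i, HahnSeries.C (c i) * (Δ (u i) / u i) + Δ v := by
  obtain ⟨ι, _, c, u, v, hc, hu, hv, h⟩ := h
  choose c' hc' using fun i => hconst (c i) (hc i)
  choose hDu hDu' using fun i => hσ ⟨u i, hu i⟩
  obtain ⟨hDv, hDv'⟩ := hσ ⟨v, hv⟩
  refine ⟨ι, inferInstance, c', fun i => σ ⟨u i, hu i⟩, σ ⟨v, hv⟩, fun i => ?_, ?_⟩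
  · apply (algebraMap F L).injective
    rw [← hd, hc', hc, map_zero]
  · have h1 : algebraMap F F⟮t⟯ a = ∑ i, algebraMap F F⟮t⟯ (c' i) *
        ((⟨D (u i), hDu i⟩ : F⟮t⟯) / ⟨u i, hu i⟩) + ⟨D v, hDv⟩ := by
      apply Subtype.ext
      change algebraMap F L a = _
      rw [h]
      push_cast
      congr 1
      refine Finset.sum_congr rfl fun i _ => ?_
      rw [← hc' i]
    have h2 := congrArg σ h1
    simpa only [map_add, map_sum, map_mul, map_div₀, hC, hDu', hDv'] using h2

theorem expExtDeriv_C (d : SelfDeriv F) (θ a : F) :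
    expExtDeriv d θ (HahnSeries.C a) = HahnSeries.C (d a) := by
  refine HahnSeries.ext (funext fun n => ?_)
  rw [coeff_expExtDeriv, HahnSeries.C_apply, HahnSeries.C_apply]
  rcases eq_or_ne n 0 with rfl | hn
  · simp
  · simp [HahnSeries.coeff_single_of_ne hn]

theorem expExtDeriv_X (d : SelfDeriv F) (θ : F) :
    expExtDeriv d θ (single 1 1) = HahnSeries.C θ * (single 1 1 : F⸨X⸩) ^ 1 := by
  refine HahnSeries.ext (funext fun n => ?_)
  rw [coeff_expExtDeriv, pow_one, coeff_C_mul]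
  rcases eq_or_ne n 1 with rfl | hn
  · simp
  · simp [HahnSeries.coeff_single_of_ne hn]

theorem logExtDeriv_C (d : SelfDeriv F) (η a : F) :
    logExtDeriv d η (HahnSeries.C a) = HahnSeries.C (d a) := by
  refine HahnSeries.ext (funext fun n => ?_)
  rw [coeff_logExtDeriv, HahnSeries.C_apply, HahnSeries.C_apply]
  rcases eq_or_ne n 0 with rfl | hn
  · simp
  rcases eq_or_ne n 1 with rfl | hn'
  · simp
  · simp [HahnSeries.coeff_single_of_ne hn,
      HahnSeries.coeff_single_of_ne (show n - 1 ≠ 0 by omega)]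

theorem logExtDeriv_X (d : SelfDeriv F) (η : F) :
    logExtDeriv d η (single 1 1) = HahnSeries.C (-η) * (single 1 1 : F⸨X⸩) ^ 2 := by
  refine HahnSeries.ext (funext fun n => ?_)
  rw [coeff_logExtDeriv, coeff_C_mul, pow_two, HahnSeries.single_mul_single]
  norm_num
  rcases eq_or_ne n 2 with rfl | hn
  · norm_num [HahnSeries.coeff_single_of_ne]
  rcases eq_or_ne n 1 with rfl | hn'
  · simp
  · simp [HahnSeries.coeff_single_of_ne hn, HahnSeries.coeff_single_of_ne hn',
      HahnSeries.coeff_single_of_ne (show n - 1 ≠ 1 by omega)]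

/-- The descent itself is `isLiouville_of_finiteDimensional`. It remains to see that the derivation
carried by `F⟮t⟯` is the restriction of `D` and that the constants come from `F`. -/
theorem exists_finiteDimensional_deriv
    (hd : ∀ a, D (algebraMap F L a) = algebraMap F L (d a))
    [CharZero F] {t : L} (ht : IsAlgebraic F t) :
    (∀ u ∈ F⟮t⟯, D u ∈ F⟮t⟯) ∧ ∀ a, (∀ c, D c = 0 → c ∈ (algebraMap F L).range) →
      HasLogFormIn D (F⟮t⟯ : Set L) (algebraMap F L a) → HasLogForm d a := by
  let _ : Differential F := ⟨d⟩
  let _ : Differential L := ⟨D⟩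
  have _ : DifferentialAlgebra F L := ⟨hd⟩
  have _ : FiniteDimensional F F⟮t⟯ := IntermediateField.adjoin.finiteDimensional ht.isIntegral
  have h1 : ∀ u : F⟮t⟯, D u = ((Differential.deriv u : F⟮t⟯) : L) := fun u =>
    deriv_algebraMap (A := F⟮t⟯) (B := L) u
  refine ⟨fun u hu => by rw [h1 ⟨u, hu⟩]; exact Subtype.property _, fun a hconst h => ?_⟩
  obtain ⟨ι, _, c, u, v, hc, hu, hv, h⟩ := h
  choose c' hc' using fun i => hconst (c i) (hc i)
  have h2 : ∀ i, d (c' i) = 0 := fun i => by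
    apply (algebraMap F L).injective
    rw [← hd, hc', hc, map_zero]
  obtain ⟨ι₀, hι₀, c₀, hc₀, u₀, v₀, h₀⟩ :=
    (isLiouville_of_finiteDimensional (F := F) (K := F⟮t⟯)).isLiouville a ι c' h2
      (fun i => ⟨u i, hu i⟩) ⟨v, hv⟩ (by
        apply Subtype.ext
        change algebraMap F L a = _
        rw [h]
        push_cast
        rw [← h1]
        congr 1
        refine Finset.sum_congr rfl fun i _ => ?_
        rw [← hc' i]
        simp only [Differential.logDeriv]
        push_cast
        rw [← h1])
  exact ⟨ι₀, hι₀, c₀, u₀, v₀, hc₀, h₀⟩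

/-- An elementary step does not create new elements with a logarithmic form. -/
theorem IsElemStep.stable_and_hasLogForm
    (hd : ∀ a, D (algebraMap F L a) = algebraMap F L (d a))
    (hconst : ∀ c, D c = 0 → c ∈ (algebraMap F L).range)
    [CharZero F] {t : L} (ht : IsElemStep D d t) :
    (∀ u ∈ F⟮t⟯, D u ∈ F⟮t⟯) ∧
      ∀ a, HasLogFormIn D (F⟮t⟯ : Set L) (algebraMap F L a) → HasLogForm d a := by
  -- A logarithm or an exponential may happen to be algebraic; only a transcendental one has a
  -- Laurent expansion.
  by_cases halg : IsAlgebraic F t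
  · have := exists_finiteDimensional_deriv hd halg
    exact ⟨this.1, fun a => this.2 a hconst⟩
  rcases ht with h | ⟨a₀, h⟩ | ⟨a₀, h⟩
  · exact absurd h halg
  · have ht0 : t ≠ 0 := fun h0 => halg (h0 ▸ isAlgebraic_zero)
    have htr : Transcendental F t⁻¹ := fun h0 => halg (by simpa using h0.inv)
    -- If `e` were another primitive, `t - e` would be a constant, hence in `F`, and `t` would be
    -- algebraic.
    have hne : ∀ e, d e ≠ d a₀ / a₀ := by
      intro e he
      obtain ⟨c, hc⟩ := hconst (t - algebraMap F L e) (by rw [map_sub, h, hd, he, sub_self])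
      apply halg
      have : t = algebraMap F L (c + e) := by rw [map_add, hc]; ring
      rw [this]
      exact isAlgebraic_algebraMap _
    -- The expansion is at `t = ∞`, with `X = 1/t` and `X' = -(d a₀ / a₀) X²`.
    have hEq : F⟮t⟯ = F⟮t⁻¹⟯ := by
      apply le_antisymm
      · rw [adjoin_simple_le_iff]
        simpa using inv_mem (mem_adjoin_simple_self F t⁻¹)
      · rw [adjoin_simple_le_iff]
        exact inv_mem (mem_adjoin_simple_self F t)
    obtain ⟨σ, hσC, hσ⟩ := exists_laurent_embedding D d hd t⁻¹ htr (logExtDeriv d (d a₀ / a₀))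
      (logExtDeriv_C d _) (-(d a₀ / a₀)) 2 (by
        rw [Derivation.leibniz_inv, h, smul_eq_mul, map_neg]; ring) (logExtDeriv_X d _)
    rw [hEq]
    refine ⟨fun u hu => (hσ ⟨u, hu⟩).1, fun a ha => ?_⟩
    obtain ⟨ι, _, c, u, v, hc, hh⟩ := hasLogForm_of_laurent hd hconst _ σ hσC hσ ha
    exact hasLogForm_of_logExtDeriv d a₀ a hne c hc u v hh
  · obtain ⟨σ, hσC, hσ⟩ := exists_laurent_embedding D d hd t halg (expExtDeriv d (d a₀))
      (expExtDeriv_C d _) (d a₀) 1 (by rw [h]; ring) (expExtDeriv_X d _)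
    refine ⟨fun u hu => (hσ ⟨u, hu⟩).1, fun a ha => ?_⟩
    obtain ⟨ι, _, c, u, v, hc, hh⟩ := hasLogForm_of_laurent hd hconst _ σ hσC hσ ha
    exact hasLogForm_of_expExtDeriv d a₀ a c hc u v hh

end Step

/-! ### Towers of elementary field extensions -/

section Tower

open IntermediateField

variable {L : Type*} [Field L]

/-- The restriction of a derivation to a differential subfield. -/
def subfieldDeriv (D : SelfDeriv L) (E : Subfield L) (hE : ∀ a ∈ E, D a ∈ E) : SelfDeriv E :=
  derivationOfLeibniz
    { toFun := fun a => ⟨D a, hE a a.2⟩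
      map_zero' := by ext; simp
      map_add' := fun a b => by ext; simp }
    (fun a b => by ext; simp)

theorem coe_subfieldDeriv (D : SelfDeriv L) (E : Subfield L) (hE : ∀ a ∈ E, D a ∈ E) (a : E) :
    (subfieldDeriv D E hE a : L) = D a := rfl

/-- The subfields of `L` that are obtained from `E₀` by successively adjoining algebraic elements,
logarithms and exponentials. -/
inductive IsTower (D : SelfDeriv L) (E₀ : Subfield L) : Subfield L → Prop
  | base : IsTower D E₀ E₀
  | step {E : Subfield L} (hE : IsTower D E₀ E) (t : L)
      (ht : IsAlgebraic E t ∨ (∃ a ∈ E, D t = D a / a) ∨ ∃ a ∈ E, D t = t * D a) :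
      IsTower D E₀ (IntermediateField.adjoin E {t}).toSubfield

/-- Every field of the tower contains `E₀`, hence all constants of `L`, so no step creates new
constants and the one-step descent can be iterated. -/
theorem IsTower.spec [CharZero L] {D : SelfDeriv L} {E₀ : Subfield L} (hE₀ : ∀ a ∈ E₀, D a ∈ E₀)
    (hconst : ∀ c, D c = 0 → c ∈ E₀) {E : Subfield L} (hE : IsTower D E₀ E) :
    E₀ ≤ E ∧ (∀ a ∈ E, D a ∈ E) ∧
      ∀ a ∈ E₀, HasLogFormIn D (E : Set L) a → HasLogFormIn D (E₀ : Set L) a := by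
  induction hE with
  | base => exact ⟨le_rfl, hE₀, fun _ _ h => h⟩
  | @step E _ t ht ih =>
    obtain ⟨hle, hst, hform⟩ := ih
    have hd : ∀ a, D (algebraMap E L a) = algebraMap E L (subfieldDeriv D E hst a) := fun _ => rfl
    have hc : ∀ c, D c = 0 → c ∈ (algebraMap E L).range := fun c h => ⟨⟨c, hle (hconst c h)⟩, rfl⟩
    have hstep : IsElemStep D (subfieldDeriv D E hst) t := by
      rcases ht with h | ⟨a, ha, h⟩ | ⟨a, ha, h⟩
      · exact Or.inl h
      · exact Or.inr (Or.inl ⟨⟨a, ha⟩, h⟩)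
      · exact Or.inr (Or.inr ⟨⟨a, ha⟩, h⟩)
    have : CharZero E :=
      ⟨fun m n h => by exact_mod_cast congrArg (algebraMap E L) h⟩
    obtain ⟨h1, h2⟩ := hstep.stable_and_hasLogForm hd hc
    have hEt : E ≤ (IntermediateField.adjoin E {t}).toSubfield := fun a ha =>
      (IntermediateField.adjoin E {t}).algebraMap_mem ⟨a, ha⟩
    refine ⟨hle.trans hEt, h1, fun a ha h => hform a ha ?_⟩
    have h3 := (h2 ⟨a, hle ha⟩ h).hasLogFormIn hd
    rwa [show Set.range (algebraMap E L) = (E : Set L) from Subtype.range_coe] at h3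

theorem IsTower.le_adjoin {D : SelfDeriv L} {E₀ E : Subfield L} (hE : IsTower D E₀ E) (t : L)
    (ht : IsAlgebraic E t ∨ (∃ a ∈ E, D t = D a / a) ∨ ∃ a ∈ E, D t = t * D a) :
    ∃ E', IsTower D E₀ E' ∧ E ≤ E' ∧ t ∈ E' :=
  ⟨_, hE.step t ht, fun a ha => (IntermediateField.adjoin E {t}).algebraMap_mem ⟨a, ha⟩,
    mem_adjoin_simple_self E t⟩

/-- The tower is made to start from an arbitrary tower `E`, so that those for several operands can
be stacked. -/
theorem IsElem.exists_isTower [CharZero L] {D : SelfDeriv L} {E₀ : Subfield L}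
    (hE₀ : ∀ a ∈ E₀, D a ∈ E₀) (hconst : ∀ c, D c = 0 → c ∈ E₀) {y : L}
    (hy : IsElem D (E₀ : Set L) y) :
    ∀ E, IsTower D E₀ E → ∃ E', IsTower D E₀ E' ∧ E ≤ E' ∧ y ∈ E' := by
  have two : ∀ {a b : L}, (∀ E, IsTower D E₀ E → ∃ E', IsTower D E₀ E' ∧ E ≤ E' ∧ a ∈ E') →
      (∀ E, IsTower D E₀ E → ∃ E', IsTower D E₀ E' ∧ E ≤ E' ∧ b ∈ E') →
      ∀ E, IsTower D E₀ E → ∃ E', IsTower D E₀ E' ∧ E ≤ E' ∧ a ∈ E' ∧ b ∈ E' := by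
    intro a b iha ihb E hE
    obtain ⟨E₁, h1, h2, h3⟩ := iha E hE
    obtain ⟨E₂, h4, h5, h6⟩ := ihb E₁ h1
    exact ⟨E₂, h4, h2.trans h5, h5 h3, h6⟩
  induction hy with
  | base h => exact fun E hE => ⟨E, hE, le_rfl, (hE.spec hE₀ hconst).1 h⟩
  | one => exact fun E hE => ⟨E, hE, le_rfl, one_mem E⟩
  | add _ _ iha ihb =>
    intro E hE
    obtain ⟨E', h1, h2, h3, h4⟩ := two iha ihb E hE
    exact ⟨E', h1, h2, add_mem h3 h4⟩
  | sub _ _ iha ihb =>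
    intro E hE
    obtain ⟨E', h1, h2, h3, h4⟩ := two iha ihb E hE
    exact ⟨E', h1, h2, sub_mem h3 h4⟩
  | mul _ _ iha ihb =>
    intro E hE
    obtain ⟨E', h1, h2, h3, h4⟩ := two iha ihb E hE
    exact ⟨E', h1, h2, mul_mem h3 h4⟩
  | inv _ h ih =>
    intro E hE
    obtain ⟨E', h1, h2, h3⟩ := ih E hE
    exact ⟨E', h1, h2, eq_inv_of_mul_eq_one_right h ▸ inv_mem h3⟩
  | deriv _ ih =>
    intro E hE
    obtain ⟨E', h1, h2, h3⟩ := ih E hE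
    exact ⟨E', h1, h2, (h1.spec hE₀ hconst).2.1 _ h3⟩
  | @alg n c b _ h ih =>
    intro E hE
    have hall : ∀ s : Finset (Fin n), ∃ E', IsTower D E₀ E' ∧ E ≤ E' ∧ ∀ i ∈ s, c i ∈ E' := by
      intro s
      induction s using Finset.induction_on with
      | empty => exact ⟨E, hE, le_rfl, by simp⟩
      | insert i s _ ihs =>
        obtain ⟨E₁, h1, h2, h3⟩ := ihs
        obtain ⟨E₂, h4, h5, h6⟩ := ih i E₁ h1
        refine ⟨E₂, h4, h2.trans h5, fun j hj => ?_⟩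
        rcases Finset.mem_insert.1 hj with rfl | hj
        · exact h6
        · exact h5 (h3 j hj)
    obtain ⟨E', h1, h2, h3⟩ := hall Finset.univ
    have hb : IsAlgebraic E' b := by
      refine IsIntegral.isAlgebraic ⟨Polynomial.X ^ n + ∑ i : Fin n, Polynomial.C
        (⟨c i, h3 i (Finset.mem_univ i)⟩ : E') * Polynomial.X ^ (i : ℕ), ?_, ?_⟩
      · refine Polynomial.monic_X_pow_add ?_
        refine (Polynomial.degree_sum_fin_lt _)
      · rw [← h]
        simp [Polynomial.eval₂_finsetSum]
        rfl
    obtain ⟨E'', h4, h5, h6⟩ := h1.le_adjoin b (Or.inl hb)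
    exact ⟨E'', h4, h2.trans h5, h6⟩
  | @exp a b e _ hb h ih =>
    intro E hE
    obtain ⟨E', h1, h2, h3⟩ := ih E hE
    obtain ⟨E'', h4, h5, h6⟩ := h1.le_adjoin b (Or.inr (Or.inr ⟨a, h3, h⟩))
    exact ⟨E'', h4, h2.trans h5, h6⟩
  | @log a b e _ he h ih =>
    intro E hE
    obtain ⟨E', h1, h2, h3⟩ := ih E hE
    obtain ⟨E'', h4, h5, h6⟩ := h1.le_adjoin b
      (Or.inr (Or.inl ⟨a, h3, by rw [← h, mul_div_cancel_right₀ _ (left_ne_zero_of_mul_eq_one he)]⟩))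
    exact ⟨E'', h4, h2.trans h5, h6⟩

/-- **Liouville's theorem** for an elementary extension without new constants. -/
theorem hasLogFormIn_of_isElem [CharZero L] {D : SelfDeriv L} {E₀ : Subfield L}
    (hE₀ : ∀ a ∈ E₀, D a ∈ E₀) (hconst : ∀ c, D c = 0 → c ∈ E₀) {y : L}
    (hy : IsElem D (E₀ : Set L) y) (hDy : D y ∈ E₀) : HasLogFormIn D (E₀ : Set L) (D y) := by
  obtain ⟨E, hE, -, hyE⟩ := hy.exists_isTower hE₀ hconst E₀ IsTower.base
  -- At the top of the tower `D y` is a logarithmic form without logarithms.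
  exact (hE.spec hE₀ hconst).2.2 _ hDy ⟨Empty, inferInstance, Empty.elim, Empty.elim, y,
    fun i => i.elim, fun i => i.elim, hyE, by simp⟩

end Tower

/-! ### Reduction to elementary field extensions without new constants -/

section Countable

variable {L : Type*} [CommRing L]

/-- The elementary description of an element involves only countably many elements. -/
theorem IsElem.exists_countable {D : SelfDeriv L} {S : Set L} {y : L} (hy : IsElem D S y) :
    ∃ C : Set L, C.Countable ∧ ∀ (A : Subring L) (hA : ∀ a ∈ A, D a ∈ A), S ⊆ A → C ⊆ A →
      ∃ h : y ∈ A, IsElem (restrictDeriv D A hA) (Subtype.val ⁻¹' S) (⟨y, h⟩ : A) := by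
  induction hy with
  | @base a h => exact ⟨∅, Set.countable_empty, fun A hA hS _ => ⟨hS h, IsElem.base h⟩⟩
  | one => exact ⟨∅, Set.countable_empty, fun A hA hS _ => ⟨A.one_mem, IsElem.one⟩⟩
  | add _ _ iha ihb =>
    obtain ⟨C₁, h1, h2⟩ := iha
    obtain ⟨C₂, h3, h4⟩ := ihb
    refine ⟨C₁ ∪ C₂, h1.union h3, fun A hA hS hC => ?_⟩
    obtain ⟨h5, h6⟩ := h2 A hA hS (Set.subset_union_left.trans hC)
    obtain ⟨h7, h8⟩ := h4 A hA hS (Set.subset_union_right.trans hC)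
    exact ⟨A.add_mem h5 h7, h6.add h8⟩
  | sub _ _ iha ihb =>
    obtain ⟨C₁, h1, h2⟩ := iha
    obtain ⟨C₂, h3, h4⟩ := ihb
    refine ⟨C₁ ∪ C₂, h1.union h3, fun A hA hS hC => ?_⟩
    obtain ⟨h5, h6⟩ := h2 A hA hS (Set.subset_union_left.trans hC)
    obtain ⟨h7, h8⟩ := h4 A hA hS (Set.subset_union_right.trans hC)
    exact ⟨A.sub_mem h5 h7, h6.sub h8⟩
  | mul _ _ iha ihb =>
    obtain ⟨C₁, h1, h2⟩ := iha
    obtain ⟨C₂, h3, h4⟩ := ihb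
    refine ⟨C₁ ∪ C₂, h1.union h3, fun A hA hS hC => ?_⟩
    obtain ⟨h5, h6⟩ := h2 A hA hS (Set.subset_union_left.trans hC)
    obtain ⟨h7, h8⟩ := h4 A hA hS (Set.subset_union_right.trans hC)
    exact ⟨A.mul_mem h5 h7, h6.mul h8⟩
  | @inv a b _ h ih =>
    obtain ⟨C, h1, h2⟩ := ih
    refine ⟨insert b C, h1.insert b, fun A hA hS hC => ?_⟩
    obtain ⟨h5, h6⟩ := h2 A hA hS ((Set.subset_insert _ _).trans hC)
    exact ⟨hC (Set.mem_insert _ _), h6.inv (Subtype.ext h)⟩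
  | deriv _ ih =>
    obtain ⟨C, h1, h2⟩ := ih
    refine ⟨C, h1, fun A hA hS hC => ?_⟩
    obtain ⟨h5, h6⟩ := h2 A hA hS hC
    exact ⟨hA _ h5, h6.deriv⟩
  | @alg n c b _ h ih =>
    choose C h1 h2 using ih
    refine ⟨insert b (⋃ i, C i), (Set.countable_iUnion h1).insert b, fun A hA hS hC => ?_⟩
    choose h5 h6 using fun i => h2 i A hA hS
      (((Set.subset_iUnion C i).trans (Set.subset_insert _ _)).trans hC)
    refine ⟨hC (Set.mem_insert _ _), IsElem.alg h6 (Subtype.ext ?_)⟩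
    push_cast
    exact h
  | @exp a b e _ hb h ih =>
    obtain ⟨C, h1, h2⟩ := ih
    -- The inverse `e` is recorded as well, since `b` has to be a unit of the subring.
    refine ⟨insert b (insert e C), (h1.insert e).insert b, fun A hA hS hC => ?_⟩
    obtain ⟨h5, h6⟩ := h2 A hA hS
      (((Set.subset_insert _ _).trans (Set.subset_insert _ _)).trans hC)
    exact ⟨hC (Set.mem_insert _ _), h6.exp
      (e := ⟨e, hC (Set.mem_insert_of_mem _ (Set.mem_insert _ _))⟩) (Subtype.ext hb)
      (Subtype.ext h)⟩
  | @log a b e _ he h ih =>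
    obtain ⟨C, h1, h2⟩ := ih
    refine ⟨insert b (insert e C), (h1.insert e).insert b, fun A hA hS hC => ?_⟩
    obtain ⟨h5, h6⟩ := h2 A hA hS
      (((Set.subset_insert _ _).trans (Set.subset_insert _ _)).trans hC)
    exact ⟨hC (Set.mem_insert _ _), h6.log
      (e := ⟨e, hC (Set.mem_insert_of_mem _ (Set.mem_insert _ _))⟩) (Subtype.ext he)
      (Subtype.ext h)⟩

/-- A countable set of elements lies in a differential subalgebra of countable dimension. -/
theorem exists_diffSubalgebra {k : Type*} [Field k] [Algebra k L] (d : SelfDeriv k)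
    (D : SelfDeriv L) (hD : ∀ a, D (algebraMap k L a) = algebraMap k L (d a)) {C : Set L}
    (hC : C.Countable) :
    ∃ A : Subalgebra k L, (∀ a ∈ A, D a ∈ A) ∧ C ⊆ A ∧ Module.rank k A ≤ Cardinal.aleph0 := by
  let C' : Set L := ⋃ n : ℕ, D^[n] '' C
  have hC' : C'.Countable := Set.countable_iUnion fun n => hC.image _
  refine ⟨Algebra.adjoin k C', fun a ha => ?_, fun c hc => ?_, ?_⟩
  · induction ha using Algebra.adjoin_induction with
    | mem x hx =>
      obtain ⟨n, c, hc, rfl⟩ := Set.mem_iUnion.1 hx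
      refine Algebra.subset_adjoin (Set.mem_iUnion.2 ⟨n + 1, c, hc, ?_⟩)
      rw [Function.iterate_succ_apply']
    | algebraMap r => rw [hD]; exact Subalgebra.algebraMap_mem _ _
    | add x y _ _ hx hy => rw [map_add]; exact add_mem hx hy
    | mul x y hx' hy' hx hy =>
      rw [SelfDeriv.map_mul]
      exact add_mem (mul_mem hx' hy) (mul_mem hy' hx)
  · exact Algebra.subset_adjoin (Set.mem_iUnion.2 ⟨0, c, hc, rfl⟩)
  · refine (Algebra.rank_adjoin_le C').trans (max_le ?_ le_rfl)
    exact hC'.le_aleph0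

end Countable

/-! ### Constants of differentially simple rings -/

section Constants

open Polynomial

variable {k : Type*} [Field k] [CharZero k] [Algebra ℂ k] {d : SelfDeriv k}

/-- An algebraic constant is a complex number. -/
theorem mem_range_of_isAlgebraic {Q : Type*} [Field Q] [Algebra k Q] (D : SelfDeriv Q)
    (hD : ∀ a, D (algebraMap k Q a) = algebraMap k Q (d a))
    (hconst : ∀ c, d c = 0 → c ∈ (algebraMap ℂ k).range) {c : Q} (hc : D c = 0)
    (halg : IsAlgebraic k c) : c ∈ (algebraMap k Q).range := by
  let _ : Differential k := ⟨d⟩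
  let _ : Differential Q := ⟨D⟩
  have _ : DifferentialAlgebra k Q := ⟨hD⟩
  set p := minpoly k c with hp
  have hmonic : p.Monic := minpoly.monic halg.isIntegral
  have hirr : Irreducible p := minpoly.irreducible halg.isIntegral
  have h1 : aeval c (Differential.mapCoeffs p) = 0 := by
    have := Differential.deriv_aeval_eq (A := k) (R := Q) c p
    rw [minpoly.aeval, map_zero, show (Differential.deriv c : Q) = 0 from hc, mul_zero,
      add_zero] at this
    exact this.symm
  have hcoeff : ∀ n, (Differential.mapCoeffs p).coeff n = d (p.coeff n) := fun n => by
    rw [Differential.coeff_mapCoeffs]; rfl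
  -- As `p` is monic, differentiating its coefficients lowers the degree, while `c` remains a root;
  -- minimality forces zero. So `p` has constant, that is complex, coefficients.
  have h2 : Differential.mapCoeffs p = 0 := by
    by_contra hne
    have h3 := minpoly.degree_le_of_ne_zero k c hne h1
    have h4 : (Differential.mapCoeffs p).coeff (Differential.mapCoeffs p).natDegree ≠ 0 := by
      simpa using hne
    rw [hcoeff] at h4
    have h5 := Polynomial.natDegree_le_natDegree h3
    rw [← hp] at h5
    rcases h5.eq_or_lt with h6 | h6
    · rw [← h6, hmonic.coeff_natDegree] at h4
      exact h4 (by simp)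
    · rw [Polynomial.coeff_eq_zero_of_natDegree_lt h6] at h4
      exact h4 (by simp)
  have h3 : p ∈ Polynomial.lifts (algebraMap ℂ k) := by
    rw [Polynomial.lifts_iff_coeff_lifts]
    intro n
    have := hconst (p.coeff n) (by rw [← hcoeff, h2, coeff_zero])
    exact this
  obtain ⟨q, hq⟩ := h3
  rw [Polynomial.coe_mapRingHom] at hq
  have hdeg : q.degree ≠ 0 := by
    have : q.degree = p.degree := by rw [← hq, Polynomial.degree_map]
    rw [this]
    exact (Polynomial.degree_pos_of_irreducible hirr).ne'
  -- An irreducible polynomial with a complex root is linear.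
  obtain ⟨z, hz⟩ := IsAlgClosed.exists_root q hdeg
  have hroot : p.IsRoot (algebraMap ℂ k z) := by
    rw [← hq]
    exact hz.map
  exact minpoly.mem_range_of_degree_eq_one k c
    (Polynomial.degree_eq_one_of_irreducible_of_root hirr hroot)

/-- The constants of the fraction field of a simple differential ring of countable dimension are
complex numbers. -/
theorem mem_range_of_isDiffSimple {S Q : Type} [CommRing S] [IsDomain S] [Field Q] [Algebra S Q]
    [IsFractionRing S Q] [Algebra k S] [Algebra k Q] [IsScalarTower k S Q] {DS : SelfDeriv S}
    (hsimple : IsDiffSimple DS) (hrank : Module.rank k S ≤ Cardinal.aleph0)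
    (hDS : ∀ a, DS (algebraMap k S a) = algebraMap k S (d a))
    (hdC : ∀ z : ℂ, d (algebraMap ℂ k z) = 0)
    (hconst : ∀ c, d c = 0 → c ∈ (algebraMap ℂ k).range) {c : Q}
    (hc : fractionDeriv Q DS c = 0) : c ∈ (algebraMap k Q).range := by
  have hDQ : ∀ a, fractionDeriv Q DS (algebraMap k Q a) = algebraMap k Q (d a) := fun a => by
    rw [IsScalarTower.algebraMap_apply k S Q, fractionDeriv_algebraMap, hDS,
      ← IsScalarTower.algebraMap_apply]
  by_cases halg : IsAlgebraic k c
  · exact mem_range_of_isAlgebraic _ hDQ hconst hc halg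
  exfalso
  have hinj : Function.Injective (algebraMap S Q) := IsFractionRing.injective S Q
  -- The denominators of a constant `c` form a differential ideal. It is nonzero, so by simplicity
  -- it contains `1`.
  obtain ⟨s, rfl⟩ : c ∈ (algebraMap S Q).range := by
    let I : Ideal S :=
      { carrier := {s | algebraMap S Q s * c ∈ (algebraMap S Q).range}
        zero_mem' := by simp [zero_mem]
        add_mem' := fun {a b} ha hb => by
          simp only [Set.mem_ofPred_eq, map_add, add_mul]
          exact add_mem ha hb
        smul_mem' := fun a b hb => by
          simp only [Set.mem_ofPred_eq, smul_eq_mul, map_mul, mul_assoc]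
          exact mul_mem ⟨a, rfl⟩ hb }
    have hI : ∀ a ∈ I, DS a ∈ I := by
      rintro a ⟨r, hr⟩
      refine ⟨DS r, ?_⟩
      rw [← fractionDeriv_algebraMap Q, hr, SelfDeriv.map_mul, hc, mul_zero, zero_add,
        fractionDeriv_algebraMap, mul_comm]
    rcases hsimple I hI with h | h
    · obtain ⟨a, b, hb, hab⟩ := IsFractionRing.div_surjective (A := S) c
      have hb0 : b ≠ 0 := nonZeroDivisors.ne_zero hb
      have hb1 : algebraMap S Q b ≠ 0 := by simpa using hb0
      have : b ∈ I := ⟨a, by rw [← hab]; field_simp⟩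
      rw [h] at this
      exact absurd this hb0
    · have : (1 : S) ∈ I := h ▸ Submodule.mem_top
      obtain ⟨r, hr⟩ := this
      exact ⟨r, by rw [hr]; simp⟩
  have hs : DS s = 0 := by
    apply hinj
    rw [← fractionDeriv_algebraMap, hc, map_zero]
  have hne : ∀ a : k, s ≠ algebraMap k S a := by
    rintro a rfl
    apply halg
    rw [← IsScalarTower.algebraMap_apply]
    exact isAlgebraic_algebraMap a
  -- A nonzero constant generates a nonzero differential ideal, so it is a unit of the simple ring
  -- `S`.
  have hinv : ∀ z : ℂ, ∃ r : S, (s - algebraMap k S (algebraMap ℂ k z)) * r = 1 := by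
    intro z
    rcases hsimple (Ideal.span {s - algebraMap k S (algebraMap ℂ k z)}) (by
      intro a ha
      obtain ⟨b, rfl⟩ := Ideal.mem_span_singleton'.1 ha
      rw [SelfDeriv.map_mul, map_sub, hs, hDS, hdC, map_zero, sub_zero, mul_zero, zero_add]
      exact Ideal.mem_span_singleton'.2 ⟨DS b, mul_comm _ _⟩) with h | h
    · rw [Ideal.span_singleton_eq_bot, sub_eq_zero] at h
      exact absurd h (hne _)
    · obtain ⟨b, hb⟩ := Ideal.mem_span_singleton'.1 ((Ideal.eq_top_iff_one _).1 h)
      exact ⟨b, by rw [mul_comm, hb]⟩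
  choose r hr using hinv
  -- The inverses of `s - z` are independent because `s` is transcendental over `k`; there are
  -- continuum many of them in a space of countable dimension.
  have hli : LinearIndependent k r := by
    apply LinearIndependent.of_comp (IsScalarTower.toAlgHom k S Q).toLinearMap
    have h1 := (Transcendental.linearIndependent_sub_inv halg).comp (algebraMap ℂ k)
      (algebraMap ℂ k).injective
    have h3 : ((fun a => (algebraMap S Q s - algebraMap k Q a)⁻¹) ∘ algebraMap ℂ k) =
        (IsScalarTower.toAlgHom k S Q).toLinearMap ∘ r := by
      funext z
      have h2 := congrArg (algebraMap S Q) (hr z)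
      rw [map_mul, map_sub, map_one, ← IsScalarTower.algebraMap_apply k S Q] at h2
      exact (eq_inv_of_mul_eq_one_right h2).symm
    rwa [h3] at h1
  have h3 := hli.cardinal_le_rank.trans hrank
  rw [Cardinal.mk_complex] at h3
  exact absurd h3 (not_le.2 Cardinal.aleph0_lt_continuum)

end Constants

/-- **Liouville's theorem** in a differential ring: an element of the differential field `k` that
has an elementary primitive in some nontrivial differential ring over `k` has a logarithmic
form. -/
theorem hasLogForm_of_isElem {k L : Type} [Field k] [CharZero k] [Algebra ℂ k] {d : SelfDeriv k}
    (hdC : ∀ z : ℂ, d (algebraMap ℂ k z) = 0)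
    (hconst : ∀ c, d c = 0 → c ∈ (algebraMap ℂ k).range) [CommRing L] [Nontrivial L]
    {D : SelfDeriv L} (i : k →+* L) (hi : ∀ a, D (i a) = i (d a)) {y : L}
    (hy : IsElem D (Set.range i) y) {f : k} (hf : D y = i f) : HasLogForm d f := by
  let _ : Algebra k L := i.toAlgebra
  obtain ⟨C, hC, hCy⟩ := hy.exists_countable
  obtain ⟨A, hAst, hCA, hrank⟩ := exists_diffSubalgebra d D hi hC
  obtain ⟨hyA, hyE⟩ := hCy A.toSubring hAst
    (by rintro _ ⟨a, rfl⟩; exact A.algebraMap_mem a) hCA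
  set DA : SelfDeriv A := restrictDeriv D A.toSubring hAst with hDA
  -- The conditions in `IsElem` are equations, so `y` stays elementary modulo `I`, and `k` still
  -- embeds because the quotient is nontrivial.
  obtain ⟨I, hI, hIT, hsimple⟩ := exists_maximal_diffIdeal DA
  have : Nontrivial (A ⧸ I) := Ideal.Quotient.nontrivial_iff.2 hIT
  let _ : Algebra ℚ (A ⧸ I) := ((algebraMap k (A ⧸ I)).comp (algebraMap ℚ k)).toAlgebra
  have : IsDomain (A ⧸ I) := hsimple.isDomain
  let Q := FractionRing (A ⧸ I)
  set DS := quotientDeriv DA I hI with hDS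
  let π : A →+* Q := (algebraMap (A ⧸ I) Q).comp (Ideal.Quotient.mk I)
  have hπ : ∀ a, fractionDeriv Q DS (π a) = π (DA a) := fun a => by
    rw [RingHom.comp_apply, fractionDeriv_algebraMap, quotientDeriv_mk]
    rfl
  have hk : ∀ a, DS (algebraMap k (A ⧸ I) a) = algebraMap k (A ⧸ I) (d a) := by
    intro a
    change Ideal.Quotient.mk I (DA (algebraMap k A a)) = Ideal.Quotient.mk I (algebraMap k A (d a))
    congr 1
    exact Subtype.ext (hi a)
  have hkQ : ∀ a, fractionDeriv Q DS (algebraMap k Q a) = algebraMap k Q (d a) := fun a => by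
    rw [IsScalarTower.algebraMap_apply k (A ⧸ I) Q, fractionDeriv_algebraMap, hk,
      ← IsScalarTower.algebraMap_apply]
  have hrank' : Module.rank k (A ⧸ I) ≤ Cardinal.aleph0 :=
    (LinearMap.rank_le_of_surjective (Ideal.Quotient.mkₐ k I).toLinearMap
      Ideal.Quotient.mk_surjective).trans hrank
  have : CharZero Q := charZero_of_injective_algebraMap (algebraMap k Q).injective
  have hπk : ∀ a : k, π (algebraMap k A a) = algebraMap k Q a := fun a => rfl
  have hyQ : IsElem (fractionDeriv Q DS) ((algebraMap k Q).fieldRange : Set Q) (π ⟨y, hyA⟩) := by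
    refine IsElem.map π hπ ?_ hyE
    rintro ⟨_, ha'⟩ ⟨a, rfl⟩
    exact IsElem.base ⟨a, hπk a⟩
  have hDy : fractionDeriv Q DS (π ⟨y, hyA⟩) = algebraMap k Q f := by
    rw [hπ, ← hπk]
    congr 1
    exact Subtype.ext hf
  have hform := hasLogFormIn_of_isElem (E₀ := (algebraMap k Q).fieldRange)
    (by rintro _ ⟨a, rfl⟩; exact ⟨d a, (hkQ a).symm⟩)
    (fun c hc => mem_range_of_isDiffSimple hsimple hrank' hk hdC hconst hc) hyQ
    (hDy ▸ ⟨f, rfl⟩)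
  rw [hDy] at hform
  obtain ⟨ι, _, c, u, v, hc, hu, ⟨v', rfl⟩, h⟩ := hform
  choose u' hu' using hu
  choose c' hc' using fun j =>
    mem_range_of_isDiffSimple hsimple hrank' hk hdC hconst (hc j)
  refine ⟨ι, inferInstance, c', u', v', fun j => ?_, ?_⟩
  · apply (algebraMap k Q).injective
    rw [← hkQ, hc', hc, map_zero]
  · apply (algebraMap k Q).injective
    rw [h]
    simp [hu', hc', ← hkQ]

/-! ### Elements that are elementary in some extension -/

section IsElemOver

variable {M : Type} [Field M]

/-- `g` is elementary over `S` in some differential ring that contains the differential field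
`M`. -/
def IsElemOver (D : SelfDeriv M) (S : Set M) (g : M) : Prop :=
  ∃ (L : Type) (_ : CommRing L) (_ : Nontrivial L) (D' : SelfDeriv L) (j : M →+* L),
    (∀ a, D' (j a) = j (D a)) ∧ IsElem D' (j '' S) (j g)

variable {D : SelfDeriv M} {S : Set M}

theorem IsElem.isElemOver {g : M} (hg : IsElem D S g) : IsElemOver D S g :=
  ⟨M, inferInstance, inferInstance, D, RingHom.id M, fun _ => rfl, by simpa using hg⟩

/-- Finitely many elements that are elementary in some extensions are elementary in a common
one. -/
theorem IsElemOver.exists_common {n : ℕ} {c : Fin n → M} (hc : ∀ i, IsElemOver D S (c i)) :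
    ∃ (L : Type) (_ : CommRing L) (_ : Nontrivial L) (D' : SelfDeriv L) (j : M →+* L),
      (∀ a, D' (j a) = j (D a)) ∧ ∀ i, IsElem D' (j '' S) (j (c i)) := by
  induction n with
  | zero =>
    exact ⟨M, inferInstance, inferInstance, D, RingHom.id M, fun _ => rfl, fun i => i.elim0⟩
  | succ n ih =>
    obtain ⟨L₁, _, _, D₁, j₁, h₁, e₁⟩ := ih (c := fun i => c i.castSucc) fun i => hc _
    obtain ⟨L₂, _, _, D₂, j₂, h₂, e₂⟩ := hc (Fin.last n)
    obtain ⟨T, _, _, DT, i, j, hi, hj, hij⟩ := exists_amalgam j₁ j₂ D₁ D₂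
      (fun r => ⟨D r, h₁ r, h₂ r⟩)
    refine ⟨T, inferInstance, inferInstance, DT, i.comp j₁, fun a => ?_, fun m => ?_⟩
    · simp only [RingHom.comp_apply, hi, h₁]
    · refine Fin.lastCases ?_ (fun m => ?_) m
      · rw [RingHom.comp_apply, hij]
        refine IsElem.map j hj ?_ e₂
        rintro _ ⟨s, hs, rfl⟩
        exact IsElem.base ⟨s, hs, hij s⟩
      · refine IsElem.map i hi ?_ (e₁ m)
        rintro _ ⟨s, hs, rfl⟩
        exact IsElem.base ⟨s, hs, rfl⟩

/-- Closure under each operation thus reduces to an equation in `M` itself. -/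
theorem IsElemOver.of_isElem {n : ℕ} {c : Fin n → M} (hc : ∀ i, IsElemOver D S (c i)) {g : M}
    (hg : IsElem D (Set.range c) g) : IsElemOver D S g := by
  obtain ⟨L, _, _, D', j, hj, h⟩ := IsElemOver.exists_common hc
  refine ⟨L, inferInstance, inferInstance, D', j, hj, IsElem.map j hj ?_ hg⟩
  rintro _ ⟨i, rfl⟩
  exact h i

theorem IsElemOver.of_isElem_one {a : M} (ha : IsElemOver D S a) {g : M}
    (hg : IsElem D {a} g) : IsElemOver D S g :=
  IsElemOver.of_isElem (c := ![a]) (by simpa using ha) (by simpa using hg)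

theorem IsElemOver.of_isElem_two {a b : M} (ha : IsElemOver D S a) (hb : IsElemOver D S b) {g : M}
    (hg : IsElem D {a, b} g) : IsElemOver D S g := by
  have h : Set.range ![a, b] = {a, b} := by ext; simp [eq_comm, or_comm]
  exact IsElemOver.of_isElem (c := ![a, b]) (by simp [Fin.forall_fin_two, ha, hb]) (h ▸ hg)

/-- Being elementary depends only on the differential field generated. -/
theorem IsElemOver.transfer {F : Type*} [Field F] {M' : Type} [Field M'] {D' : SelfDeriv M'}
    (i : F →+* M) (i' : F →+* M') (h : ∀ r, ∃ r', D (i r) = i r' ∧ D' (i' r) = i' r')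
    {S : Set F} {g : F} (hg : IsElemOver D (i '' S) (i g)) : IsElemOver D' (i' '' S) (i' g) := by
  obtain ⟨L, _, _, DL, j, hj, e⟩ := hg
  -- The extension `L` of `M` is glued to `M'` along `F`; `M` itself need not map to `M'`.
  obtain ⟨T, _, _, DT, k, l, hk, hl, hkl⟩ := exists_amalgam (j.comp i) i' DL D' (fun r => by
    obtain ⟨r', h₁, h₂⟩ := h r
    exact ⟨r', by rw [RingHom.comp_apply, hj, h₁]; rfl, h₂⟩)
  refine ⟨T, inferInstance, inferInstance, DT, l, hl, ?_⟩
  rw [← hkl]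
  refine IsElem.map k hk ?_ e
  rintro _ ⟨_, ⟨s, hs, rfl⟩, rfl⟩
  exact IsElem.base ⟨i' s, ⟨s, hs, rfl⟩, (hkl s).symm⟩

/-- Elementary elements are preserved by a change of variable. -/
theorem IsElemOver.comp {M₀ : Type} [Field M₀] {D₀ : SelfDeriv M₀} {S₀ : Set M₀} {z g : M₀}
    (i : M₀ →+* M) {u : M} (hu : u ≠ 0) (hi : ∀ a, D (i a) = u * i (D₀ a)) (hz : D₀ z = 1)
    (hS : ∀ s ∈ S₀, i s ∈ S) (hiz : IsElemOver D S (i z)) (hg : IsElemOver D₀ (insert z S₀) g) :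
    IsElemOver D S (i g) := by
  obtain ⟨L₀, _, _, DL₀, j₀, hj₀, e₀⟩ := hg
  obtain ⟨L₁, _, _, DL₁, j₁, hj₁, e₁⟩ := hiz
  -- With respect to `u⁻¹ D` the map `i` is a homomorphism of differential rings, so `L₀` and `M`
  -- can be amalgamated over `M₀`.
  obtain ⟨T, _, _, DT, k₀, k, hk₀, hk, hkk⟩ := exists_amalgam j₀ i DL₀ (SelfDeriv.addMul 0 u⁻¹ D)
    (fun r => ⟨D₀ r, hj₀ r, by
      rw [SelfDeriv.addMul_apply, hi, inv_mul_cancel_left₀ hu]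
      exact zero_add _⟩)
  -- Multiplying back by `u` restores `D` on `M`, which permits the second amalgamation, with the
  -- ring where `i z` is elementary.
  have hDT : ∀ m, SelfDeriv.addMul 0 (k u) DT (k m) = k (D m) := by
    intro m
    rw [SelfDeriv.addMul_apply, hk, SelfDeriv.addMul_apply, Derivation.zero_apply, zero_add,
      Derivation.zero_apply, zero_add, ← map_mul, mul_inv_cancel_left₀ hu]
  obtain ⟨T', _, _, DT', l, l₁, hl, hl₁, hll⟩ := exists_amalgam k j₁
    (SelfDeriv.addMul 0 (k u) DT) DL₁ (fun r => ⟨D r, hDT r, hj₁ r⟩)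
  have hlk : ∀ a, DT' (l (k a)) = l (k (D a)) := fun a => by rw [hl, hDT]
  refine ⟨T', inferInstance, inferInstance, DT', l.comp k, hlk, ?_⟩
  have hz' : IsElem DT' ((l.comp k) '' S) (l (k (i z))) := by
    rw [hll]
    refine IsElem.map l₁ hl₁ ?_ e₁
    rintro _ ⟨s, hs, rfl⟩
    exact IsElem.base ⟨s, hs, hll s⟩
  -- Since `D₀ z = 1`, the factor `u` is the derivative of `i z`.
  have hu' : IsElem DT' ((l.comp k) '' S) (l (k u)) := by
    have := hz'.deriv
    rwa [hlk, hi, hz, map_one, mul_one] at this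
  rw [RingHom.comp_apply, ← hkk]
  refine IsElem.map_of_unit (l.comp k₀) (u := l (k u)) (v := l (k u⁻¹)) ?_ hu' (fun a => ?_) ?_ e₀
  · rw [← map_mul, ← map_mul, mul_inv_cancel₀ hu, map_one, map_one]
  · rw [RingHom.comp_apply, hl, SelfDeriv.addMul_apply, Derivation.zero_apply, zero_add, map_mul,
      hk₀, RingHom.comp_apply]
  · rintro _ ⟨s, hs, rfl⟩
    rw [RingHom.comp_apply, hkk]
    rcases Set.mem_insert_iff.1 hs with rfl | hs
    · exact hz'
    · exact IsElem.base ⟨i s, hS s hs, rfl⟩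

end IsElemOver

/-! ### Germs of meromorphic functions -/

section Germ

/-- The field of germs at `z` of meromorphic functions. -/
def merGerm (z : ℂ) : Subring (Germ (𝓝[≠] z) ℂ) where
  carrier := {g | ∃ f : ℂ → ℂ, MeromorphicAt f z ∧ (f : Germ (𝓝[≠] z) ℂ) = g}
  zero_mem' := ⟨fun _ => 0, MeromorphicAt.const 0 z, rfl⟩
  one_mem' := ⟨fun _ => 1, MeromorphicAt.const 1 z, rfl⟩
  add_mem' := by
    rintro _ _ ⟨f, hf, rfl⟩ ⟨g, hg, rfl⟩
    exact ⟨f + g, hf.add hg, rfl⟩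
  mul_mem' := by
    rintro _ _ ⟨f, hf, rfl⟩ ⟨g, hg, rfl⟩
    exact ⟨f * g, hf.mul hg, rfl⟩
  neg_mem' := by
    rintro _ ⟨f, hf, rfl⟩
    exact ⟨-f, hf.neg, rfl⟩

/-- The germ at `z` of a meromorphic function; by convention `0` if `f` is not meromorphic. -/
def toGerm (z : ℂ) (f : ℂ → ℂ) : merGerm z :=
  open Classical in if h : MeromorphicAt f z then ⟨(f : Germ (𝓝[≠] z) ℂ), f, h, rfl⟩ else 0

variable {z : ℂ} {f g : ℂ → ℂ}

theorem coe_toGerm (hf : MeromorphicAt f z) :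
    (toGerm z f : Germ (𝓝[≠] z) ℂ) = (f : Germ (𝓝[≠] z) ℂ) := by
  rw [toGerm, dif_pos hf]

theorem exists_toGerm (a : merGerm z) : ∃ f, MeromorphicAt f z ∧ toGerm z f = a := by
  obtain ⟨_, f, hf, rfl⟩ := a
  exact ⟨f, hf, Subtype.ext (coe_toGerm hf)⟩

theorem toGerm_eq_iff (hf : MeromorphicAt f z) (hg : MeromorphicAt g z) :
    toGerm z f = toGerm z g ↔ f =ᶠ[𝓝[≠] z] g := by
  rw [Subtype.ext_iff, coe_toGerm hf, coe_toGerm hg, Germ.coe_eq]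

theorem toGerm_congr (h : f =ᶠ[𝓝[≠] z] g) : toGerm z f = toGerm z g := by
  by_cases hf : MeromorphicAt f z
  · exact (toGerm_eq_iff hf (hf.congr h)).2 h
  · rw [toGerm, toGerm, dif_neg hf, dif_neg (fun hg => hf (hg.congr h.symm))]

theorem toGerm_add (hf : MeromorphicAt f z) (hg : MeromorphicAt g z) :
    toGerm z (fun w => f w + g w) = toGerm z f + toGerm z g :=
  Subtype.ext (by
    rw [coe_toGerm (hf.fun_add hg), Subring.coe_add, coe_toGerm hf, coe_toGerm hg]; rfl)

theorem toGerm_sub (hf : MeromorphicAt f z) (hg : MeromorphicAt g z) :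
    toGerm z (fun w => f w - g w) = toGerm z f - toGerm z g :=
  Subtype.ext (by
    rw [coe_toGerm (hf.fun_sub hg), AddSubgroupClass.coe_sub, coe_toGerm hf, coe_toGerm hg]; rfl)

theorem toGerm_mul (hf : MeromorphicAt f z) (hg : MeromorphicAt g z) :
    toGerm z (fun w => f w * g w) = toGerm z f * toGerm z g :=
  Subtype.ext (by
    rw [coe_toGerm (hf.fun_mul hg), Subring.coe_mul, coe_toGerm hf, coe_toGerm hg]; rfl)

theorem toGerm_zero : toGerm z (fun _ => 0) = 0 :=
  Subtype.ext (by rw [coe_toGerm (MeromorphicAt.const 0 z)]; rfl)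

theorem toGerm_one : toGerm z (fun _ => 1) = 1 :=
  Subtype.ext (by rw [coe_toGerm (MeromorphicAt.const 1 z)]; rfl)

theorem toGerm_eq_zero_iff (hf : MeromorphicAt f z) :
    toGerm z f = 0 ↔ ∀ᶠ w in 𝓝[≠] z, f w = 0 := by
  rw [← toGerm_zero, toGerm_eq_iff hf (MeromorphicAt.const 0 z)]
  rfl

instance : Field (merGerm z) :=
  { (inferInstance : CommRing (merGerm z)) with
    inv := fun a => ⟨(a : Germ (𝓝[≠] z) ℂ)⁻¹, by
      obtain ⟨_, f, hf, rfl⟩ := a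
      exact ⟨f⁻¹, hf.inv, rfl⟩⟩
    exists_pair_ne := ⟨0, 1, by
      rw [← toGerm_zero, ← toGerm_one, Ne, toGerm_eq_iff (MeromorphicAt.const 0 z)
        (MeromorphicAt.const 1 z)]
      intro h
      obtain ⟨w, hw⟩ := h.exists
      exact zero_ne_one hw⟩
    mul_inv_cancel := by
      intro a ha
      obtain ⟨f, hf, rfl⟩ := exists_toGerm a
      rw [Ne, toGerm_eq_zero_iff hf] at ha
      have h1 := hf.eventually_eq_zero_or_eventually_ne_zero.resolve_left ha
      apply Subtype.ext
      change (toGerm z f : Germ (𝓝[≠] z) ℂ) * (toGerm z f : Germ (𝓝[≠] z) ℂ)⁻¹ = 1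
      rw [coe_toGerm hf]
      refine Germ.coe_eq.2 ?_
      filter_upwards [h1] with w hw
      simp [hw]
    inv_zero := Subtype.ext (by
      change ((0 : ℂ → ℂ) : Germ (𝓝[≠] z) ℂ)⁻¹ = _
      refine Germ.coe_eq.2 ?_
      filter_upwards with w
      simp)
    nnqsmul := _
    nnqsmul_def := fun _ _ => rfl
    qsmul := _
    qsmul_def := fun _ _ => rfl }

theorem toGerm_inv (hf : MeromorphicAt f z) : toGerm z (fun w => (f w)⁻¹) = (toGerm z f)⁻¹ :=
  Subtype.ext (by
    rw [coe_toGerm hf.fun_inv]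
    change _ = (toGerm z f : Germ (𝓝[≠] z) ℂ)⁻¹
    rw [coe_toGerm hf]; rfl)

theorem toGerm_div (hf : MeromorphicAt f z) (hg : MeromorphicAt g z) :
    toGerm z (fun w => f w / g w) = toGerm z f / toGerm z g := by
  simp only [div_eq_mul_inv]
  rw [toGerm_mul hf hg.fun_inv, toGerm_inv hg]

/-- The derivation `d / dz` of the field of germs. -/
def germDeriv (z : ℂ) : SelfDeriv (merGerm z) :=
  -- Independence of the representative: functions equal on a punctured neighbourhood have equal
  -- derivatives there.
  have key : ∀ f, MeromorphicAt f z →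
      toGerm z (deriv (exists_toGerm (toGerm z f)).choose) = toGerm z (deriv f) := fun f hf => by
    obtain ⟨h1, h2⟩ := (exists_toGerm (toGerm z f)).choose_spec
    exact toGerm_congr ((toGerm_eq_iff h1 hf).1 h2).nhdsNE_deriv
  have hadd : ∀ a b : merGerm z, toGerm z (deriv (exists_toGerm (a + b)).choose) =
      toGerm z (deriv (exists_toGerm a).choose) + toGerm z (deriv (exists_toGerm b).choose) := by
    intro a b
    obtain ⟨f, hf, rfl⟩ := exists_toGerm a
    obtain ⟨g, hg, rfl⟩ := exists_toGerm b
    rw [← toGerm_add hf hg, key f hf, key g hg, key _ (hf.fun_add hg), ← toGerm_add hf.deriv hg.deriv]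
    apply toGerm_congr
    filter_upwards [hf.eventually_analyticAt, hg.eventually_analyticAt] with w h1 h2
    exact deriv_fun_add h1.differentiableAt h2.differentiableAt
  derivationOfLeibniz
    (AddMonoidHom.mk' (fun a => toGerm z (deriv (exists_toGerm a).choose)) hadd)
    (fun a b => by
      obtain ⟨f, hf, rfl⟩ := exists_toGerm a
      obtain ⟨g, hg, rfl⟩ := exists_toGerm b
      simp only [AddMonoidHom.mk'_apply]
      rw [← toGerm_mul hf hg, key f hf, key g hg, key _ (hf.fun_mul hg), ← toGerm_mul hf hg.deriv,
        ← toGerm_mul hg hf.deriv, ← toGerm_add (hf.fun_mul hg.deriv) (hg.fun_mul hf.deriv)]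
      apply toGerm_congr
      filter_upwards [hf.eventually_analyticAt, hg.eventually_analyticAt] with w h1 h2
      rw [deriv_fun_mul h1.differentiableAt h2.differentiableAt]
      ring)

theorem germDeriv_toGerm (hf : MeromorphicAt f z) :
    germDeriv z (toGerm z f) = toGerm z (deriv f) := by
  obtain ⟨h1, h2⟩ := (exists_toGerm (toGerm z f)).choose_spec
  exact toGerm_congr ((toGerm_eq_iff h1 hf).1 h2).nhdsNE_deriv

/-- The derivation `d / dX` of the field of germs. -/
def germDerivWrt (z : ℂ) (X : ℂ → ℂ) : SelfDeriv (merGerm z) :=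
  SelfDeriv.addMul 0 (toGerm z (deriv X))⁻¹ (germDeriv z)

theorem germDerivWrt_toGerm {X : ℂ → ℂ} (hX : MeromorphicAt X z) (hf : MeromorphicAt f z) :
    germDerivWrt z X (toGerm z f) = toGerm z (fun w => deriv f w / deriv X w) := by
  rw [germDerivWrt, SelfDeriv.addMul_apply, Derivation.zero_apply, zero_add, germDeriv_toGerm hf,
    toGerm_div hf.deriv hX.deriv, div_eq_inv_mul]

end Germ

/-! ### Functions on a Riemann surface in different charts -/

section Charts

variable {U : Type*} [TopologicalSpace U] [ChartedSpace ℂ U]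

theorem eventually_nhds_chart {p : U} {P : U → Prop} :
    (∀ᶠ w in 𝓝 (chartAt ℂ p p), P ((chartAt ℂ p).symm w)) ↔ ∀ᶠ q in 𝓝 p, P q := by
  rw [← (chartAt ℂ p).eventually_nhds' P (mem_chart_source ℂ p)]

theorem eventually_nhdsNE_chart {p : U} {P : U → Prop} :
    (∀ᶠ w in 𝓝[≠] (chartAt ℂ p p), P ((chartAt ℂ p).symm w)) ↔ ∀ᶠ q in 𝓝[≠] p, P q := by
  rw [eventually_nhdsWithin_iff, eventually_nhdsWithin_iff,
    ← eventually_nhds_chart (p := p) (P := fun q => q ∈ ({p}ᶜ : Set U) → P q)]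
  have h1 : ∀ᶠ w in 𝓝 (chartAt ℂ p p), w ∈ (chartAt ℂ p).target :=
    (chartAt ℂ p).open_target.mem_nhds (mem_chart_target ℂ p)
  refine eventually_congr ?_
  filter_upwards [h1] with w hw
  have : w ∈ ({chartAt ℂ p p}ᶜ : Set ℂ) ↔ (chartAt ℂ p).symm w ∈ ({p}ᶜ : Set U) := by
    simp only [Set.mem_compl_iff, Set.mem_singleton_iff, not_iff_not]
    constructor
    · rintro rfl
      exact (chartAt ℂ p).left_inv (mem_chart_source ℂ p)
    · intro h
      rw [← (chartAt ℂ p).right_inv hw, h]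
  rw [this]

instance nhdsNE_neBot (p : U) : (𝓝[≠] p).NeBot := by
  rw [← Filter.frequently_true_iff_neBot]
  intro h
  have := (eventually_nhdsNE_chart (p := p) (P := fun _ => ¬ True)).2 h
  obtain ⟨w, hw⟩ := this.exists
  exact hw trivial

theorem inChart_eventuallyEq (f : U → ℂ) {p q : U} (hq : q ∈ (chartAt ℂ p).source) :
    inChart f q =ᶠ[𝓝 (chartAt ℂ q q)]
      inChart f p ∘ ((chartAt ℂ p) ∘ (chartAt ℂ q).symm) := by
  have := (eventually_nhds_chart (p := q) (P := fun u => u ∈ (chartAt ℂ p).source)).2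
    ((chartAt ℂ p).open_source.mem_nhds hq)
  filter_upwards [this] with w hw
  simp only [inChart, Function.comp_apply]
  rw [(chartAt ℂ p).left_inv hw]

theorem eventually_mem_chart_source (p : U) : ∀ᶠ q in 𝓝 p, q ∈ (chartAt ℂ p).source :=
  (chartAt ℂ p).open_source.mem_nhds (mem_chart_source ℂ p)

/-- `f` is meromorphic at `p`. -/
def MerAt (f : U → ℂ) (p : U) : Prop := MeromorphicAt (inChart f p) (chartAt ℂ p p)

theorem HolAt.merAt {f : U → ℂ} {p : U} (h : HolAt f p) : MerAt f p := AnalyticAt.meromorphicAt h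

theorem HolAt.congr {f g : U → ℂ} {p : U} (h : HolAt f p) (hfg : f =ᶠ[𝓝 p] g) : HolAt g p :=
  AnalyticAt.congr h (eventually_nhds_chart.2 hfg)

variable [IsManifold 𝓘(ℂ) ω U]

theorem analyticAt_transition {p q u : U} (hp : u ∈ (chartAt ℂ p).source)
    (hq : u ∈ (chartAt ℂ q).source) :
    AnalyticAt ℂ ((chartAt ℂ p) ∘ (chartAt ℂ q).symm) (chartAt ℂ q u) := by
  have h1 := (contDiffGroupoid ω 𝓘(ℂ)).compatible (chart_mem_atlas ℂ q) (chart_mem_atlas ℂ p)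
  rw [contDiffGroupoid, mem_groupoid_of_pregroupoid] at h1
  have h2 : ContDiffOn ℂ ω ((chartAt ℂ p) ∘ (chartAt ℂ q).symm)
      ((chartAt ℂ q).symm.trans (chartAt ℂ p)).source := by
    simpa [contDiffPregroupoid] using h1.1
  refine (h2.contDiffAt (((chartAt ℂ q).symm.trans (chartAt ℂ p)).open_source.mem_nhds ?_)).analyticAt
  rw [OpenPartialHomeomorph.trans_source]
  refine ⟨(chartAt ℂ q).map_source hq, ?_⟩
  rw [Set.mem_preimage, (chartAt ℂ q).left_inv hq]
  exact hp

theorem deriv_transition_ne_zero {p q u : U} (hp : u ∈ (chartAt ℂ p).source)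
    (hq : u ∈ (chartAt ℂ q).source) :
    deriv ((chartAt ℂ p) ∘ (chartAt ℂ q).symm) (chartAt ℂ q u) ≠ 0 := by
  intro h0
  have h1 := (analyticAt_transition hp hq).differentiableAt
  have h2 := (analyticAt_transition hq hp).differentiableAt
  have hval : ((chartAt ℂ p) ∘ (chartAt ℂ q).symm) (chartAt ℂ q u) = chartAt ℂ p u := by
    rw [Function.comp_apply, (chartAt ℂ q).left_inv hq]
  have h3 : ((chartAt ℂ q) ∘ (chartAt ℂ p).symm) ∘ ((chartAt ℂ p) ∘ (chartAt ℂ q).symm)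
      =ᶠ[𝓝 (chartAt ℂ q u)] id := by
    have h4 : ((chartAt ℂ q).symm.trans (chartAt ℂ p)).source ∈ 𝓝 (chartAt ℂ q u) := by
      refine ((chartAt ℂ q).symm.trans (chartAt ℂ p)).open_source.mem_nhds ?_
      rw [OpenPartialHomeomorph.trans_source]
      refine ⟨(chartAt ℂ q).map_source hq, ?_⟩
      rw [Set.mem_preimage, (chartAt ℂ q).left_inv hq]
      exact hp
    filter_upwards [h4] with w hw
    rw [OpenPartialHomeomorph.trans_source] at hw
    simp only [Function.comp_apply, id]
    rw [(chartAt ℂ p).left_inv hw.2, (chartAt ℂ q).right_inv hw.1]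
  have h5 := h3.deriv_eq
  rw [deriv_comp _ (hval ▸ h2) h1, h0, mul_zero, deriv_id] at h5
  exact zero_ne_one h5

/-- `HolAt f q` refers to the preferred chart at `q`, which varies with `q`; this permits working in
one fixed chart. -/
theorem holAt_iff {f : U → ℂ} {p q : U} (hq : q ∈ (chartAt ℂ p).source) :
    HolAt f q ↔ AnalyticAt ℂ (inChart f p) (chartAt ℂ p q) := by
  have hq' := mem_chart_source ℂ q
  constructor
  · intro h
    have h1 : inChart f p =ᶠ[𝓝 (chartAt ℂ p q)]
        inChart f q ∘ ((chartAt ℂ q) ∘ (chartAt ℂ p).symm) := by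
      have h2 : ((chartAt ℂ p).symm.trans (chartAt ℂ q)).source ∈ 𝓝 (chartAt ℂ p q) := by
        refine ((chartAt ℂ p).symm.trans (chartAt ℂ q)).open_source.mem_nhds ?_
        rw [OpenPartialHomeomorph.trans_source]
        refine ⟨(chartAt ℂ p).map_source hq, ?_⟩
        rw [Set.mem_preimage, (chartAt ℂ p).left_inv hq]
        exact hq'
      filter_upwards [h2] with w hw
      rw [OpenPartialHomeomorph.trans_source] at hw
      simp only [inChart, Function.comp_apply]
      rw [(chartAt ℂ q).left_inv hw.2]
    rw [analyticAt_congr h1]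
    refine AnalyticAt.comp ?_ (analyticAt_transition hq' hq)
    rw [Function.comp_apply, (chartAt ℂ p).left_inv hq]
    exact h
  · intro h
    rw [HolAt, analyticAt_congr (inChart_eventuallyEq f hq)]
    refine AnalyticAt.comp ?_ (analyticAt_transition hq hq')
    rw [Function.comp_apply, (chartAt ℂ q).left_inv hq']
    exact h

/-- The derivative with respect to `x` may be computed in any chart. -/
theorem derivWrt_eq {x f : U → ℂ} {p q : U} (hq : q ∈ (chartAt ℂ p).source)
    (hf : DifferentiableAt ℂ (inChart f p) (chartAt ℂ p q))
    (hx : DifferentiableAt ℂ (inChart x p) (chartAt ℂ p q)) :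
    derivWrt x f q =
      deriv (inChart f p) (chartAt ℂ p q) / deriv (inChart x p) (chartAt ℂ p q) := by
  have hq' := mem_chart_source ℂ q
  have hval : ((chartAt ℂ p) ∘ (chartAt ℂ q).symm) (chartAt ℂ q q) = chartAt ℂ p q := by
    rw [Function.comp_apply, (chartAt ℂ q).left_inv hq']
  have key : ∀ g : U → ℂ, DifferentiableAt ℂ (inChart g p) (chartAt ℂ p q) → chartDeriv g q =
      deriv (inChart g p) (chartAt ℂ p q) *
        deriv ((chartAt ℂ p) ∘ (chartAt ℂ q).symm) (chartAt ℂ q q) := by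
    intro g hg
    rw [chartDeriv, (inChart_eventuallyEq g hq).deriv_eq,
      deriv_comp _ (hval ▸ hg) (analyticAt_transition hq hq').differentiableAt, hval]
  rw [derivWrt, key f hf, key x hx, mul_div_mul_right _ _ (deriv_transition_ne_zero hq hq')]

theorem HolAt.eventually {f : U → ℂ} {p : U} (h : HolAt f p) : ∀ᶠ q in 𝓝 p, HolAt f q := by
  have h1 : ∀ᶠ w in 𝓝 (chartAt ℂ p p), AnalyticAt ℂ (inChart f p) w := h.eventually_analyticAt
  have h2 := ((chartAt ℂ p).continuousAt (mem_chart_source ℂ p)).eventually h1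
  filter_upwards [h2, eventually_mem_chart_source p] with q hq hq'
  exact (holAt_iff hq').2 hq

theorem tendsto_chart_nhdsNE (p : U) :
    Tendsto (chartAt ℂ p) (𝓝[≠] p) (𝓝[≠] (chartAt ℂ p p)) := by
  rw [tendsto_nhdsWithin_iff]
  refine ⟨((chartAt ℂ p).continuousAt (mem_chart_source ℂ p)).mono_left nhdsWithin_le_nhds, ?_⟩
  filter_upwards [self_mem_nhdsWithin,
    (eventually_mem_chart_source p).filter_mono nhdsWithin_le_nhds] with q hq hq'
  exact fun h => hq ((chartAt ℂ p).injOn hq' (mem_chart_source ℂ p) h)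

theorem MerAt.eventually_holAt {f : U → ℂ} {p : U} (h : MerAt f p) :
    ∀ᶠ q in 𝓝[≠] p, HolAt f q := by
  have h1 := (tendsto_chart_nhdsNE p).eventually (MeromorphicAt.eventually_analyticAt h)
  filter_upwards [h1, (eventually_mem_chart_source p).filter_mono nhdsWithin_le_nhds]
    with q hq hq'
  exact (holAt_iff hq').2 hq

theorem HolAt.continuousAt {f : U → ℂ} {p : U} (h : HolAt f p) : ContinuousAt f p := by
  have h1 : ContinuousAt (inChart f p ∘ chartAt ℂ p) p :=
    ContinuousAt.comp (AnalyticAt.continuousAt h)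
      ((chartAt ℂ p).continuousAt (mem_chart_source ℂ p))
  refine h1.congr ?_
  filter_upwards [eventually_mem_chart_source p] with q hq
  simp [inChart, (chartAt ℂ p).left_inv hq]

/-- The value of `derivWrt` at each point is computed in that point's own chart. Off `p` both
functions are holomorphic and the transition factors cancel. -/
theorem inChart_derivWrt_eventuallyEq {x f : U → ℂ} {p : U} (hx : MerAt x p) (hf : MerAt f p) :
    inChart (derivWrt x f) p =ᶠ[𝓝[≠] (chartAt ℂ p p)]
      fun w => deriv (inChart f p) w / deriv (inChart x p) w := by
  have h1 : ∀ᶠ w in 𝓝[≠] (chartAt ℂ p p), w ∈ (chartAt ℂ p).target :=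
    nhdsWithin_le_nhds ((chartAt ℂ p).open_target.mem_nhds (mem_chart_target ℂ p))
  filter_upwards [h1, MeromorphicAt.eventually_analyticAt hx,
    MeromorphicAt.eventually_analyticAt hf] with w hw hxw hfw
  rw [inChart, Function.comp_apply]
  have h2 := (chartAt ℂ p).right_inv hw
  rw [derivWrt_eq ((chartAt ℂ p).map_target hw) (h2.symm ▸ hfw.differentiableAt)
    (h2.symm ▸ hxw.differentiableAt), h2]

theorem MerAt.derivWrt {x f : U → ℂ} {p : U} (hx : MerAt x p) (hf : MerAt f p) :
    MerAt (derivWrt x f) p :=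
  MeromorphicAt.congr (MeromorphicAt.fun_div (MeromorphicAt.deriv hf) (MeromorphicAt.deriv hx))
    (inChart_derivWrt_eventuallyEq hx hf).symm

theorem HolAt.derivWrt {x f : U → ℂ} {p : U} (hx : HolAt x p) (hf : HolAt f p)
    (h : chartDeriv x p ≠ 0) : HolAt (derivWrt x f) p := by
  have h1 : inChart (Liouville.derivWrt x f) p =ᶠ[𝓝 (chartAt ℂ p p)]
      fun w => deriv (inChart f p) w / deriv (inChart x p) w := by
    have h1 : ∀ᶠ w in 𝓝 (chartAt ℂ p p), w ∈ (chartAt ℂ p).target :=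
      (chartAt ℂ p).open_target.mem_nhds (mem_chart_target ℂ p)
    filter_upwards [h1, AnalyticAt.eventually_analyticAt hx,
      AnalyticAt.eventually_analyticAt hf] with w hw hxw hfw
    rw [inChart, Function.comp_apply]
    have h2 := (chartAt ℂ p).right_inv hw
    rw [derivWrt_eq ((chartAt ℂ p).map_target hw) (h2.symm ▸ hfw.differentiableAt)
      (h2.symm ▸ hxw.differentiableAt), h2]
  rw [HolAt, analyticAt_congr h1]
  exact (AnalyticAt.deriv hf).fun_div (AnalyticAt.deriv hx) h

/-! ### The identity theorem -/

theorem MerAt.eventually_eq_zero_or {f : U → ℂ} {p : U} (h : MerAt f p) :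
    (∀ᶠ q in 𝓝[≠] p, f q = 0) ∨ ∀ᶠ q in 𝓝[≠] p, f q ≠ 0 := by
  rw [← eventually_nhdsNE_chart, ← eventually_nhdsNE_chart (P := fun q => f q ≠ 0)]
  exact MeromorphicAt.eventually_eq_zero_or_eventually_ne_zero h

/-- A meromorphic function on a connected set that vanishes near one point vanishes near all
points. -/
theorem eventually_eq_zero_of_isPreconnected [T1Space U] {W : Set U}
    (hW : IsPreconnected W) {f : U → ℂ} (hf : ∀ w ∈ W, MerAt f w) {p q : U} (hp : p ∈ W)
    (hq : q ∈ W) (h : ∀ᶠ u in 𝓝[≠] p, f u = 0) : ∀ᶠ u in 𝓝[≠] q, f u = 0 := by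
  -- The points near which `f` vanishes and those near which it does not form two open sets covering
  -- `W`; if both met `W`, they would share a point, which is absurd.
  have hopen : ∀ P : U → Prop, IsOpen {u | ∀ᶠ v in 𝓝[≠] u, P v} := by
    intro P
    rw [isOpen_iff_eventually]
    intro u hu
    have h1 := eventually_nhdsNE_eventually_nhds_iff.2 hu
    rw [eventually_nhdsWithin_iff] at h1
    filter_upwards [h1] with v hv
    rcases eq_or_ne v u with rfl | hne
    · exact hu
    · exact (hv hne).filter_mono nhdsWithin_le_nhds
  by_contra hcon
  have hq' := (hf q hq).eventually_eq_zero_or.resolve_left hcon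
  obtain ⟨r, hr, h1, h2⟩ := hW {u | ∀ᶠ v in 𝓝[≠] u, f v = 0} {u | ∀ᶠ v in 𝓝[≠] u, f v ≠ 0}
    (hopen _) (hopen _) (fun w hw => (hf w hw).eventually_eq_zero_or) ⟨p, hp, h⟩ ⟨q, hq, hq'⟩
  have h1' : ∀ᶠ v in 𝓝[≠] r, f v = 0 := h1
  have h2' : ∀ᶠ v in 𝓝[≠] r, f v ≠ 0 := h2
  obtain ⟨v, hv, hv'⟩ := (h1'.and h2').exists
  exact hv' hv

end Charts

/-! ### Germs on a Riemann surface -/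

section ElemGerm

variable {U : Type*} [TopologicalSpace U] [ChartedSpace ℂ U]

/-- The germ at `p` of a meromorphic function, read in the preferred chart. -/
def germAt (p : U) (f : U → ℂ) : merGerm (chartAt ℂ p p) := toGerm _ (inChart f p)

/-- The derivation `d / dx` of the field of meromorphic germs at `p`. -/
def derivAt (x : U → ℂ) (p : U) : SelfDeriv (merGerm (chartAt ℂ p p)) :=
  germDerivWrt _ (inChart x p)

variable {x f g : U → ℂ} {p : U} {B : Set (U → ℂ)}

theorem MerAt.const (c : ℂ) (p : U) : MerAt (fun _ => c) p := MeromorphicAt.const c _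

theorem MerAt.add (hf : MerAt f p) (hg : MerAt g p) : MerAt (fun u => f u + g u) p :=
  MeromorphicAt.fun_add hf hg

theorem MerAt.sub (hf : MerAt f p) (hg : MerAt g p) : MerAt (fun u => f u - g u) p :=
  MeromorphicAt.fun_sub hf hg

theorem MerAt.mul (hf : MerAt f p) (hg : MerAt g p) : MerAt (fun u => f u * g u) p :=
  MeromorphicAt.fun_mul hf hg

theorem MerAt.inv (hf : MerAt f p) : MerAt (fun u => (f u)⁻¹) p := MeromorphicAt.fun_inv hf

theorem germAt_add (hf : MerAt f p) (hg : MerAt g p) :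
    germAt p (fun u => f u + g u) = germAt p f + germAt p g := toGerm_add hf hg

theorem germAt_sub (hf : MerAt f p) (hg : MerAt g p) :
    germAt p (fun u => f u - g u) = germAt p f - germAt p g := toGerm_sub hf hg

theorem germAt_mul (hf : MerAt f p) (hg : MerAt g p) :
    germAt p (fun u => f u * g u) = germAt p f * germAt p g := toGerm_mul hf hg

theorem germAt_inv (hf : MerAt f p) : germAt p (fun u => (f u)⁻¹) = (germAt p f)⁻¹ :=
  toGerm_inv hf

theorem germAt_zero : germAt p (fun _ => 0) = 0 := toGerm_zero

theorem germAt_one : germAt p (fun _ => 1) = 1 := toGerm_one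

theorem germAt_congr (h : f =ᶠ[𝓝[≠] p] g) : germAt p f = germAt p g :=
  toGerm_congr (eventually_nhdsNE_chart.2 h)

theorem germAt_eq_zero_iff (hf : MerAt f p) : germAt p f = 0 ↔ ∀ᶠ u in 𝓝[≠] p, f u = 0 :=
  (toGerm_eq_zero_iff hf).trans (eventually_nhdsNE_chart (P := fun u => f u = 0))

theorem germAt_pow (hf : MerAt f p) (n : ℕ) :
    MerAt (fun u => f u ^ n) p ∧ germAt p (fun u => f u ^ n) = germAt p f ^ n := by
  induction n with
  | zero =>
    simp only [pow_zero]
    exact ⟨MerAt.const 1 p, germAt_one⟩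
  | succ n ih =>
    simp only [pow_succ]
    exact ⟨ih.1.mul hf, by rw [germAt_mul ih.1 hf, ih.2]⟩

theorem germAt_sum {ι : Type*} (s : Finset ι) {c : ι → U → ℂ} (hc : ∀ i, MerAt (c i) p) :
    MerAt (fun u => ∑ i ∈ s, c i u) p ∧
      germAt p (fun u => ∑ i ∈ s, c i u) = ∑ i ∈ s, germAt p (c i) := by
  classical
  induction s using Finset.induction_on with
  | empty =>
    simp only [Finset.sum_empty]
    exact ⟨MerAt.const 0 p, germAt_zero⟩
  | insert i s hi ih =>
    simp only [Finset.sum_insert hi]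
    exact ⟨(hc i).add ih.1, by rw [germAt_add (hc i) ih.1, ih.2]⟩

/-- The germ of `f` at `p` is holomorphic, and elementary over the germs of `B` in some extension
of the differential field of meromorphic germs. -/
def ElemGerm (x : U → ℂ) (B : Set (U → ℂ)) (f : U → ℂ) (p : U) : Prop :=
  HolAt f p ∧ IsElemOver (derivAt x p) (germAt p '' B) (germAt p f)

theorem ElemGerm.add (hf : ElemGerm x B f p) (hg : ElemGerm x B g p) :
    ElemGerm x B (fun u => f u + g u) p := by
  refine ⟨AnalyticAt.fun_add hf.1 hg.1, hf.2.of_isElem_two hg.2 ?_⟩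
  rw [germAt_add (AnalyticAt.meromorphicAt hf.1) (AnalyticAt.meromorphicAt hg.1)]
  exact (IsElem.base (by simp)).add (IsElem.base (by simp))

theorem ElemGerm.sub (hf : ElemGerm x B f p) (hg : ElemGerm x B g p) :
    ElemGerm x B (fun u => f u - g u) p := by
  refine ⟨AnalyticAt.fun_sub hf.1 hg.1, hf.2.of_isElem_two hg.2 ?_⟩
  rw [germAt_sub (AnalyticAt.meromorphicAt hf.1) (AnalyticAt.meromorphicAt hg.1)]
  exact (IsElem.base (by simp)).sub (IsElem.base (by simp))

theorem ElemGerm.mul (hf : ElemGerm x B f p) (hg : ElemGerm x B g p) :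
    ElemGerm x B (fun u => f u * g u) p := by
  refine ⟨AnalyticAt.fun_mul hf.1 hg.1, hf.2.of_isElem_two hg.2 ?_⟩
  rw [germAt_mul (AnalyticAt.meromorphicAt hf.1) (AnalyticAt.meromorphicAt hg.1)]
  exact (IsElem.base (by simp)).mul (IsElem.base (by simp))

theorem IsElem.inv₀ {M : Type*} [Field M] {D : SelfDeriv M} {S : Set M} {a : M}
    (ha : IsElem D S a) : IsElem D S a⁻¹ := by
  rcases eq_or_ne a 0 with rfl | h
  · simpa using ha
  · exact ha.inv (mul_inv_cancel₀ h)

theorem inChart_self (f : U → ℂ) (p : U) : inChart f p (chartAt ℂ p p) = f p := by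
  simp [inChart]

variable [IsManifold 𝓘(ℂ) ω U]

theorem germAt_derivWrt (hx : MerAt x p) (hf : MerAt f p) :
    germAt p (derivWrt x f) = derivAt x p (germAt p f) := by
  rw [derivAt, germAt, germAt, germDerivWrt_toGerm hx hf]
  exact toGerm_congr (inChart_derivWrt_eventuallyEq hx hf)

theorem ElemGerm.div (hf : ElemGerm x B f p) (hg : ElemGerm x B g p) (h : g p ≠ 0) :
    ElemGerm x B (fun u => f u / g u) p := by
  refine ⟨AnalyticAt.fun_div hf.1 hg.1 (show inChart g p (chartAt ℂ p p) ≠ 0 by rwa [inChart_self]), hf.2.of_isElem_two hg.2 ?_⟩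
  simp only [div_eq_mul_inv]
  rw [germAt_mul hf.1.merAt hg.1.merAt.inv, germAt_inv hg.1.merAt]
  exact (IsElem.base (by simp)).mul (IsElem.inv₀ (IsElem.base (by simp)))

theorem ElemGerm.derivWrt (hf : ElemGerm x B f p) (hx : HolAt x p) (h : chartDeriv x p ≠ 0) :
    ElemGerm x B (derivWrt x f) p := by
  refine ⟨hx.derivWrt hf.1 h, hf.2.of_isElem_one ?_⟩
  rw [germAt_derivWrt hx.merAt hf.1.merAt]
  exact IsElem.deriv (IsElem.base (by simp))

theorem ElemGerm.solve {n : ℕ} {c : Fin n → U → ℂ} {y : U → ℂ} (hc : ∀ i, ElemGerm x B (c i) p)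
    (hy : HolAt y p) (h : ∀ᶠ u in 𝓝 p, y u ^ n + ∑ i, c i u * y u ^ (i : ℕ) = 0) :
    ElemGerm x B y p := by
  refine ⟨hy, IsElemOver.of_isElem (c := fun i => germAt p (c i)) (fun i => (hc i).2) ?_⟩
  refine IsElem.alg (n := n) (c := fun i => germAt p (c i)) (fun i => IsElem.base ⟨i, rfl⟩) ?_
  have h1 : ∀ i, MerAt (fun u => c i u * y u ^ (i : ℕ)) p := fun i =>
    (hc i).1.merAt.mul (germAt_pow hy.merAt i).1
  have h2 : germAt p (fun u => y u ^ n + ∑ i, c i u * y u ^ (i : ℕ)) = 0 := by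
    rw [← germAt_zero]
    exact germAt_congr (h.filter_mono nhdsWithin_le_nhds)
  rw [germAt_add (germAt_pow hy.merAt n).1 (germAt_sum _ h1).1, (germAt_pow hy.merAt n).2,
    (germAt_sum _ h1).2] at h2
  rw [← h2]
  congr 1
  refine Finset.sum_congr rfl fun i _ => ?_
  rw [germAt_mul (hc i).1.merAt (germAt_pow hy.merAt i).1, (germAt_pow hy.merAt i).2]

/-- The functions that are meromorphic on `W`. -/
def merOn (W : Set U) : Subring (U → ℂ) where
  carrier := {f | ∀ w ∈ W, MerAt f w}
  zero_mem' := fun w _ => MerAt.const 0 w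
  one_mem' := fun w _ => MerAt.const 1 w
  add_mem' := fun hf hg w hw => (hf w hw).add (hg w hw)
  mul_mem' := fun hf hg w hw => (hf w hw).mul (hg w hw)
  neg_mem' := fun hf w hw => MeromorphicAt.neg (hf w hw)

/-- The germ at a point of `W`, as a homomorphism. -/
def merOnGerm (W : Set U) {p : U} (hp : p ∈ W) : merOn W →+* merGerm (chartAt ℂ p p) where
  toFun f := germAt p f
  map_zero' := germAt_zero
  map_one' := germAt_one
  map_add' f g := germAt_add (f.2 p hp) (g.2 p hp)
  map_mul' f g := germAt_mul (f.2 p hp) (g.2 p hp)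

/-- The functions used to build `f` need not continue to `q`, but `h`, `B` and `x` are meromorphic
on all of `W`. The field of meromorphic functions on `W` maps to the germs at both points, and
`IsElemOver.transfer` moves the abstract extension from one to the other. -/
theorem ElemGerm.continuation [T1Space U] {q : U}
    (hf : ElemGerm x B f p) (hx : IsMeromorphic x) (hB : ∀ b ∈ B, IsMeromorphic b)
    (h : IsDirectContinuation f p g q) : ElemGerm x B g q := by
  obtain ⟨W, hWo, hW, hp, hq, h, hhol, hhf, hhg⟩ := h
  refine ⟨(hhol q hq).congr hhg, ?_⟩
  -- `merOn W` is not a field, since values on discrete sets count in it. By the identity theorem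
  -- (`hker`) the kernel does not depend on the point.
  let P : Ideal (merOn W) := RingHom.ker (merOnGerm W hp)
  have hker : ∀ {r s : U} (hr : r ∈ W) (hs : s ∈ W) (a : merOn W), merOnGerm W hr a = 0 →
      merOnGerm W hs a = 0 := by
    intro r s hr hs a ha
    have h1 : germAt r a.1 = 0 := ha
    rw [germAt_eq_zero_iff (a.2 r hr)] at h1
    exact (germAt_eq_zero_iff (a.2 s hs)).2
      (eventually_eq_zero_of_isPreconnected hW a.2 hr hs h1)
  have hmax : P.IsMaximal := by
    rw [Ideal.isMaximal_iff]
    refine ⟨fun h1 => ?_, fun J a hJ haP haJ => ?_⟩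
    · have : merOnGerm W hp 1 = 0 := h1
      rw [map_one] at this
      exact one_ne_zero this
    · have ha : germAt p a.1 ≠ 0 := haP
      let b : merOn W := ⟨fun u => (a.1 u)⁻¹, fun w hw => (a.2 w hw).inv⟩
      have h1 : a * b - 1 ∈ P := by
        change merOnGerm W hp (a * b - 1) = 0
        rw [map_sub, map_mul, map_one, sub_eq_zero]
        change germAt p a.1 * germAt p (fun u => (a.1 u)⁻¹) = 1
        rw [germAt_inv (a.2 p hp), mul_inv_cancel₀ ha]
      have h2 : (1 : merOn W) = a * b - (a * b - 1) := by ring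
      rw [h2]
      exact J.sub_mem (J.mul_mem_right _ haJ) (hJ h1)
  let _ : Field (merOn W ⧸ P) := Ideal.Quotient.field P
  let ip : merOn W ⧸ P →+* merGerm (chartAt ℂ p p) :=
    Ideal.Quotient.lift P (merOnGerm W hp) fun a ha => ha
  let iq : merOn W ⧸ P →+* merGerm (chartAt ℂ q q) :=
    Ideal.Quotient.lift P (merOnGerm W hq) fun a ha => hker hp hq a ha
  have hBW : ∀ b ∈ B, b ∈ merOn W := fun b hb w _ => hB b hb w
  let S : Set (merOn W ⧸ P) := {s | ∃ b, ∃ hb : b ∈ B, s = Ideal.Quotient.mk P ⟨b, hBW b hb⟩}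
  have hSp : ip '' S = germAt p '' B := by
    ext s
    constructor
    · rintro ⟨_, ⟨b, hb, rfl⟩, rfl⟩
      exact ⟨b, hb, rfl⟩
    · rintro ⟨b, hb, rfl⟩
      exact ⟨_, ⟨b, hb, rfl⟩, rfl⟩
  have hSq : iq '' S = germAt q '' B := by
    ext s
    constructor
    · rintro ⟨_, ⟨b, hb, rfl⟩, rfl⟩
      exact ⟨b, hb, rfl⟩
    · rintro ⟨b, hb, rfl⟩
      exact ⟨_, ⟨b, hb, rfl⟩, rfl⟩
  let hW' : merOn W := ⟨h, fun w hw => (hhol w hw).merAt⟩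
  have e1 : germAt p f = ip (Ideal.Quotient.mk P hW') :=
    germAt_congr (hhf.symm.filter_mono nhdsWithin_le_nhds)
  have e2 : germAt q g = iq (Ideal.Quotient.mk P hW') :=
    germAt_congr (hhg.symm.filter_mono nhdsWithin_le_nhds)
  have hf2 := hf.2
  rw [e1, ← hSp] at hf2
  rw [e2, ← hSq]
  refine IsElemOver.transfer ip iq (fun r => ?_) hf2
  obtain ⟨a, rfl⟩ := Ideal.Quotient.mk_surjective r
  refine ⟨Ideal.Quotient.mk P ⟨Liouville.derivWrt x a.1, fun w hw => MerAt.derivWrt (hx w) (a.2 w hw)⟩,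
    ?_, ?_⟩
  · exact (germAt_derivWrt (hx p) (a.2 p hp)).symm
  · exact (germAt_derivWrt (hx q) (a.2 q hq)).symm

end ElemGerm

/-! ### Change of variable for germs -/

section Pull

/-- The punctured disc is the image of a half plane under `w ↦ z + exp w`. -/
theorem isPreconnected_punctured_ball (z : ℂ) {r : ℝ} (hr : 0 < r) :
    IsPreconnected (Metric.ball z r \ {z}) := by
  have h1 : IsPreconnected {w : ℂ | w.re < Real.log r} :=
    (convex_halfSpace_re_lt _).isPreconnected
  have h2 := h1.image (fun w => z + Complex.exp w) (by fun_prop)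
  convert h2 using 1
  ext v
  simp only [Set.mem_sdiff, Metric.mem_ball, Set.mem_singleton_iff, Set.mem_image,
    Set.mem_ofPred_eq, dist_eq_norm]
  constructor
  · rintro ⟨h, hne⟩
    have hne' : v - z ≠ 0 := sub_ne_zero.2 hne
    refine ⟨Complex.log (v - z), ?_, ?_⟩
    · rw [Complex.log_re]
      exact Real.log_lt_log (norm_pos_iff.2 hne') h
    · rw [Complex.exp_log hne']; ring
  · rintro ⟨w, hw, rfl⟩
    refine ⟨?_, by simp [Complex.exp_ne_zero]⟩
    rw [add_sub_cancel_left, Complex.norm_exp]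
    exact (Real.lt_log_iff_exp_lt hr).1 hw

theorem exists_punctured_ball {z : ℂ} {P : ℂ → Prop} (h : ∀ᶠ w in 𝓝[≠] z, P w) :
    ∃ r > 0, ∀ w ∈ Metric.ball z r \ {z}, P w := by
  rw [eventually_nhdsWithin_iff, Metric.eventually_nhds_iff_ball] at h
  obtain ⟨r, hr, h⟩ := h
  exact ⟨r, hr, fun w hw => h w hw.1 hw.2⟩

theorem eventually_const_of_deriv_eq_zero {f : ℂ → ℂ} {z : ℂ} (hf : MeromorphicAt f z)
    (h : ∀ᶠ w in 𝓝[≠] z, deriv f w = 0) : ∃ c, ∀ᶠ w in 𝓝[≠] z, f w = c := by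
  obtain ⟨r, hr, hW⟩ := exists_punctured_ball (h.and hf.eventually_analyticAt)
  have ho : IsOpen (Metric.ball z r \ {z}) := Metric.isOpen_ball.sdiff isClosed_singleton
  obtain ⟨c, hc⟩ := ho.exists_is_const_of_deriv_eq_zero (isPreconnected_punctured_ball z hr)
    (fun w hw => (hW w hw).2.differentiableAt.differentiableWithinAt) (fun w hw => (hW w hw).1)
  refine ⟨c, ?_⟩
  filter_upwards [sdiff_mem_nhdsWithin_compl (Metric.ball_mem_nhds z hr) {z}] with w hw
  exact hc w hw

theorem tendsto_nhdsNE_of_not_const {F : ℂ → ℂ} {z : ℂ} (hF : AnalyticAt ℂ F z)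
    (hc : ¬ ∀ᶠ w in 𝓝 z, F w = F z) : Tendsto F (𝓝[≠] z) (𝓝[≠] (F z)) := by
  rw [tendsto_nhdsWithin_iff]
  exact ⟨hF.continuousAt.mono_left nhdsWithin_le_nhds,
    (hF.eventually_eq_or_eventually_ne analyticAt_const).resolve_left hc⟩

/-- Composition of germs with a non-constant analytic function `F`. -/
def pullGerm {F : ℂ → ℂ} {z b : ℂ} (hb : F z = b) (hF : AnalyticAt ℂ F z)
    (ht : Tendsto F (𝓝[≠] z) (𝓝[≠] b)) : merGerm b →+* merGerm z where
  toFun a := ⟨a.1.compTendsto F ht, by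
    obtain ⟨_, g, hg, rfl⟩ := a
    subst hb
    exact ⟨g ∘ F, hg.comp_analyticAt hF, rfl⟩⟩
  map_zero' := rfl
  map_one' := rfl
  map_add' := by
    rintro ⟨_, f, hf, rfl⟩ ⟨_, g, hg, rfl⟩
    rfl
  map_mul' := by
    rintro ⟨_, f, hf, rfl⟩ ⟨_, g, hg, rfl⟩
    rfl

variable {F : ℂ → ℂ} {z b : ℂ} (hb : F z = b) (hF : AnalyticAt ℂ F z)
    (ht : Tendsto F (𝓝[≠] z) (𝓝[≠] b))

theorem pullGerm_toGerm {g : ℂ → ℂ} (hg : MeromorphicAt g b) :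
    pullGerm hb hF ht (toGerm b g) = toGerm z (g ∘ F) := by
  have h : MeromorphicAt (g ∘ F) z := by
    subst hb
    exact hg.comp_analyticAt hF
  apply Subtype.ext
  rw [coe_toGerm h]
  change (toGerm b g).1.compTendsto F ht = _
  rw [coe_toGerm hg]
  rfl

theorem germDerivWrt_pullGerm {X : ℂ → ℂ} (hX : MeromorphicAt X z) (a : merGerm b) :
    germDerivWrt z X (pullGerm hb hF ht a) = toGerm z (fun w => deriv F w / deriv X w) *
      pullGerm hb hF ht (germDerivWrt b (fun w => w) a) := by
  obtain ⟨g, hg, rfl⟩ := exists_toGerm a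
  have h1 : MeromorphicAt (fun w => deriv g w / deriv (fun w : ℂ => w) w) b :=
    hg.deriv.fun_div (MeromorphicAt.deriv (MeromorphicAt.id b))
  have h2 : MeromorphicAt (g ∘ F) z := by
    subst hb
    exact hg.comp_analyticAt hF
  have h3 : MeromorphicAt ((fun w => deriv g w / deriv (fun w : ℂ => w) w) ∘ F) z := by
    subst hb
    exact h1.comp_analyticAt hF
  rw [pullGerm_toGerm hb hF ht hg, germDerivWrt_toGerm hX h2,
    germDerivWrt_toGerm (X := fun w => w) (MeromorphicAt.id b) hg, pullGerm_toGerm hb hF ht h1,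
    ← toGerm_mul (hF.meromorphicAt.deriv.fun_div hX.deriv) h3]
  apply toGerm_congr
  filter_upwards [ht.eventually hg.eventually_analyticAt,
    hF.eventually_analyticAt.filter_mono nhdsWithin_le_nhds] with w hw hw'
  simp only [Function.comp_apply]
  rw [deriv_comp w hw.differentiableAt hw'.differentiableAt, deriv_id'']
  ring

end Pull

/-! ### Composition, exponentials and logarithms of germs -/

section Comp

variable {U : Type*} [TopologicalSpace U] [ChartedSpace ℂ U] {x f g : U → ℂ} {p : U}
  {B : Set (U → ℂ)}

theorem ElemGerm.congr (hf : ElemGerm x B f p) (h : f =ᶠ[𝓝 p] g) : ElemGerm x B g p := by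
  refine ⟨AnalyticAt.congr hf.1 (eventually_nhds_chart.2 h), ?_⟩
  rw [← germAt_congr (h.filter_mono nhdsWithin_le_nhds)]
  exact hf.2

theorem ElemGerm.of_mem (hf : f ∈ B) (hp : HolAt f p) : ElemGerm x B f p :=
  ⟨hp, IsElem.isElemOver (IsElem.base ⟨f, hf, rfl⟩)⟩

theorem HolAt.const (c : ℂ) (p : U) : HolAt (fun _ => c) p := analyticAt_const

/-- The variable and the constants. -/
def varConst : Set (ℂ → ℂ) := insert (fun z => z) (Set.range fun c _ => c)

/-- Pulling back along `f` multiplies derivations by `u = df/dx`, so this is `IsElemOver.comp`. -/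
theorem ElemGerm.comp {φ : ℂ → ℂ} (hx : MerAt x p)
    (hx' : toGerm (chartAt ℂ p p) (deriv (inChart x p)) ≠ 0)
    (hB : ∀ c : ℂ, (fun _ => c) ∈ B) (hφ : ElemGerm (fun z => z) varConst φ (f p))
    (hf : ElemGerm x B f p) : ElemGerm x B (fun u => φ (f u)) p := by
  have hφ1 : AnalyticAt ℂ φ (f p) := hφ.1
  have hb : inChart f p (chartAt ℂ p p) = f p := by simp [inChart]
  have hF : AnalyticAt ℂ (inChart f p) (chartAt ℂ p p) := hf.1
  -- Germs on punctured neighbourhoods cannot be pulled back along a constant `f`, but then `φ ∘ f`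
  -- is a constant, which lies in `B`.
  by_cases hc : ∀ᶠ w in 𝓝 (chartAt ℂ p p), inChart f p w = inChart f p (chartAt ℂ p p)
  · have h1 : ∀ᶠ u in 𝓝 p, f u = f p := by
      rw [hb] at hc
      exact eventually_nhds_chart.1 hc
    refine (ElemGerm.of_mem (hB (φ (f p))) (HolAt.const _ p)).congr ?_
    filter_upwards [h1] with u hu
    rw [hu]
  have ht := tendsto_nhdsNE_of_not_const hF hc
  rw [hb] at ht
  refine ⟨AnalyticAt.comp (g := φ) (f := inChart f p) (hb.symm ▸ hφ1) hF, ?_⟩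
  have hu : toGerm (chartAt ℂ p p)
      (fun w => deriv (inChart f p) w / deriv (inChart x p) w) ≠ 0 := by
    rw [toGerm_div hF.deriv.meromorphicAt (MeromorphicAt.deriv hx)]
    refine div_ne_zero (fun h0 => hc ?_) hx'
    rw [toGerm_eq_zero_iff hF.deriv.meromorphicAt] at h0
    obtain ⟨c, h1⟩ := eventually_const_of_deriv_eq_zero hF.meromorphicAt h0
    have h2 : ∀ᶠ w in 𝓝 (chartAt ℂ p p), inChart f p w = c :=
      (hF.frequently_eq_iff_eventually_eq analyticAt_const).1 h1.frequently
    rwa [h2.self_of_nhds]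
  have hφ2 := hφ.2
  rw [varConst, Set.image_insert_eq] at hφ2
  have hid : ∀ b : ℂ, MeromorphicAt (fun w : ℂ => w) b := MeromorphicAt.id
  have key := IsElemOver.comp (D := derivAt x p) (S := germAt p '' B)
    (pullGerm hb hF ht) hu (germDerivWrt_pullGerm hb hF ht hx) (z := toGerm (f p) (fun w => w))
    ?_ ?_ ?_ hφ2
  · change IsElemOver _ _ (pullGerm hb hF ht (toGerm (f p) φ)) at key
    rwa [pullGerm_toGerm hb hF ht hφ1.meromorphicAt] at key
  · rw [germDerivWrt_toGerm (hid _) (hid _), ← toGerm_one]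
    congr 1
    ext w
    simp
  · rintro _ ⟨_, ⟨c, rfl⟩, rfl⟩
    refine ⟨fun _ => c, hB c, ?_⟩
    exact (pullGerm_toGerm hb hF ht (g := fun _ => c) (MeromorphicAt.const c _)).symm
  · rw [pullGerm_toGerm hb hF ht (hid _)]
    exact hf.2

theorem HolAt.exp (hf : HolAt f p) : HolAt (fun u => Complex.exp (f u)) p :=
  AnalyticAt.cexp' hf

variable [IsManifold 𝓘(ℂ) ω U]

theorem derivWrt_exp {q : U} (hf : HolAt f q) :
    derivWrt x (fun u => Complex.exp (f u)) q = Complex.exp (f q) * derivWrt x f q := by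
  have h1 : chartDeriv (fun u => Complex.exp (f u)) q = Complex.exp (f q) * chartDeriv f q := by
    have h2 : DifferentiableAt ℂ (inChart f q) (chartAt ℂ q q) := AnalyticAt.differentiableAt hf
    have h3 := h2.hasDerivAt.cexp.deriv
    rw [inChart_self] at h3
    exact h3
  rw [derivWrt, derivWrt, h1, mul_div_assoc]

theorem derivAt_germAt_exp (hx : MerAt x p) (hf : HolAt f p) :
    derivAt x p (germAt p fun u => Complex.exp (f u)) =
      germAt p (fun u => Complex.exp (f u)) * derivAt x p (germAt p f) := by
  rw [← germAt_derivWrt hx hf.exp.merAt, ← germAt_derivWrt hx hf.merAt,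
    ← germAt_mul hf.exp.merAt (MerAt.derivWrt hx hf.merAt)]
  apply germAt_congr
  filter_upwards [hf.eventually.filter_mono nhdsWithin_le_nhds] with q hq
  exact derivWrt_exp hq

theorem germAt_exp_mul_exp_neg (hf : HolAt f p) :
    germAt p (fun u => Complex.exp (f u)) * germAt p (fun u => Complex.exp (-f u)) = 1 := by
  have h : HolAt (fun u => Complex.exp (-f u)) p := HolAt.exp (AnalyticAt.neg hf)
  rw [← germAt_mul hf.exp.merAt h.merAt, ← germAt_one]
  congr 1
  ext u
  rw [← Complex.exp_add, add_neg_cancel, Complex.exp_zero]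

theorem ElemGerm.exp (hx : MerAt x p) (hf : ElemGerm x B f p) :
    ElemGerm x B (fun u => Complex.exp (f u)) p :=
  ⟨hf.1.exp, hf.2.of_isElem_one (IsElem.exp (IsElem.base rfl) (germAt_exp_mul_exp_neg hf.1)
    (derivAt_germAt_exp hx hf.1))⟩

/-- `f` is a logarithm of `exp f`. All inverse functions are reached in this way. -/
theorem ElemGerm.of_exp (hx : MerAt x p) (hf : HolAt f p)
    (h : ElemGerm x B (fun u => Complex.exp (f u)) p) : ElemGerm x B f p :=
  ⟨hf, h.2.of_isElem_one (IsElem.log (IsElem.base rfl) (germAt_exp_mul_exp_neg hf)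
    (by rw [derivAt_germAt_exp hx hf, mul_comm]))⟩

/-- The derivative of a nonconstant meromorphic function is nowhere locally zero. -/
theorem toGerm_deriv_ne_zero [T1Space U] [ConnectedSpace U] (hx : IsMeromorphic x)
    (hx' : IsNonconstant x) (p : U) : toGerm (chartAt ℂ p p) (deriv (inChart x p)) ≠ 0 := by
  intro h
  rw [toGerm_eq_zero_iff (MeromorphicAt.deriv (hx p))] at h
  obtain ⟨c, hc⟩ := eventually_const_of_deriv_eq_zero (hx p) h
  have hc' : ∀ᶠ u in 𝓝[≠] p, x u - c = 0 := by
    filter_upwards [(eventually_nhdsNE_chart (P := fun u => x u = c)).1 hc] with u hu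
    rw [hu, sub_self]
  refine hx' ⟨c, ?_⟩
  rw [EventuallyEq, Filter.Eventually, mem_codiscrete]
  intro q
  rw [disjoint_principal_right, compl_compl]
  filter_upwards [eventually_eq_zero_of_isPreconnected isPreconnected_univ
    (fun w _ => MerAt.sub (hx w) (MerAt.const c w)) (Set.mem_univ p) (Set.mem_univ q) hc']
    with u hu
  exact sub_eq_zero.1 hu

end Comp

/-! ### Germs of elementary functions -/

section Basic

theorem derivWrt_id (f : ℂ → ℂ) : derivWrt (fun z => z) f = deriv f := by
  ext b
  change deriv f b / deriv (fun z => z) b = _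
  simp

theorem merAt_id (b : ℂ) : MerAt (fun z : ℂ => z) b := MeromorphicAt.id b

theorem elemGerm_const (c b : ℂ) : ElemGerm (fun z => z) varConst (fun _ => c) b :=
  ElemGerm.of_mem (Set.mem_insert_of_mem _ ⟨c, rfl⟩) (HolAt.const c b)

theorem elemGerm_var (b : ℂ) : ElemGerm (fun z => z) varConst (fun z => z) b :=
  ElemGerm.of_mem (Set.mem_insert _ _) analyticAt_id

/-- A germ is elementary if its exponential times `i` is a quadratic irrationality. -/
theorem elemGerm_of_quadratic {g c₀ c₁ : ℂ → ℂ} {b : ℂ} (hg : AnalyticAt ℂ g b)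
    (h₀ : ElemGerm (fun z => z) varConst c₀ b) (h₁ : ElemGerm (fun z => z) varConst c₁ b)
    (h : ∀ᶠ z in 𝓝 b, Complex.exp (g z * Complex.I) ^ 2 +
      (c₀ z + c₁ z * Complex.exp (g z * Complex.I)) = 0) :
    ElemGerm (fun z => z) varConst g b := by
  have hgI : AnalyticAt ℂ (fun z => g z * Complex.I) b := hg.fun_mul analyticAt_const
  have hw : ElemGerm (fun z => z) varConst (fun z => Complex.exp (g z * Complex.I)) b := by
    refine ElemGerm.solve (n := 2) (c := ![c₀, c₁]) (by simp [Fin.forall_fin_two, h₀, h₁])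
      (HolAt.exp hgI) ?_
    filter_upwards [h] with z hz
    simpa [Fin.sum_univ_two] using hz
  have h2 := (ElemGerm.of_exp (f := fun z => g z * Complex.I) (merAt_id b) hgI hw).mul (elemGerm_const (-Complex.I) b)
  refine h2.congr (Eventually.of_forall fun z => ?_)
  change g z * Complex.I * -Complex.I = g z
  linear_combination (-g z) * Complex.I_mul_I

theorem elemGerm_expI (c b : ℂ) :
    ElemGerm (fun z => z) varConst (fun z => Complex.exp (z * c)) b :=
  ElemGerm.exp (merAt_id b) ((elemGerm_var b).mul (elemGerm_const _ b))

theorem elemGerm_sin (b : ℂ) : ElemGerm (fun z => z) varConst Complex.sin b := by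
  refine ((((elemGerm_expI (-Complex.I) b).sub (elemGerm_expI Complex.I b)).mul
    (elemGerm_const Complex.I b)).div (elemGerm_const 2 b) two_ne_zero).congr
    (Eventually.of_forall fun z => ?_)
  simp only [Complex.sin, neg_mul, mul_neg]

theorem elemGerm_cos (b : ℂ) : ElemGerm (fun z => z) varConst Complex.cos b := by
  refine (((elemGerm_expI Complex.I b).add (elemGerm_expI (-Complex.I) b)).div
    (elemGerm_const 2 b) two_ne_zero).congr (Eventually.of_forall fun z => ?_)
  simp only [Complex.cos, neg_mul, mul_neg]

theorem sin_eq_exp (z : ℂ) : Complex.sin z * (2 * Complex.exp (z * Complex.I)) =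
    Complex.I - Complex.I * Complex.exp (z * Complex.I) ^ 2 := by
  have h : Complex.exp (-z * Complex.I) * Complex.exp (z * Complex.I) = 1 := by
    rw [← Complex.exp_add, neg_mul, neg_add_cancel, Complex.exp_zero]
  rw [Complex.sin]
  linear_combination Complex.I * h

theorem cos_eq_exp (z : ℂ) : Complex.cos z * (2 * Complex.exp (z * Complex.I)) =
    Complex.exp (z * Complex.I) ^ 2 + 1 := by
  have h : Complex.exp (-z * Complex.I) * Complex.exp (z * Complex.I) = 1 := by
    rw [← Complex.exp_add, neg_mul, neg_add_cancel, Complex.exp_zero]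
  rw [Complex.cos]
  linear_combination h

/-- For an inverse trigonometric `g`, the function `w = exp (i g)` satisfies `w² - 2izw - 1 = 0`
(arcsin), `w² - 2zw + 1 = 0` (arccos), `w² = (1 + iz)/(1 - iz)` (arctan) or `w² = (z + i)/(z - i)`
(arccot). -/
theorem IsBasicElementary.elemGerm {f : ℂ → ℂ} {b : ℂ} (hf : IsBasicElementary f b) :
    ElemGerm (fun z => z) varConst f b := by
  have hlog : ∀ g : ℂ → ℂ, AnalyticAt ℂ g b → (∀ᶠ z in 𝓝 b, Complex.exp (g z) = z) →
      ElemGerm (fun z => z) varConst g b := fun g hg h =>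
    ElemGerm.of_exp (merAt_id b) hg ((elemGerm_var b).congr (h.mono fun z hz => hz.symm))
  have hI := Complex.I_mul_I
  have hlin : ∀ c d : ℂ, ElemGerm (fun z => z) varConst (fun z => c * z + d) b := fun c d =>
    ((elemGerm_const c b).mul (elemGerm_var b)).add (elemGerm_const d b)
  cases hf with
  | const c => exact elemGerm_const c b
  | var => exact elemGerm_var b
  | exp => exact ElemGerm.exp (merAt_id b) (elemGerm_var b)
  | log _ _ hg h => exact hlog _ hg h
  | pow α _ g hg h =>
    exact ElemGerm.exp (merAt_id b) ((elemGerm_const α b).mul (hlog g hg h))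
  | sin => exact elemGerm_sin b
  | cos => exact elemGerm_cos b
  | tan _ hb => exact (elemGerm_sin b).div (elemGerm_cos b) hb
  | cot _ hb => exact (elemGerm_cos b).div (elemGerm_sin b) hb
  | arcsin _ g hg h =>
    refine elemGerm_of_quadratic hg (elemGerm_const (-1) b) (hlin (-2 * Complex.I) 0) ?_
    filter_upwards [h] with z hz
    have := sin_eq_exp (f z)
    rw [hz] at this
    linear_combination (-Complex.I) * this + (Complex.exp (f z * Complex.I) ^ 2 - 1) * hI
  | arccos _ g hg h =>
    refine elemGerm_of_quadratic hg (elemGerm_const 1 b) (hlin (-2) 0) ?_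
    filter_upwards [h] with z hz
    have := cos_eq_exp (f z)
    rw [hz] at this
    linear_combination -this
  | arctan _ g hg h =>
    have key : ∀ z, Complex.sin (f z) = z * Complex.cos (f z) →
        Complex.exp (f z * Complex.I) ^ 2 * (-Complex.I * z + 1) = Complex.I * z + 1 := by
      intro z hz
      have h1 := sin_eq_exp (f z)
      have h2 := cos_eq_exp (f z)
      rw [hz] at h1
      linear_combination (-Complex.I) * h1 + Complex.I * z * h2 +
        (Complex.exp (f z * Complex.I) ^ 2 - 1) * hI
    -- If `1 - iz` vanished, `key` would make `1 + iz` vanish too, and their sum is `2`.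
    have hne : ∀ z, Complex.sin (f z) = z * Complex.cos (f z) → -Complex.I * z + 1 ≠ 0 := by
      intro z hz h0
      have h1 := key z hz
      rw [h0, mul_zero] at h1
      exact two_ne_zero (α := ℂ) (by linear_combination h0 - h1)
    refine elemGerm_of_quadratic hg ((elemGerm_const 0 b).sub
      ((hlin Complex.I 1).div (hlin (-Complex.I) 1) (hne b h.self_of_nhds)))
      (elemGerm_const 0 b) ?_
    filter_upwards [h] with z hz
    rw [← key z hz, mul_div_cancel_right₀ _ (hne z hz)]
    ring
  | arccot _ g hg h =>
    have key : ∀ z, Complex.cos (f z) = z * Complex.sin (f z) →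
        Complex.exp (f z * Complex.I) ^ 2 * (1 * z + -Complex.I) = 1 * z + Complex.I := by
      intro z hz
      have h1 := sin_eq_exp (f z)
      have h2 := cos_eq_exp (f z)
      rw [hz] at h2
      linear_combination Complex.I * h2 - Complex.I * z * h1 +
        (z * Complex.exp (f z * Complex.I) ^ 2 - z) * hI
    have hne : ∀ z, Complex.cos (f z) = z * Complex.sin (f z) → 1 * z + -Complex.I ≠ 0 := by
      intro z hz h0
      have h1 := key z hz
      rw [h0, mul_zero] at h1
      exact two_ne_zero (α := ℂ) (by linear_combination Complex.I * (h0 + h1) + 2 * hI)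
    refine elemGerm_of_quadratic hg ((elemGerm_const 0 b).sub
      ((hlin 1 Complex.I).div (hlin 1 (-Complex.I)) (hne b h.self_of_nhds)))
      (elemGerm_const 0 b) ?_
    filter_upwards [h] with z hz
    rw [← key z hz, mul_div_cancel_right₀ _ (hne z hz)]
    ring

theorem isMeromorphic_id : IsMeromorphic (fun z : ℂ => z) := merAt_id

theorem isMeromorphic_of_mem_varConst {f : ℂ → ℂ} (hf : f ∈ varConst) : IsMeromorphic f := by
  rcases hf with rfl | ⟨c, rfl⟩
  · exact isMeromorphic_id
  · exact fun b => MerAt.const c b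

theorem IsGenElementary.elemGerm {f : ℂ → ℂ} {b : ℂ} (hf : IsGenElementary f b) :
    ElemGerm (fun z => z) varConst f b := by
  induction hf with
  | basic hf => exact hf.elemGerm
  | continuation _ h ih =>
    exact ih.continuation isMeromorphic_id (fun _ => isMeromorphic_of_mem_varConst) h
  | @comp f g b _ _ ihf ihg =>
    refine ElemGerm.comp (merAt_id b) ?_ (fun c => Set.mem_insert_of_mem _ ⟨c, rfl⟩) ihf ihg
    change toGerm b (_root_.deriv fun z => z) ≠ 0
    rw [deriv_id'', toGerm_one]
    exact one_ne_zero
  | add _ _ ihf ihg => exact ihf.add ihg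
  | sub _ _ ihf ihg => exact ihf.sub ihg
  | mul _ _ ihf ihg => exact ihf.mul ihg
  | div _ _ h ihf ihg => exact ihf.div ihg h
  | @deriv f b _ ih =>
    rw [← derivWrt_id]
    refine ih.derivWrt analyticAt_id ?_
    change _root_.deriv (fun z : ℂ => z) b ≠ 0
    simp
  | solve _ hy h ih => exact ElemGerm.solve ih hy h

end Basic

/-! ### Germs elementary over `K` -/

section Over

variable {U : Type*} [TopologicalSpace U] [T1Space U] [ConnectedSpace U] [ChartedSpace ℂ U]
  [IsManifold 𝓘(ℂ) ω U]

theorem IsGenElementaryOver.elemGerm {x : U → ℂ} (hx : IsMeromorphic x) (hx' : IsNonconstant x)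
    {K : Subalgebra ℂ (U → ℂ)} (hK : IsFunctionalDifferentialField x K) {f : U → ℂ} {p : U}
    (hf : IsGenElementaryOver x K f p) : ElemGerm x K f p := by
  induction hf with
  | basic hf hp => exact ElemGerm.of_mem hf hp
  | continuation _ h ih => exact ih.continuation hx hK.meromorphic h
  | comp hφ _ ih =>
    exact ElemGerm.comp (hx _) (toGerm_deriv_ne_zero hx hx' _) (fun c => K.algebraMap_mem c)
      hφ.elemGerm ih
  | add _ _ ihf ihg => exact ihf.add ihg
  | sub _ _ ihf ihg => exact ihf.sub ihg
  | mul _ _ ihf ihg => exact ihf.mul ihg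
  | div _ _ h ihf ihg => exact ihf.div ihg h
  | deriv _ h1 h2 ih => exact ih.derivWrt h1 h2
  | solve _ hy h ih => exact ElemGerm.solve ih hy h

end Over

/-! ### The differential field of germs of `K` -/

section FieldGerm

variable {U : Type*} [TopologicalSpace U] [ChartedSpace ℂ U] [IsManifold 𝓘(ℂ) ω U]
  {x : U → ℂ} {K : Subalgebra ℂ (U → ℂ)}

/-- The germs at `p` of the functions in `K`. -/
def fieldGerm (hK : IsFunctionalDifferentialField x K) (p : U) :
    Subfield (merGerm (chartAt ℂ p p)) where
  carrier := germAt p '' K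
  one_mem' := ⟨1, K.one_mem, germAt_one⟩
  zero_mem' := ⟨0, K.zero_mem, germAt_zero⟩
  add_mem' := by
    rintro _ _ ⟨f, hf, rfl⟩ ⟨g, hg, rfl⟩
    exact ⟨f + g, K.add_mem hf hg, germAt_add (hK.meromorphic f hf p) (hK.meromorphic g hg p)⟩
  mul_mem' := by
    rintro _ _ ⟨f, hf, rfl⟩ ⟨g, hg, rfl⟩
    exact ⟨f * g, K.mul_mem hf hg, germAt_mul (hK.meromorphic f hf p) (hK.meromorphic g hg p)⟩
  neg_mem' := by
    rintro _ ⟨f, hf, rfl⟩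
    refine ⟨0 - f, K.sub_mem K.zero_mem hf, ?_⟩
    have h := germAt_sub (MerAt.const 0 p) (hK.meromorphic f hf p)
    rw [germAt_zero, zero_sub] at h
    exact h
  inv_mem' := by
    rintro _ ⟨f, hf, rfl⟩
    exact ⟨f⁻¹, hK.inv_mem f hf, germAt_inv (hK.meromorphic f hf p)⟩

/-- The constant germs. -/
def constGerm (p : U) : ℂ →+* merGerm (chartAt ℂ p p) where
  toFun c := germAt p fun _ => c
  map_one' := germAt_one
  map_zero' := germAt_zero
  map_add' c d := germAt_add (MerAt.const c p) (MerAt.const d p)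
  map_mul' c d := germAt_mul (MerAt.const c p) (MerAt.const d p)

theorem derivAt_constGerm {p : U} (hx : MerAt x p) (c : ℂ) : derivAt x p (constGerm p c) = 0 := by
  change derivAt x p (germAt p fun _ => c) = 0
  rw [← germAt_derivWrt hx (MerAt.const c p), ← germAt_zero]
  congr 1
  ext q
  have : chartDeriv (fun _ => c) q = 0 := deriv_const _ c
  rw [derivWrt, this, zero_div]

/-- A punctured disc is connected, so vanishing derivative means constant. This gives the hypothesis
on constants in `hasLogForm_of_isElem`. -/
theorem mem_range_constGerm {p : U} (hx' : toGerm (chartAt ℂ p p) (deriv (inChart x p)) ≠ 0)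
    {a : merGerm (chartAt ℂ p p)} (ha : derivAt x p a = 0) : ∃ c, constGerm p c = a := by
  obtain ⟨f, hf, rfl⟩ := exists_toGerm a
  rw [derivAt, germDerivWrt, SelfDeriv.addMul_apply, Derivation.zero_apply, zero_add,
    mul_eq_zero, or_iff_right (inv_ne_zero hx'), germDeriv_toGerm hf,
    toGerm_eq_zero_iff hf.deriv] at ha
  obtain ⟨c, hc⟩ := eventually_const_of_deriv_eq_zero hf ha
  exact ⟨c, toGerm_congr (hc.mono fun w hw => hw.symm)⟩

/-- An integral of a function in `K` that is elementary over `K` has a logarithmic form, at the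
level of germs. -/
theorem ElemGerm.exists_logForm {p : U} (hx : MerAt x p)
    (hx' : toGerm (chartAt ℂ p p) (deriv (inChart x p)) ≠ 0)
    (hK : IsFunctionalDifferentialField x K) {f y : U → ℂ} (hf : f ∈ K)
    (hy : IsIntegralOf x f y p) (he : ElemGerm x K y p) :
    ∃ (m : ℕ) (r₀ : U → ℂ) (r : Fin m → U → ℂ) (c : Fin m → ℂ), r₀ ∈ K ∧ (∀ i, r i ∈ K) ∧
      (∀ i, germAt p (r i) ≠ 0) ∧ derivAt x p (germAt p y) =
        ∑ i, constGerm p (c i) * (derivAt x p (germAt p (r i)) / germAt p (r i)) +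
          derivAt x p (germAt p r₀) := by
  let Kp := fieldGerm hK p
  have hconst : ∀ c, constGerm p c ∈ Kp := fun c => ⟨_, K.algebraMap_mem c, rfl⟩
  have hD : ∀ a ∈ Kp, derivAt x p a ∈ Kp := by
    rintro _ ⟨g, hg, rfl⟩
    exact ⟨_, hK.deriv_mem g hg, germAt_derivWrt hx (hK.meromorphic g hg p)⟩
  let φ : ℂ →+* Kp := (constGerm p).codRestrict Kp.toSubring hconst
  let _ : Algebra ℂ Kp := φ.toAlgebra
  have : CharZero Kp := charZero_of_injective_ringHom φ.injective
  obtain ⟨hyh, L, _, _, D', j, hj, hL⟩ := he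
  have hDy : derivAt x p (germAt p y) = germAt p f := by
    rw [← germAt_derivWrt hx hyh.merAt]
    exact germAt_congr hy.2
  have hrange : j '' (germAt p '' K) = Set.range (j.comp Kp.subtype) := by
    ext s
    constructor
    · rintro ⟨a, ha, rfl⟩
      exact ⟨⟨a, ha⟩, rfl⟩
    · rintro ⟨a, rfl⟩
      exact ⟨a.1, a.2, rfl⟩
  rw [hrange] at hL
  obtain ⟨ι, _, c, u, v, hc, hfe⟩ := hasLogForm_of_isElem (d := subfieldDeriv (derivAt x p) Kp hD)
    (fun z => Subtype.ext (by
      rw [coe_subfieldDeriv]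
      exact derivAt_constGerm hx z))
    (fun a ha => by
      have ha' := congrArg Subtype.val ha
      rw [coe_subfieldDeriv] at ha'
      obtain ⟨z, hz⟩ := mem_range_constGerm hx' ha'
      exact ⟨z, Subtype.ext hz⟩)
    (j.comp Kp.subtype) (fun a => by
      rw [RingHom.comp_apply, RingHom.comp_apply, hj]
      congr 1)
    hL (f := ⟨germAt p f, f, hf, rfl⟩) (by rw [hj, hDy]; rfl)
  have hc' : ∀ i, ∃ z, constGerm p z = c i := fun i => by
    have := congrArg Subtype.val (hc i)
    rw [coe_subfieldDeriv] at this
    exact mem_range_constGerm hx' this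
  choose cc hcc using hc'
  -- A logarithmic form may contain `uᵢ = 0`, with `0 / 0 = 0`; it is replaced by `1`, whose
  -- logarithmic derivative is also `0`.
  have hu : ∀ i, ∃ r ∈ K, germAt p r ≠ 0 ∧ derivAt x p (germAt p r) / germAt p r =
      derivAt x p (u i) / u i := by
    intro i
    obtain ⟨r, hr, hru⟩ := (u i).2
    by_cases h0 : (u i : merGerm (chartAt ℂ p p)) = 0
    · refine ⟨1, K.one_mem, ?_, ?_⟩
      · change germAt p (fun _ => 1) ≠ 0
        rw [germAt_one]
        exact one_ne_zero
      · change derivAt x p (germAt p (fun _ => 1)) / germAt p (fun _ => 1) = _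
        rw [germAt_one, h0, div_zero, Derivation.map_one_eq_zero, zero_div]
    · exact ⟨r, hr, by rwa [hru], by rw [hru]⟩
  choose r hrK hr0 hru using hu
  obtain ⟨r₀, hr₀, hv⟩ := v.2
  let e := (Fintype.equivFin ι).symm
  refine ⟨Fintype.card ι, r₀, fun i => r (e i), fun i => cc (e i), hr₀, fun i => hrK _,
    fun i => hr0 _, ?_⟩
  rw [e.sum_comp (fun i => constGerm p (cc i) *
    (derivAt x p (germAt p (r i)) / germAt p (r i))), hDy, hv]
  have h1 := congrArg Kp.subtype hfe
  rw [map_add, map_sum] at h1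
  refine h1.trans ?_
  congr 1
  refine Finset.sum_congr rfl fun i _ => ?_
  rw [map_mul, map_div₀, hru, hcc]
  rfl

end FieldGerm

/-! ### From the derivative to the logarithmic sum -/

section LogSum

/-- On a connected open set, a function whose derivative has a logarithmic form is a sum of
logarithms, with one constant of integration for all points. -/
theorem exists_log_sum {W : Set ℂ} (hW : IsOpen W) (hWc : IsPreconnected W) (hne : W.Nonempty)
    {m : ℕ} {Y R₀ : ℂ → ℂ} {R : Fin m → ℂ → ℂ} {c : Fin m → ℂ}
    (hY : ∀ w ∈ W, AnalyticAt ℂ Y w) (hR₀ : ∀ w ∈ W, AnalyticAt ℂ R₀ w)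
    (hR : ∀ i, ∀ w ∈ W, AnalyticAt ℂ (R i) w) (hR' : ∀ i, ∀ w ∈ W, R i w ≠ 0)
    (hd : ∀ w ∈ W, deriv Y w = ∑ i, c i * (deriv (R i) w / R i w) + deriv R₀ w) :
    ∃ C : ℂ, ∀ w ∈ W, ∃ L : Fin m → ℂ → ℂ,
      (∀ i, AnalyticAt ℂ (L i) w ∧ ∀ᶠ v in 𝓝 w, Complex.exp (L i v) = R i v) ∧
      ∀ᶠ v in 𝓝 w, Y v = R₀ v + C + ∑ i, c i * L i v := by
  have hloc : ∀ w ∈ W, ∃ V : Set ℂ, IsOpen V ∧ w ∈ V ∧ ∃ (ℓ : Fin m → ℂ → ℂ) (C₀ : ℂ), ∀ v ∈ V,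
      (∀ i, AnalyticAt ℂ (ℓ i) v ∧ Complex.exp (ℓ i v) = R i v) ∧
        Y v = R₀ v + C₀ + ∑ i, c i * ℓ i v := by
    intro w hw
    have h1 : ∀ i, ∀ᶠ v in 𝓝 w, R i v / R i w ∈ Complex.slitPlane := fun i => by
      have h2 : ContinuousAt (fun v => R i v / R i w) w :=
        (hR i w hw).continuousAt.div_const _
      refine h2.eventually (Complex.isOpen_slitPlane.mem_nhds ?_)
      change R i w / R i w ∈ Complex.slitPlane
      rw [div_self (hR' i w hw)]
      exact Complex.one_mem_slitPlane
    obtain ⟨ρ, hρ, hV⟩ := Metric.eventually_nhds_iff_ball.1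
      ((eventually_all.2 h1).and (hW.mem_nhds hw))
    -- Dividing by the value at `w` keeps the argument near `1`, away from the cut.
    let ℓ : Fin m → ℂ → ℂ := fun i v => Complex.log (R i v / R i w) + Complex.log (R i w)
    have hℓ : ∀ i, ∀ v ∈ Metric.ball w ρ, AnalyticAt ℂ (ℓ i) v := fun i v hv =>
      (((hR i v (hV v hv).2).div_const).clog ((hV v hv).1 i)).add analyticAt_const
    have hexp : ∀ i, ∀ v ∈ Metric.ball w ρ, Complex.exp (ℓ i v) = R i v := fun i v hv => by
      have h3 := hR' i w hw
      rw [Complex.exp_add, Complex.exp_log (div_ne_zero (hR' i v (hV v hv).2) h3),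
        Complex.exp_log h3, div_mul_cancel₀ _ h3]
    have hder : ∀ i, ∀ v ∈ Metric.ball w ρ, HasDerivAt (ℓ i) (deriv (R i) v / R i v) v := by
      intro i v hv
      have h3 := hR' i w hw
      have h4 := hR' i v (hV v hv).2
      have h5 := (((hR i v (hV v hv).2).differentiableAt.hasDerivAt.div_const (R i w)).clog
        ((hV v hv).1 i)).add_const (Complex.log (R i w))
      refine h5.congr_deriv ?_
      field_simp
    have hG : ∀ v ∈ Metric.ball w ρ,
        HasDerivAt (fun v => Y v - R₀ v - ∑ i, c i * ℓ i v) 0 v := by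
      intro v hv
      have hvW := (hV v hv).2
      have h5 := ((hY v hvW).differentiableAt.hasDerivAt.fun_sub
        (hR₀ v hvW).differentiableAt.hasDerivAt).fun_sub
        (HasDerivAt.fun_sum (u := Finset.univ) fun i _ => (hder i v hv).const_mul (c i))
      refine h5.congr_deriv ?_
      rw [hd v hvW]
      ring
    obtain ⟨C₀, hC₀⟩ := Metric.isOpen_ball.exists_is_const_of_deriv_eq_zero
      (Metric.isPreconnected_ball (x := w) (r := ρ))
      (fun v hv => (hG v hv).differentiableAt.differentiableWithinAt) (fun v hv => (hG v hv).deriv)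
    refine ⟨Metric.ball w ρ, Metric.isOpen_ball, Metric.mem_ball_self hρ, ℓ, C₀, fun v hv =>
      ⟨fun i => ⟨hℓ i v hv, hexp i v hv⟩, ?_⟩⟩
    linear_combination hC₀ v hv
  let A : ℂ → ℂ → Prop := fun C w => ∃ L : Fin m → ℂ → ℂ,
      (∀ i, AnalyticAt ℂ (L i) w ∧ ∀ᶠ v in 𝓝 w, Complex.exp (L i v) = R i v) ∧
      ∀ᶠ v in 𝓝 w, Y v = R₀ v + C + ∑ i, c i * L i v
  obtain ⟨w₀, hw₀⟩ := hne
  obtain ⟨V₀, hV₀, hwV₀, ℓ₀, C, h₀⟩ := hloc w₀ hw₀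
  have hA₀ : A C w₀ := ⟨ℓ₀, fun i => ⟨((h₀ w₀ hwV₀).1 i).1,
    Filter.eventually_of_mem (hV₀.mem_nhds hwV₀) fun v hv => ((h₀ v hv).1 i).2⟩,
    Filter.eventually_of_mem (hV₀.mem_nhds hwV₀) fun v hv => (h₀ v hv).2⟩
  refine ⟨C, fun w hw => ?_⟩
  change A C w
  refine (hWc.induction₂ (fun a b => A C a ↔ A C b) (fun a ha => ?_)
    (fun _ _ _ _ _ _ h h' => h.trans h') (fun _ _ _ _ h => h.symm) hw₀ hw).1 hA₀
  obtain ⟨V, hVo, haV, ℓ, C₀, hV⟩ := hloc a ha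
  -- Branches differ by multiples of `2πi`, so on `V` the constant `C` is admissible at `v` exactly
  -- if `C₀ - C` is a combination `∑ cᵢ nᵢ 2πi`. This does not involve `v`, so admissibility is
  -- locally constant and spreads over the connected `W`.
  have key : ∀ v ∈ V, A C v ↔
      ∃ n : Fin m → ℤ, C₀ = C + ∑ i, c i * (n i * (2 * Real.pi * Complex.I)) := by
    intro v hv
    constructor
    · rintro ⟨L, hL, hLs⟩
      have h1 : ∀ i, ∃ n : ℤ, L i v = ℓ i v + n * (2 * Real.pi * Complex.I) := fun i =>
        Complex.exp_eq_exp_iff_exists_int.1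
          ((hL i).2.self_of_nhds.trans ((hV v hv).1 i).2.symm)
      choose n hn using h1
      refine ⟨n, ?_⟩
      have h2 := hLs.self_of_nhds
      rw [(hV v hv).2] at h2
      simp only [hn, mul_add, Finset.sum_add_distrib] at h2
      linear_combination h2
    · rintro ⟨n, hn⟩
      refine ⟨fun i v => ℓ i v + n i * (2 * Real.pi * Complex.I), fun i =>
        ⟨((hV v hv).1 i).1.add analyticAt_const, ?_⟩, ?_⟩
      · filter_upwards [hVo.mem_nhds hv] with v' hv'
        rw [Complex.exp_add, Complex.exp_int_mul_two_pi_mul_I, mul_one, ((hV v' hv').1 i).2]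
      · filter_upwards [hVo.mem_nhds hv] with v' hv'
        rw [(hV v' hv').2, hn]
        simp only [mul_add, Finset.sum_add_distrib]
        ring
  filter_upwards [mem_nhdsWithin_of_mem_nhds (hVo.mem_nhds haV)] with v hv
  rw [key a haV, key v hv]

variable {U : Type*} [TopologicalSpace U] [ChartedSpace ℂ U] [IsManifold 𝓘(ℂ) ω U]

/-- Multiplying by `dx` gives an identity of derivatives in the chart. On a small punctured disc it
holds pointwise and the `rᵢ` have neither zeros nor poles, so `exists_log_sum` applies. -/
theorem isLogSum_of_logForm {x : U → ℂ} {K : Subalgebra ℂ (U → ℂ)} {p : U}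
    (hx' : toGerm (chartAt ℂ p p) (deriv (inChart x p)) ≠ 0) (hK : ∀ g ∈ K, MerAt g p)
    {y : U → ℂ} (hy : HolAt y p) {m : ℕ} {r₀ : U → ℂ} {r : Fin m → U → ℂ} {c : Fin m → ℂ}
    (hr₀ : r₀ ∈ K) (hr : ∀ i, r i ∈ K) (hr0 : ∀ i, germAt p (r i) ≠ 0)
    (h : derivAt x p (germAt p y) =
      ∑ i, constGerm p (c i) * (derivAt x p (germAt p (r i)) / germAt p (r i)) +
        derivAt x p (germAt p r₀)) : IsLogSum K y p := by
  set z := chartAt ℂ p p with hz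
  have hMr₀ : MeromorphicAt (inChart r₀ p) z := hK r₀ hr₀
  have hMr : ∀ i, MeromorphicAt (inChart (r i) p) z := fun i => hK _ (hr i)
  have hYa : AnalyticAt ℂ (inChart y p) z := hy
  have hder : ∀ a : merGerm z, derivAt x p a =
      (toGerm z (deriv (inChart x p)))⁻¹ * germDeriv z a := fun a => by
    rw [derivAt, germDerivWrt, SelfDeriv.addMul_apply, Derivation.zero_apply, zero_add]
  have h1 : germDeriv z (germAt p y) =
      ∑ i, constGerm p (c i) * (germDeriv z (germAt p (r i)) / germAt p (r i)) +
        germDeriv z (germAt p r₀) := by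
    simp only [hder] at h
    refine mul_left_cancel₀ (inv_ne_zero hx') ?_
    rw [h, mul_add, Finset.mul_sum]
    congr 1
    refine Finset.sum_congr rfl fun i _ => ?_
    ring
  have hterm : ∀ i, MeromorphicAt
      (fun w => c i * (deriv (inChart (r i) p) w / inChart (r i) p w)) z := fun i =>
    (MeromorphicAt.const (c i) z).fun_mul ((hMr i).deriv.fun_div (hMr i))
  have hsum : ∀ s : Finset (Fin m), MeromorphicAt (fun w => ∑ i ∈ s,
      c i * (deriv (inChart (r i) p) w / inChart (r i) p w)) z ∧
      toGerm z (fun w => ∑ i ∈ s, c i * (deriv (inChart (r i) p) w / inChart (r i) p w)) =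
        ∑ i ∈ s, constGerm p (c i) * (germDeriv z (germAt p (r i)) / germAt p (r i)) := by
    intro s
    induction s using Finset.induction_on with
    | empty =>
      simp only [Finset.sum_empty]
      exact ⟨MeromorphicAt.const 0 z, toGerm_zero⟩
    | insert i s hi ih =>
      simp only [Finset.sum_insert hi]
      refine ⟨(hterm i).fun_add ih.1, ?_⟩
      rw [toGerm_add (hterm i) ih.1, ih.2, toGerm_mul (MeromorphicAt.const (c i) z)
        ((hMr i).deriv.fun_div (hMr i)), toGerm_div (hMr i).deriv (hMr i),
        ← germDeriv_toGerm (hMr i)]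
      rfl
  have h2 : ∀ᶠ w in 𝓝[≠] z, deriv (inChart y p) w =
      ∑ i, c i * (deriv (inChart (r i) p) w / inChart (r i) p w) + deriv (inChart r₀ p) w := by
    refine (toGerm_eq_iff hYa.deriv.meromorphicAt ((hsum Finset.univ).1.fun_add hMr₀.deriv)).1 ?_
    rw [toGerm_add (hsum Finset.univ).1 hMr₀.deriv, (hsum Finset.univ).2,
      ← germDeriv_toGerm hYa.meromorphicAt, ← germDeriv_toGerm hMr₀]
    exact h1
  have h3 : ∀ᶠ w in 𝓝[≠] z, ∀ i, AnalyticAt ℂ (inChart (r i) p) w ∧ inChart (r i) p w ≠ 0 := by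
    refine eventually_all.2 fun i => (hMr i).eventually_analyticAt.and ?_
    refine (hMr i).eventually_eq_zero_or_eventually_ne_zero.resolve_left fun h0 => hr0 i ?_
    exact (toGerm_eq_zero_iff (hMr i)).2 h0
  have h4 : ∀ᶠ w in 𝓝[≠] z, AnalyticAt ℂ (inChart y p) w :=
    hYa.eventually_analyticAt.filter_mono nhdsWithin_le_nhds
  obtain ⟨ρ, hρ, hW⟩ := exists_punctured_ball
    (h2.and (h3.and (h4.and hMr₀.eventually_analyticAt)))
  have hWn : Metric.ball z ρ \ {z} ∈ 𝓝[≠] z :=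
    sdiff_mem_nhdsWithin_compl (Metric.ball_mem_nhds z hρ) {z}
  have hWo : IsOpen (Metric.ball z ρ \ {z}) := Metric.isOpen_ball.sdiff isClosed_singleton
  obtain ⟨C, hC⟩ := exists_log_sum hWo (isPreconnected_punctured_ball z hρ)
    (Filter.nonempty_of_mem hWn) (fun w hw => (hW w hw).2.2.1) (fun w hw => (hW w hw).2.2.2)
    (fun i w hw => ((hW w hw).2.1 i).1) (fun i w hw => ((hW w hw).2.1 i).2)
    (fun w hw => (hW w hw).1)
  -- The constant of integration belongs to `K` and joins `r₀`.
  refine ⟨m, r₀ + algebraMap ℂ _ C, r, c, K.add_mem hr₀ (K.algebraMap_mem C), hr, ?_⟩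
  filter_upwards [(tendsto_chart_nhdsNE p).eventually hWn,
    (eventually_mem_chart_source p).filter_mono nhdsWithin_le_nhds] with q hq hqs
  obtain ⟨L, hL, hLs⟩ := hC _ hq
  have hcont := (chartAt ℂ p).continuousAt hqs
  have hsrc : ∀ᶠ u in 𝓝 q, u ∈ (chartAt ℂ p).source := (chartAt ℂ p).open_source.mem_nhds hqs
  refine ⟨fun i u => L i (chartAt ℂ p u), fun i => ⟨?_, ?_⟩, ?_⟩
  · rw [holAt_iff hqs]
    refine (hL i).1.congr ?_
    filter_upwards [(chartAt ℂ p).open_target.mem_nhds ((chartAt ℂ p).map_source hqs)] with w hw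
    simp only [inChart, Function.comp_apply]
    rw [(chartAt ℂ p).right_inv hw]
  · filter_upwards [hcont.eventually (hL i).2, hsrc] with u hu hus
    rw [hu, inChart, Function.comp_apply, (chartAt ℂ p).left_inv hus]
  · filter_upwards [hcont.eventually hLs, hsrc] with u hu hus
    simp only [inChart, Function.comp_apply, (chartAt ℂ p).left_inv hus] at hu
    exact hu

end LogSum

/-! ### Logarithmic sums are elementary -/

section Converse

variable {U : Type*} [TopologicalSpace U] [ChartedSpace ℂ U] {x : U → ℂ}
  {K : Subalgebra ℂ (U → ℂ)}

/-- Near `q` the branch `L` is the composite of `r` with the branch of `ln` at `r q` taking the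
value `L q`. -/
theorem IsLogBranch.exists_isGenElementaryOver {r L : U → ℂ} {q : U} (hr : r ∈ K)
    (hrq : HolAt r q) (h : IsLogBranch r L q) (hLc : ContinuousAt L q) :
    ∃ L', IsGenElementaryOver x K L' q ∧ L' =ᶠ[𝓝 q] L := by
  have hr0 : r q ≠ 0 := by
    rw [← h.2.self_of_nhds]
    exact Complex.exp_ne_zero _
  have hslit : r q / r q ∈ Complex.slitPlane := by
    rw [div_self hr0]
    exact Complex.one_mem_slitPlane
  have hlog : IsGenElementary (fun z => Complex.log (z / r q) + L q) (r q) := by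
    refine .basic (.log _ _ ?_ ?_)
    · exact ((analyticAt_id.div_const).clog hslit).add analyticAt_const
    · filter_upwards [isOpen_ne.mem_nhds hr0] with z hz
      rw [Complex.exp_add, Complex.exp_log (div_ne_zero hz hr0), h.2.self_of_nhds,
        div_mul_cancel₀ _ hr0]
  refine ⟨_, .comp hlog (.basic hr hrq), ?_⟩
  -- In this strip the principal logarithm inverts the exponential.
  have him : ∀ᶠ u in 𝓝 q, |(L u - L q).im| < Real.pi := by
    have h1 : ContinuousAt (fun u => |(L u - L q).im|) q :=
      (Complex.continuous_im.continuousAt.comp (hLc.sub continuousAt_const)).abs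
    refine h1.eventually (gt_mem_nhds ?_)
    simpa using Real.pi_pos
  filter_upwards [h.2, him] with u hu hu'
  rw [abs_lt] at hu'
  rw [← hu, ← h.2.self_of_nhds, ← Complex.exp_sub, Complex.log_exp hu'.1 hu'.2.le]
  ring

theorem IsGenElementaryOver.sum {m : ℕ} {c : Fin m → ℂ} {L : Fin m → U → ℂ} {q : U}
    (hL : ∀ i, IsGenElementaryOver x K (L i) q) (s : Finset (Fin m)) :
    IsGenElementaryOver x K (fun u => ∑ i ∈ s, c i * L i u) q := by
  have hconst : ∀ c : ℂ, IsGenElementaryOver x K (fun _ => c) q := fun c =>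
    .basic (K.algebraMap_mem c) (HolAt.const c q)
  induction s using Finset.induction_on with
  | empty =>
    simp only [Finset.sum_empty]
    exact hconst 0
  | insert i s hi ih =>
    simp only [Finset.sum_insert hi]
    exact ((hconst (c i)).mul (hL i)).add ih

theorem exists_isOpen_isPreconnected {p : U} {P : U → Prop} (h : ∀ᶠ q in 𝓝 p, P q) :
    ∃ W : Set U, IsOpen W ∧ IsPreconnected W ∧ p ∈ W ∧ ∀ w ∈ W, P w := by
  have h1 : ∀ᶠ w in 𝓝 (chartAt ℂ p p), w ∈ (chartAt ℂ p).target ∧ P ((chartAt ℂ p).symm w) :=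
    Filter.Eventually.and ((chartAt ℂ p).open_target.mem_nhds (mem_chart_target ℂ p))
      (eventually_nhds_chart.2 h)
  obtain ⟨ρ, hρ, hV⟩ := Metric.eventually_nhds_iff_ball.1 h1
  have hsub : Metric.ball (chartAt ℂ p p) ρ ⊆ (chartAt ℂ p).target := fun w hw => (hV w hw).1
  refine ⟨(chartAt ℂ p).symm '' Metric.ball (chartAt ℂ p p) ρ, ?_, ?_, ?_, ?_⟩
  · exact (chartAt ℂ p).symm.isOpen_image_of_subset_source Metric.isOpen_ball hsub
  · exact Metric.isPreconnected_ball.image _ ((chartAt ℂ p).continuousOn_symm.mono hsub)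
  · exact ⟨_, Metric.mem_ball_self hρ, (chartAt ℂ p).left_inv (mem_chart_source ℂ p)⟩
  · rintro _ ⟨w, hw, rfl⟩
    exact (hV w hw).2

variable [IsManifold 𝓘(ℂ) ω U]

/-- At `p` itself some `rᵢ` may be singular. The identity is used at a nearby `q`, and `y`,
holomorphic on a disc containing both points, carries it back to `p`. -/
theorem IsLogSum.isGenElementaryOver (hK : ∀ g ∈ K, IsMeromorphic g) {y : U → ℂ} {p : U}
    (hy : HolAt y p) (h : IsLogSum K y p) : IsGenElementaryOver x K y p := by
  obtain ⟨m, r₀, r, c, hr₀, hr, h⟩ := h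
  obtain ⟨W, hWo, hWc, hpW, hW⟩ := exists_isOpen_isPreconnected hy.eventually
  have h1 : ∀ᶠ q in 𝓝[≠] p, ∀ i, HolAt (r i) q :=
    eventually_all.2 fun i => MerAt.eventually_holAt (hK _ (hr i) p)
  have h2 : ∀ᶠ q in 𝓝[≠] p, HolAt r₀ q := MerAt.eventually_holAt (hK _ hr₀ p)
  obtain ⟨q, ⟨L, hL, hLs⟩, hq1, hq2, hqW⟩ :=
    (h.and (h1.and (h2.and (mem_nhdsWithin_of_mem_nhds (hWo.mem_nhds hpW))))).exists
  choose L' hL' hLL' using fun i =>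
    (hL i).exists_isGenElementaryOver (x := x) (hr i) (hq1 i) (hL i).1.continuousAt
  refine .continuation (.add (.basic hr₀ hq2) (IsGenElementaryOver.sum (c := c) hL' Finset.univ))
    ⟨W, hWo, hWc, hqW, hpW, y, hW, ?_, EventuallyEq.rfl⟩
  filter_upwards [hLs, eventually_all.2 hLL'] with u hu hu'
  rw [hu]
  simp only [hu']

end Converse

end Liouville

end

theorem mainTheorem1 {U : Type*} [TopologicalSpace U] [T2Space U] [ConnectedSpace U]
    [ChartedSpace ℂ U] [IsManifold 𝓘(ℂ) ω U]
    (x : U → ℂ) (hx : Liouville.IsMeromorphic x) (hx' : Liouville.IsNonconstant x)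
    (K : Subalgebra ℂ (U → ℂ)) (hK : Liouville.IsFunctionalDifferentialField x K)
    (f : U → ℂ) (hf : f ∈ K)
    (y : U → ℂ) (p : U) (hy : Liouville.IsIntegralOf x f y p) :
    Liouville.IsGenElementaryOver x K y p ↔ Liouville.IsLogSum K y p := by
  refine ⟨fun h => ?_, fun h => h.isGenElementaryOver hK.meromorphic hy.1⟩
  have hne := Liouville.toGerm_deriv_ne_zero hx hx' p
  obtain ⟨m, r₀, r, c, hr₀, hr, hr0, he⟩ :=
    (h.elemGerm hx hx' hK).exists_logForm (hx p) hne hK hf hy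
  exact Liouville.isLogSum_of_logForm hne (fun g hg => hK.meromorphic g hg p) hy.1 hr₀ hr
    hr0 he
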